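/- **Setting.** Let $G$ be a connected Feynman graph with $N$ massless propagators and external legs $p_1,\dots,p_K$ and $q_1,\dots,q_M$. Choose Mandelstam variables $\boldsymbol s=(\boldsymbol t,\boldsymbol\sigma)$, where $\boldsymbol t=(p_1^2,\dots,p_K^2)$ and $\boldsymbol\sigma=\boldsymbol s\setminus\boldsymbol t$: for every set $A$ of legs the squared total momentum $s_A$ is a linear function of $\boldsymbol s$, with $s_\emptyset=0$, $s_{A^c}=s_A$ and $s_{\{p_i\}}=p_i^2$. Let $$\mathcal U=\sum_{T}\prod_{e\notin T}x_e,\qquad \mathcal F=-\sum_{F}s_{F}\prod_{e\notin F}x_e,\qquad \mathcal P=\mathcal U+\mathcal F,$$ where $T$ runs over the spanning trees, $F$ over the spanning 2-trees, and $s_F$ is the squared momentum flowing between the two trees of $F$. With $L$ loops, dimension $D=4-2\epsilon$ and propagator exponents $\nu_e$, the dimensionally regularised integral is $$I=\frac{\Gamma(D/2)}{\Gamma\big((L+1)\tfrac D2-\sum_e\nu_e\big)\prod_e\Gamma(\nu_e)}\int_{x_e>0}\prod_e\frac{dx_e}{x_e}\ \mathcal I(\boldsymbol x;\boldsymbol t,\boldsymbol\sigma),\qquad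 \mathcal I=\Big(\prod_e x_e^{\nu_e}\Big)\,\mathcal P(\boldsymbol x;\boldsymbol t,\boldsymbol\sigma)^{-D/2}.$$ Kinematics are wide-angle: every $p_i^2$, and every $s_F$ whose channel is neither trivial nor one of the single legs $p_i$, evaluated at $\boldsymbol t=0$, is negative or has positive imaginary part. **Regions.** The on-shell expansion rescales $\boldsymbol t\to\lambda\boldsymbol t$, $\lambda\to0^+$. A region $R$ assigns each propagator to the hard subgraph $H$, to one of the jets $J_1,\dots,J_K$, or to the soft subgraph $S$, with $u_{R,e}=0,-1,-2$ respectively, such that: (i) a vertex belongs to $S$ if it has propagators and all of them are soft, to $J_i$ if it has a propagator of $J_i$ and all its propagators are in $J_i$ or $S$, and to $H$ otherwise; (ii) $H$ is non-empty and connected and all $q_j$ are attached to it; (iii) each $J_i$ is connected, and either contains a propagator, is attached to $H$ and has $p_i$ attached to it, or has no propagator, in which case $p_i$ is attached to $H$; (iv) every connected component of $S$ is attached to $G\setminus S$; (v) $(\boldsymbol u_R;1)$ is an inward normal vector of a lower facet (a face of dimension $N$) of the Newton polytope of $\mathcal P(\boldsymbol x;\lambda\boldsymbol t,\boldsymbol\sigma)$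 in the variables $(\boldsymbol x,\lambda)$. Let $p_R=\boldsymbol u_R\cdot\boldsymbol\nu-\tfrac D2\min_{\boldsymbol r}\,(\boldsymbol u_R;1)\cdot\boldsymbol r$, where $\boldsymbol r$ runs over the exponent vectors of $\mathcal P(\boldsymbol x;\lambda\boldsymbol t,\boldsymbol\sigma)$. The term of order $n\ge0$ of the expansion in $R$, denoted $\mathcal T^{(R)}_{\boldsymbol t,n}I$, is $I$ with $\mathcal I$ replaced by $$\frac1{n!}\,\frac{d^n}{d\lambda^n}\Big[\lambda^{-p_R}\,\mathcal I\big((\lambda^{u_{R,e}}x_e)_e;\lambda\boldsymbol t,\boldsymbol\sigma\big)\Big]_{\lambda\to0^+},$$ defined by meromorphic continuation in $(\boldsymbol\nu,D)$ from the (non-empty) domain of absolute convergence, at points where the continuation is regular; the all-order expansion is $\mathcal T^{(R)}_{\boldsymbol t}I=\sum_{n\ge0}\mathcal T^{(R)}_{\boldsymbol t,n}I$. The region is *jet-pairing soft* if each connected component of $S$ is attached to exactly two of the jets (this includes $S=\emptyset$). **Theorem.** Let $R$ be a jet-pairing soft region and fix $\boldsymbol\nu$. Then there are functions $\rho_{R,i}(\epsilon)$,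 linear in $\epsilon$ (that is, $\rho_{R,i}(\epsilon)=a_i+b_i\epsilon$), and, for every $\epsilon$, coefficients $\overline{\mathcal I}_{\boldsymbol k}(\boldsymbol s\setminus\boldsymbol t)$, $\boldsymbol k\in\mathbb Z_{\ge0}^K$, which do not depend on any of the $p_i^2$, such that at all wide-angle kinematic points $$\mathcal T^{(R)}_{\boldsymbol t}I=\Big(\prod_{i=1}^K(p_i^2)^{\rho_{R,i}(\epsilon)}\Big)\cdot\sum_{k_1,\dots,k_K\ge0}\Big(\prod_{i=1}^K(-p_i^2)^{k_i}\Big)\,\overline{\mathcal I}_{\boldsymbol k}(\boldsymbol s\setminus\boldsymbol t).$$ Precisely, with principal powers: (1) order by order, for every $n$ at which it is regular, $$\mathcal T^{(R)}_{\boldsymbol t,n}I=\Big(\prod_i(p_i^2)^{\rho_{R,i}(\epsilon)}\Big)\sum_{k_1+\dots+k_K=n}\Big(\prod_i(-p_i^2)^{k_i}\Big)\,\overline{\mathcal I}_{\boldsymbol k}(\boldsymbol s\setminus\boldsymbol t);$$ (2) if all orders are regular, then wherever the multivariate power series converges absolutely, the all-order expansion converges and the identity holds between sums. -/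

import Mathlib

open Set Filter Topology MeasureTheory

/-! ### Graphs and spanning forests -/

/-- A connected Feynman graph with vertices `V`, massless propagators `E` (several propagators may
join the same vertices), external legs `p_1, …, p_K` (taken on shell in the expansion) and
`q_1, …, q_M` (which stay off shell). -/
structure FeynmanGraph (V E : Type*) (K M : ℕ) where
  /-- the end points of a propagator -/
  ends : E → Sym2 V
  /-- the vertex where an external leg is attached -/
  leg : Fin K ⊕ Fin M → V
  /-- the graph is connected -/
  connected : (SimpleGraph.fromEdgeSet (Set.range ends)).Connected

namespace FeynmanGraph

variable {V E : Type*} [Fintype V] [Fintype E] {K M m : ℕ}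

/-- The spanning subgraph of `G` with propagators `F`, up to multiplicities. -/
def spanning (G : FeynmanGraph V E K M) (F : Finset E) : SimpleGraph V :=
  SimpleGraph.fromEdgeSet (G.ends '' (F : Set E))

/-- `F` is the set of propagators of a spanning forest with exactly `k` trees: it has `k`
connected components and, by Euler's formula, no cycle. For `k = 1` these are the spanning trees,
for `k = 2` the spanning 2-trees. -/
def IsSpanningForest (G : FeynmanGraph V E K M) (k : ℕ) (F : Finset E) : Prop :=
  Nat.card (G.spanning F).ConnectedComponent = k ∧ F.card + k = Fintype.card V

open Classical in
/-- The finite set of spanning forests with `k` trees. -/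
noncomputable def forests (G : FeynmanGraph V E K M) (k : ℕ) : Finset (Finset E) :=
  Finset.univ.filter (G.IsSpanningForest k)

/-- A graph is connected, hence has a vertex; this is one of them. -/
noncomputable def root (G : FeynmanGraph V E K M) : V :=
  Classical.choice G.connected.nonempty

open Classical in
/-- The external legs attached to one of the two trees of a spanning 2-tree (the one that contains
`root`). The other tree carries the complementary legs, and opposite total momentum. -/
noncomputable def channel (G : FeynmanGraph V E K M) (F : Finset E) : Finset (Fin K ⊕ Fin M) :=
  Finset.univ.filter fun l => (G.spanning F).Reachable G.root (G.leg l)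

/-- The number of loops. -/
def loops (_G : FeynmanGraph V E K M) : ℕ :=
  Fintype.card E + 1 - Fintype.card V

end FeynmanGraph

/-! ### Kinematics -/

/-- The momentum through the channel `A` is `± p_i`. -/
def IsOnShellChannel {K M : ℕ} (A : Finset (Fin K ⊕ Fin M)) : Prop :=
  ∃ i : Fin K, A = {Sum.inl i} ∨ Aᶜ = {Sum.inl i}

/-- The channel `A` carries a momentum that is neither zero nor one of the `± p_i`. -/
def IsHardChannel {K M : ℕ} (A : Finset (Fin K ⊕ Fin M)) : Prop :=
  A ≠ ∅ ∧ Aᶜ ≠ ∅ ∧ ¬ IsOnShellChannel A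

/-- A choice of Mandelstam variables `s`: the virtualities `t i = p_i ^ 2`, and `m` further
invariants `σ`, which form `s ∖ t`. The square `inv A` of the total momentum of the legs in `A`
is a linear function of these variables; total momentum is conserved. -/
structure Kinematics (K M m : ℕ) where
  /-- the square of the total momentum of the legs in `A` -/
  inv : Finset (Fin K ⊕ Fin M) → ((Fin K → ℂ) × (Fin m → ℂ)) →ₗ[ℂ] ℂ
  inv_empty : inv ∅ = 0
  inv_compl : ∀ A, inv Aᶜ = inv A
  inv_onShell : ∀ i t σ, inv {Sum.inl i} (t, σ) = t i

/-- Kinematics from scalar products of momenta: the scalar products of the external momenta are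
linear in the chosen Mandelstam variables, they form a symmetric matrix whose rows sum to zero
(momentum conservation), and `p_i · p_i = t i`. -/
noncomputable def Kinematics.ofGram {K M m : ℕ}
    (gram : ((Fin K → ℂ) × (Fin m → ℂ)) →ₗ[ℂ] Matrix (Fin K ⊕ Fin M) (Fin K ⊕ Fin M) ℂ)
    (symm : ∀ s a b, gram s a b = gram s b a)
    (conservation : ∀ s a, ∑ b, gram s a b = 0)
    (onShell : ∀ i t σ, gram (t, σ) (Sum.inl i) (Sum.inl i) = t i) : Kinematics K M m where
  inv A := ∑ a ∈ A, ∑ b ∈ A, Matrix.entryLinearMap ℂ ℂ a b ∘ₗ gram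
  inv_empty := by simp
  inv_compl A := by
    refine LinearMap.ext fun s => ?_
    have row (B : Finset (Fin K ⊕ Fin M)) (a) :
        ∑ b ∈ B, gram s a b = - ∑ b ∈ Bᶜ, gram s a b := by
      rw [eq_neg_iff_add_eq_zero, Finset.sum_add_sum_compl, conservation]
    simp only [LinearMap.sum_apply, LinearMap.comp_apply, Matrix.entryLinearMap_apply]
    calc ∑ a ∈ Aᶜ, ∑ b ∈ Aᶜ, gram s a b
        = - ∑ a ∈ Aᶜ, ∑ b ∈ A, gram s a b := by
          rw [← Finset.sum_neg_distrib]
          exact Finset.sum_congr rfl fun a _ => by rw [row A, neg_neg]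
      _ = - ∑ b ∈ A, ∑ a ∈ Aᶜ, gram s b a :=
          congrArg Neg.neg (Finset.sum_comm.trans (Finset.sum_congr rfl fun b _ =>
            Finset.sum_congr rfl fun a _ => symm s a b))
      _ = ∑ b ∈ A, ∑ a ∈ A, gram s b a := by
          rw [← Finset.sum_neg_distrib]
          exact Finset.sum_congr rfl fun b _ => by rw [row A]
  inv_onShell i t σ := by simp [onShell]

/-- The values that an invariant may take: spacelike (negative), or with positive imaginary part,
as in Feynman's prescription `s + i 0`. -/
def feynmanDomain : Set ℂ :=
  {z | 0 < z.im ∨ (z.im = 0 ∧ z.re < 0)}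

namespace FeynmanGraph

variable {V E : Type*} [Fintype V] [Fintype E] {K M m : ℕ}

/-- Wide-angle kinematics at the point `(t, σ)`: the small virtualities and all the other
invariants that occur in the graph, the latter in the limit `t → 0`, are non-zero, with
Feynman's prescription. -/
structure WideAngle (G : FeynmanGraph V E K M) (kin : Kinematics K M m)
    (t : Fin K → ℂ) (σ : Fin m → ℂ) : Prop where
  onShell : ∀ i, t i ∈ feynmanDomain
  hard : ∀ F ∈ G.forests 2, IsHardChannel (G.channel F) →
    kin.inv (G.channel F) (0, σ) ∈ feynmanDomain

/-! ### The Lee-Pomeransky representation -/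

open Classical in
/-- The Lee-Pomeransky polynomial: the sum of the two Symanzik polynomials. -/
noncomputable def lpPoly (G : FeynmanGraph V E K M) (kin : Kinematics K M m)
    (x : E → ℝ) (t : Fin K → ℂ) (σ : Fin m → ℂ) : ℂ :=
  (∑ T ∈ G.forests 1, ∏ e ∈ Finset.univ.filter (· ∉ T), (x e : ℂ)) +
    -∑ F ∈ G.forests 2,
      kin.inv (G.channel F) (t, σ) * ∏ e ∈ Finset.univ.filter (· ∉ F), (x e : ℂ)

/-- The Lee-Pomeransky integrand in dimension `D`, with propagator exponents `ν`. -/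
noncomputable def lpIntegrand (G : FeynmanGraph V E K M) (kin : Kinematics K M m)
    (ν : E → ℂ) (D : ℂ) (x : E → ℝ) (t : Fin K → ℂ) (σ : Fin m → ℂ) : ℂ :=
  (∏ e, (x e : ℂ) ^ ν e) * (G.lpPoly kin x t σ) ^ (-D / 2)

/-- The constant in the measure `[dx]`. -/
noncomputable def lpConst (G : FeynmanGraph V E K M) (ν : E → ℂ) (D : ℂ) : ℂ :=
  Complex.Gamma (D / 2) /
    (Complex.Gamma ((G.loops + 1) * D / 2 - ∑ e, ν e) * ∏ e, Complex.Gamma (ν e))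

/-! ### The Newton polytope and its lower facets -/

open Classical in
/-- The exponents of `x` in the monomial of the forest `F`. -/
noncomputable def exponent (_G : FeynmanGraph V E K M) (F : Finset E) : E → ℝ :=
  fun e => if e ∈ F then 0 else 1

/-- The exponent vectors of the monomials in `x` and `lam` of the Lee-Pomeransky polynomial with
rescaled virtualities `p_i ^ 2 → lam * p_i ^ 2`. -/
def newtonPoints (G : FeynmanGraph V E K M) : Set ((E → ℝ) × ℝ) :=
  {r | ∃ T ∈ G.forests 1, r = (G.exponent T, 0)} ∪
  {r | ∃ F ∈ G.forests 2, IsHardChannel (G.channel F) ∧ r = (G.exponent F, 0)} ∪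
  {r | ∃ F ∈ G.forests 2, IsOnShellChannel (G.channel F) ∧ r = (G.exponent F, 1)}

/-- The Newton polytope. -/
def newtonPolytope (G : FeynmanGraph V E K M) : Set ((E → ℝ) × ℝ) :=
  convexHull ℝ G.newtonPoints

/-- The pairing of `(u; 1)` with an exponent vector. -/
def weight (u : E → ℝ) (r : (E → ℝ) × ℝ) : ℝ :=
  (∑ e, u e * r.1 e) + r.2

/-- `(u; 1)` is an inward normal vector of a lower facet of the Newton polytope: the face where
it is minimal has dimension `N`, the number of propagators. -/
def IsLowerFacetNormal (G : FeynmanGraph V E K M) (u : E → ℝ) : Prop :=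
  Module.finrank ℝ (vectorSpan ℝ
    {r ∈ G.newtonPolytope | ∀ r' ∈ G.newtonPolytope, weight u r ≤ weight u r'}) = Fintype.card E

/-- The minimum of `(u; 1)` on the exponent vectors: the power of `lam` that the polynomial
behaves like. -/
noncomputable def minWeight (G : FeynmanGraph V E K M) (u : E → ℝ) : ℝ :=
  sInf (weight u '' G.newtonPoints)

/-- The power of `lam` that the integrand behaves like. -/
noncomputable def leadingPower (G : FeynmanGraph V E K M) (u : E → ℝ) (ν : E → ℂ) (D : ℂ) : ℂ :=
  (∑ e, (u e : ℂ) * ν e) - (G.minWeight u : ℂ) * D / 2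

end FeynmanGraph

/-! ### Regions -/

/-- The class of a propagator: hard, collinear to some `p_i`, or soft. -/
inductive Mode (K : ℕ) where
  | hard : Mode K
  | jet (i : Fin K) : Mode K
  | soft : Mode K

/-- The power of `lam` with which the Lee-Pomeransky parameter of a propagator scales. -/
def Mode.scaling {K : ℕ} : Mode K → ℝ
  | .hard => 0
  | .jet _ => -1
  | .soft => -2

namespace FeynmanGraph

variable {V E : Type*} [Fintype V] [Fintype E] {K M m : ℕ}

/-- A vertex is soft if it has propagators, and only soft ones. -/
def IsSoftVertex (G : FeynmanGraph V E K M) (part : E → Mode K) (v : V) : Prop :=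
  (∃ e, v ∈ G.ends e) ∧ ∀ e, v ∈ G.ends e → part e = .soft

/-- A vertex is in the `i`-th jet if it has a propagator of this jet, possibly soft propagators,
and no others. -/
def IsJetVertex (G : FeynmanGraph V E K M) (part : E → Mode K) (i : Fin K) (v : V) : Prop :=
  (∃ e, v ∈ G.ends e ∧ part e = .jet i) ∧
    ∀ e, v ∈ G.ends e → part e = .jet i ∨ part e = .soft

/-- All other vertices are hard. -/
def IsHardVertex (G : FeynmanGraph V E K M) (part : E → Mode K) (v : V) : Prop :=
  ¬ G.IsSoftVertex part v ∧ ∀ i, ¬ G.IsJetVertex part i v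

/-- The incidence graph of `G`, whose nodes are the vertices and the propagators. Connectedness of
the parts `H`, `J_i`, `S`, each of which is a set of vertices and propagators, is connectedness in
this graph. -/
def incidence (G : FeynmanGraph V E K M) : SimpleGraph (V ⊕ E) :=
  SimpleGraph.fromRel fun a b => ∃ v e, a = Sum.inl v ∧ b = Sum.inr e ∧ v ∈ G.ends e

/-- The hard subgraph `H`. -/
def hardPart (G : FeynmanGraph V E K M) (part : E → Mode K) : Set (V ⊕ E) :=
  {a | Sum.elim (G.IsHardVertex part) (fun e => part e = .hard) a}

/-- The jet subgraph `J_i`. -/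
def jetPart (G : FeynmanGraph V E K M) (part : E → Mode K) (i : Fin K) : Set (V ⊕ E) :=
  {a | Sum.elim (G.IsJetVertex part i) (fun e => part e = .jet i) a}

/-- The soft subgraph `S`. -/
def softPart (G : FeynmanGraph V E K M) (part : E → Mode K) : Set (V ⊕ E) :=
  {a | Sum.elim (G.IsSoftVertex part) (fun e => part e = .soft) a}

/-- The connected components of the soft subgraph. Vertices of `H` or of a jet do not belong to
it, so they do not connect soft propagators. -/
abbrev SoftComponent (G : FeynmanGraph V E K M) (part : E → Mode K) :=
  (G.incidence.induce (G.softPart part)).ConnectedComponent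

/-- The vertex `v` is an end point of a propagator of the soft component `c`. -/
def SoftComponent.Meets {G : FeynmanGraph V E K M} {part : E → Mode K}
    (c : G.SoftComponent part) (v : V) : Prop :=
  ∃ a : G.softPart part, (G.incidence.induce (G.softPart part)).connectedComponentMk a = c ∧
    ∃ e, (a : V ⊕ E) = Sum.inr e ∧ v ∈ G.ends e

/-- The division of the graph into hard, jet and soft subgraphs `H`, `J_1, …, J_K`, `S` is that of
a wide-angle scattering process. A jet may be empty, and then its leg is attached to `H`. -/
structure IsScatteringPicture (G : FeynmanGraph V E K M) (part : E → Mode K) : Prop where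
  /-- `H` is connected (and not empty) -/
  hard_connected : (G.incidence.induce (G.hardPart part)).Connected
  /-- the off-shell momenta are attached to `H` -/
  offShell_hard : ∀ j, G.IsHardVertex part (G.leg (Sum.inr j))
  /-- each jet is connected -/
  jet_connected : ∀ i, (G.incidence.induce (G.jetPart part i)).Preconnected
  /-- each (non-empty) jet is attached to `H` -/
  jet_attached : ∀ i, (∃ e, part e = .jet i) →
    ∃ e, part e = .jet i ∧ ∃ v ∈ G.ends e, G.IsHardVertex part v
  /-- the leg `p_i` is attached to the `i`-th jet -/
  onShell_jet : ∀ i, G.IsJetVertex part i (G.leg (Sum.inl i)) ∨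
    (G.IsHardVertex part (G.leg (Sum.inl i)) ∧ ∀ e, part e ≠ .jet i)
  /-- each soft component is attached to the rest of the graph -/
  soft_attached : ∀ c : G.SoftComponent part, ∃ v, c.Meets v ∧ ¬ G.IsSoftVertex part v

/-- The vector `u_R`. -/
def regionVector (part : E → Mode K) : E → ℝ :=
  fun e => (part e).scaling

/-- A region of the on-shell expansion: a scattering picture whose region vector is the normal
vector of a lower facet of the Newton polytope. -/
def IsRegion (G : FeynmanGraph V E K M) (part : E → Mode K) : Prop :=
  G.IsScatteringPicture part ∧ G.IsLowerFacetNormal (regionVector part)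

/-- Each connected component of the soft subgraph is attached to exactly two jets. -/
def IsJetPairingSoft (G : FeynmanGraph V E K M) (part : E → Mode K) : Prop :=
  ∀ c : G.SoftComponent part, {i | ∃ v, c.Meets v ∧ G.IsJetVertex part i v}.ncard = 2

/-! ### The expansion in a region -/

/-- The integrand with rescaled parameters and virtualities, divided by its leading power. -/
noncomputable def rescaledIntegrand (G : FeynmanGraph V E K M) (kin : Kinematics K M m)
    (u : E → ℝ) (ν : E → ℂ) (D : ℂ) (x : E → ℝ) (t : Fin K → ℂ) (σ : Fin m → ℂ) (lam : ℝ) : ℂ :=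
  (lam : ℂ) ^ (-G.leadingPower u ν D) *
    G.lpIntegrand kin ν D (fun e => lam ^ u e * x e) (fun i => lam * t i) σ

/-- The coefficient of `lam ^ n` in the Taylor expansion of the rescaled integrand. -/
noncomputable def taylorIntegrand (G : FeynmanGraph V E K M) (kin : Kinematics K M m)
    (u : E → ℝ) (n : ℕ) (t : Fin K → ℂ) (σ : Fin m → ℂ) (ν : E → ℂ) (D : ℂ) (x : E → ℝ) : ℂ :=
  limUnder (𝓝[>] (0 : ℝ)) (iteratedDeriv n (G.rescaledIntegrand kin u ν D x t σ)) / n.factorial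

end FeynmanGraph

/-- `v` is the value at `z` of the meromorphic continuation of the function
`z ↦ c z * ∫ f z x ∏ dx_e / x_e`, which is given by an integral over positive `x` where that
converges absolutely. The parameters `z` are the propagator exponents and the dimension. -/
def IsRegularisedIntegral {E : Type*} [Fintype E] (c : (E → ℂ) × ℂ → ℂ)
    (f : (E → ℂ) × ℂ → (E → ℝ) → ℂ) (z : (E → ℂ) × ℂ) (v : ℂ) : Prop :=
  let g : (E → ℂ) × ℂ → (E → ℝ) → ℂ := fun y x => f y x * ∏ e, ((x e)⁻¹ : ℂ)
  let W : Set ((E → ℂ) × ℂ) := interior {y | IntegrableOn (g y) {x | ∀ e, 0 < x e}}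
  W.Nonempty ∧ ∃ A B : (E → ℂ) × ℂ → ℂ,
    AnalyticOnNhd ℂ A univ ∧ AnalyticOnNhd ℂ B univ ∧
    (∀ y ∈ W, A y = B y * (c y * ∫ x in {x | ∀ e, 0 < x e}, g y x)) ∧
    B z ≠ 0 ∧ v = A z / B z

/-- `v` is the term of order `n` of the expansion of the dimensionally regularised Feynman integral
in the region with the given subgraphs, at propagator exponents `ν` and dimension `D`. -/
def FeynmanGraph.IsRegionTerm {V E : Type*} [Fintype V] [Fintype E] {K M m : ℕ}
    (G : FeynmanGraph V E K M) (kin : Kinematics K M m) (part : E → Mode K) (n : ℕ)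
    (t : Fin K → ℂ) (σ : Fin m → ℂ) (ν : E → ℂ) (D : ℂ) (v : ℂ) : Prop :=
  IsRegularisedIntegral (fun z => G.lpConst z.1 z.2)
    (fun z => G.taylorIntegrand kin (FeynmanGraph.regionVector part) n t σ z.1 z.2) (ν, D) v

/-! The region vector splits into one vector per jet. A propagator gets `-1` from each jet on which
it depends: a jet propagator from its own jet, a soft one from the jets to which its soft component
is attached. As each soft component is attached to exactly two jets, the sum over the jets is `0`,
`-1`, `-2`, as it must be (`scaling_eq_neg_card`).

Fix a jet `i` and rescale `p_i ^ 2` by a factor and the parameters in `jetEdges i` by its inverse.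
Up to a constant, the weight of a monomial is the number of propagators of its forest in `jetEdges
i`, plus its degree in `p_i ^ 2`. Every monomial has at least the weight `jetWeight i`: a spanning
tree has at least `jetRank i` such propagators, a spanning 2-tree at least one less, and if it has
one less then its channel is trivial or `p_i`, so that a monomial that occurs carries a compensating
factor `p_i ^ 2` (`channel_of_card_lt`). One tree attains the minimum for all jets at once
(`exists_tree`). Hence a monomial is leading in the region if and only if its excess vanishes for
every jet, and the leading polynomial is homogeneous under `K` independent rescalings. The Taylor
term of order `n` is then a sum of parts of multidegree `k` with `∑ i, k i = n`, and a change of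
variables in the scale invariant measure gives the part `k` the degree `ρ i + k i` in each `p_i ^
2`, for positive factors (`partIntegral_rescale`).

Complex virtualities need analysis. The facet condition says that the Newton polytope of the leading
monomials has interior points, and power counting around one of them gives an open set of exponents
and dimensions with absolute convergence (`norm_power_mul_le`). Feynman's prescription keeps the
leading coefficients in a half-plane, so the integral is holomorphic in the virtualities, and
homogeneity extends from positive factors to phases (`partIntegral_eq_exp`). The resulting formula
is linear in unknown coefficients; its consequences that do not mention them are analytic
identities, which survive the continuation in the exponents and the dimension
(`exists_coefficients_of_continuation`). -/

/-! ### Connected components of a graph when one edge is added. -/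

namespace SimpleGraph

variable {V : Type*} {G : SimpleGraph V}

/-- Adding one edge joins at most two classes of mutually reachable vertices. -/
lemma Reachable.of_sup_edge {a b v w : V} (h : (G ⊔ edge a b).Reachable v w) :
    G.Reachable v w ∨ (G.Reachable v a ∧ G.Reachable b w) ∨
      (G.Reachable v b ∧ G.Reachable a w) := by
  rw [reachable_iff_reflTransGen] at h
  induction h with
  | refl => exact Or.inl (Reachable.refl _)
  | @tail x y _ hxy ih =>
    rw [sup_adj, edge_adj] at hxy
    rcases hxy with hxy | ⟨⟨rfl, rfl⟩ | ⟨rfl, rfl⟩, _⟩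
    · have := hxy.reachable
      rcases ih with h | ⟨h, h'⟩ | ⟨h, h'⟩
      · exact Or.inl (h.trans this)
      · exact Or.inr (Or.inl ⟨h, h'.trans this⟩)
      · exact Or.inr (Or.inr ⟨h, h'.trans this⟩)
    · rcases ih with h | ⟨h, h'⟩ | ⟨h, h'⟩
      · exact Or.inr (Or.inl ⟨h, Reachable.refl _⟩)
      · exact Or.inr (Or.inl ⟨h, Reachable.refl _⟩)
      · exact Or.inl h
    · rcases ih with h | ⟨h, h'⟩ | ⟨h, h'⟩
      · exact Or.inr (Or.inr ⟨h, Reachable.refl _⟩)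
      · exact Or.inl h
      · exact Or.inr (Or.inr ⟨h, Reachable.refl _⟩)

/-- The only two components that can merge are those of `a` and `b`. Sending the component of `b` to
`none` therefore makes the map to the components of the larger graph injective. -/
lemma card_connectedComponent_le_sup_edge [Finite V] (a b : V) :
    Nat.card G.ConnectedComponent ≤ Nat.card (G ⊔ edge a b).ConnectedComponent + 1 := by
  classical
  rw [← Finite.card_option]
  let f : G.ConnectedComponent → Option (G ⊔ edge a b).ConnectedComponent := fun c =>
    if c = G.connectedComponentMk b then none
    else some (c.map (Hom.ofLE le_sup_left))
  refine Nat.card_le_card_of_injective f fun c d hcd => ?_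
  induction c using ConnectedComponent.ind with | _ v
  induction d using ConnectedComponent.ind with | _ w
  simp only [f] at hcd
  split_ifs at hcd with hv hw hw
  · rw [hv, hw]
  · simp only [Option.some.injEq, ConnectedComponent.map_mk, ConnectedComponent.eq] at hcd
    rw [ConnectedComponent.eq] at hv hw ⊢
    rcases hcd.of_sup_edge with h | ⟨h, h'⟩ | ⟨h, h'⟩
    · exact h
    · exact absurd h'.symm hw
    · exact absurd h hv

/-- The surjection between the sets of components identifies the components of `a` and `b`, so it
cannot be a bijection. -/
lemma card_connectedComponent_lt_sup_edge [Finite V] {a b : V} (h : ¬ G.Reachable a b) :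
    Nat.card (G ⊔ edge a b).ConnectedComponent < Nat.card G.ConnectedComponent := by
  have hs := ConnectedComponent.surjective_map_ofLE (le_sup_left : G ≤ G ⊔ edge a b)
  refine lt_of_le_of_ne (Nat.card_le_card_of_surjective _ hs) fun heq => ?_
  have hb := (Function.Surjective.bijective_of_nat_card_le hs heq.ge).injective
  have hab : a ≠ b := fun e => h (e ▸ Reachable.refl _)
  refine h (ConnectedComponent.exact (hb ?_))
  simp only [ConnectedComponent.map_mk]
  exact ConnectedComponent.sound (Adj.reachable (by simp [edge_adj, hab]))

/-- A spanning subgraph with as many components has the same components. -/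
lemma Reachable.of_card_le [Finite V] {G' : SimpleGraph V} (hle : G ≤ G')
    (hc : Nat.card G.ConnectedComponent ≤ Nat.card G'.ConnectedComponent) {v w : V}
    (h : G'.Reachable v w) : G.Reachable v w := by
  have hs := ConnectedComponent.surjective_map_ofLE hle
  have hb := (Function.Surjective.bijective_of_nat_card_le hs hc).injective
  exact ConnectedComponent.exact (hb (by simpa using ConnectedComponent.sound h))

end SimpleGraph

/-! ### Counting the trees of spanning subgraphs. -/

namespace FeynmanGraph

variable {V E : Type*} [Fintype V] [Fintype E] {K M m : ℕ} (G : FeynmanGraph V E K M)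

/-- The number of trees of the spanning subgraph with propagators `F`. -/
noncomputable def comps (F : Finset E) : ℕ := Nat.card (G.spanning F).ConnectedComponent

variable {G}

omit [Fintype V] [Fintype E] in
lemma spanning_adj {F : Finset E} {v w : V} :
    (G.spanning F).Adj v w ↔ (∃ e ∈ F, G.ends e = s(v, w)) ∧ v ≠ w := by
  simp [spanning, SimpleGraph.fromEdgeSet_adj]

omit [Fintype V] [Fintype E] in
lemma spanning_mono {F F' : Finset E} (h : F ⊆ F') : G.spanning F ≤ G.spanning F' :=
  SimpleGraph.fromEdgeSet_mono (Set.image_mono (by exact_mod_cast h))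

omit [Fintype V] [Fintype E] in
lemma reachable_of_mem_ends {F : Finset E} {e : E} (he : e ∈ F) {v w : V}
    (hv : v ∈ G.ends e) (hw : w ∈ G.ends e) : (G.spanning F).Reachable v w := by
  by_cases h : v = w
  · exact h ▸ SimpleGraph.Reachable.refl _
  · exact (spanning_adj.2 ⟨⟨e, he, (Sym2.mem_and_mem_iff h).1 ⟨hv, hw⟩⟩, h⟩).reachable

omit [Fintype V] [Fintype E] in
/-- If the end points of all propagators of `X` are joined by `F`, then `F` joins all that `X`
joins. -/
lemma reachable_of_forall_mem {X F : Finset E}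
    (h : ∀ e ∈ X, ∀ v ∈ G.ends e, ∀ w ∈ G.ends e, (G.spanning F).Reachable v w) {v w : V}
    (hvw : (G.spanning X).Reachable v w) : (G.spanning F).Reachable v w := by
  rw [SimpleGraph.reachable_iff_reflTransGen] at hvw
  induction hvw with
  | refl => exact SimpleGraph.Reachable.refl _
  | tail _ hxy ih =>
    obtain ⟨⟨e, he, hee⟩, -⟩ := spanning_adj.1 hxy
    exact ih.trans (h e he _ (by simp [hee]) _ (by simp [hee]))

omit [Fintype V] [Fintype E] in
lemma spanning_insert [DecidableEq E] {F : Finset E} {e : E} {a b : V} (he : G.ends e = s(a, b)) :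
    G.spanning (insert e F) = G.spanning F ⊔ SimpleGraph.edge a b := by
  rw [spanning, Finset.coe_insert, Set.image_insert_eq, he, Set.insert_eq, Set.union_comm,
    SimpleGraph.fromEdgeSet_union]
  rfl

omit [Fintype E] in
lemma comps_le_comps_insert [DecidableEq E] (F : Finset E) (e : E) :
    G.comps F ≤ G.comps (insert e F) + 1 := by
  obtain ⟨⟨a, b⟩, he⟩ := (G.ends e).exists_rep
  rw [comps, comps, spanning_insert he.symm]
  exact SimpleGraph.card_connectedComponent_le_sup_edge a b

omit [Fintype E] in
lemma comps_le_comps_union [DecidableEq E] (X Y : Finset E) :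
    G.comps X ≤ G.comps (X ∪ Y) + Y.card := by
  induction Y using Finset.induction_on with
  | empty => simp
  | insert e Y he ih =>
    have := comps_le_comps_insert (G := G) (X ∪ Y) e
    rw [Finset.union_insert, Finset.card_insert_of_notMem he]
    omega

omit [Fintype E] in
lemma comps_anti {X Y : Finset E} (h : X ⊆ Y) : G.comps Y ≤ G.comps X :=
  SimpleGraph.ConnectedComponent.card_le_card_of_le (spanning_mono h)

omit [Fintype E] in
lemma comps_empty : G.comps ∅ = Fintype.card V := by
  have : G.spanning ∅ = ⊥ := by simp [spanning]
  rw [comps, this, ← Nat.card_eq_fintype_card]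
  refine (Nat.card_eq_of_bijective (fun v => (⊥ : SimpleGraph V).connectedComponentMk v)
    ⟨fun v w h => ?_, fun c => c.ind fun v => ⟨v, rfl⟩⟩).symm
  simpa using SimpleGraph.ConnectedComponent.exact h

omit [Fintype E] in
lemma card_le_comps_add (F : Finset E) : Fintype.card V ≤ G.comps F + F.card := by
  classical
  simpa [comps_empty] using comps_le_comps_union (G := G) ∅ F

omit [Fintype E] in
/-- A forest extends to a maximal one. -/
lemma exists_forest_extension {F X : Finset E} (hFX : F ⊆ X)
    (hF : F.card + G.comps F = Fintype.card V) :
    ∃ F', F ⊆ F' ∧ F' ⊆ X ∧ F'.card + G.comps F' = Fintype.card V ∧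
      ∀ v w, (G.spanning X).Reachable v w → (G.spanning F').Reachable v w := by
  classical
  let s := X.powerset.filter fun F' => F ⊆ F' ∧ F'.card + G.comps F' = Fintype.card V
  obtain ⟨F', hF', hmax⟩ := s.exists_max_image Finset.card ⟨F, by simp [s, hFX, hF]⟩
  simp only [s, Finset.mem_filter, Finset.mem_powerset] at hF' hmax
  obtain ⟨hX, hFF', hc⟩ := hF'
  refine ⟨F', hFF', hX, hc, fun v w => reachable_of_forall_mem fun e he v hv w hw => ?_⟩
  by_contra hn
  have hvw : v ≠ w := fun h => hn (h ▸ SimpleGraph.Reachable.refl _)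
  have hen : e ∉ F' := fun h => hn (reachable_of_mem_ends h hv hw)
  have hee : G.ends e = s(v, w) := (Sym2.mem_and_mem_iff hvw).1 ⟨hv, hw⟩
  have h1 : G.comps (insert e F') < G.comps F' := by
    rw [comps, comps, spanning_insert hee]
    exact SimpleGraph.card_connectedComponent_lt_sup_edge hn
  have h2 := comps_le_comps_insert (G := G) F' e
  -- By `h1` and `h2`, adding `e` lowers the number of components by exactly one, so the result is
  -- again a forest, against maximality.
  have := hmax (insert e F') ⟨Finset.insert_subset he hX, hFF'.trans (Finset.subset_insert _ _), by
    rw [Finset.card_insert_of_notMem hen]; omega⟩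
  rw [Finset.card_insert_of_notMem hen] at this
  omega

omit [Fintype V] [Fintype E] in
/-- A path that starts inside `P` leaves it through propagators of `Q`, if these are all that are
incident with `P`. -/
lemma exists_exit {F Q : Finset E} {P : V → Prop}
    (hQ : ∀ e ∈ F, ∀ v ∈ G.ends e, P v → e ∈ Q) {v w : V} (hv : P v) (hw : ¬ P w)
    (h : (G.spanning F).Reachable v w) :
    ∃ x, ¬ P x ∧ (∃ e ∈ Q, x ∈ G.ends e) ∧ ∀ F' : Finset E, (∀ e ∈ F, e ∈ Q → e ∈ F') →
      (G.spanning F').Reachable v x := by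
  -- The second alternative describes paths that have not left `P` yet; with it the statement can be
  -- carried along the path.
  suffices H : (∃ x, ¬ P x ∧ (∃ e ∈ Q, x ∈ G.ends e) ∧ ∀ F' : Finset E,
      (∀ e ∈ F, e ∈ Q → e ∈ F') → (G.spanning F').Reachable v x) ∨
      (P w ∧ ∀ F' : Finset E, (∀ e ∈ F, e ∈ Q → e ∈ F') → (G.spanning F').Reachable v w) from
    H.resolve_right fun h => hw h.1
  clear hw
  rw [SimpleGraph.reachable_iff_reflTransGen] at h
  induction h with
  | refl => exact Or.inr ⟨hv, fun _ _ => SimpleGraph.Reachable.refl _⟩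
  | @tail x y _ hxy ih =>
    rcases ih with ih | ⟨hx, ih⟩
    · exact Or.inl ih
    · obtain ⟨⟨e, he, hee⟩, -⟩ := spanning_adj.1 hxy
      have hxe : x ∈ G.ends e := by simp [hee]
      have hye : y ∈ G.ends e := by simp [hee]
      have heQ := hQ e he x hxe hx
      have hr : ∀ F' : Finset E, (∀ e ∈ F, e ∈ Q → e ∈ F') → (G.spanning F').Reachable v y :=
        fun F' hF' => (ih F' hF').trans (reachable_of_mem_ends (hF' e he heQ) hxe hye)
      by_cases hy : P y
      · exact Or.inr ⟨hy, hr⟩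
      · exact Or.inl ⟨y, hy, ⟨e, heQ, hye⟩, hr⟩

/-! ### Connectedness in the incidence graph -/

/-- The vertices of a node of the incidence graph. -/
def Touches (G : FeynmanGraph V E K M) : V ⊕ E → V → Prop :=
  Sum.elim (fun v w => w = v) (fun e w => w ∈ G.ends e)

omit [Fintype V] [Fintype E] in
lemma exists_touches_of_incidence_adj {a b : V ⊕ E} (h : G.incidence.Adj a b) :
    ∃ v, G.Touches a v ∧ G.Touches b v := by
  rw [incidence, SimpleGraph.fromRel_adj] at h
  rcases h with ⟨-, ⟨v, e, rfl, rfl, h⟩ | ⟨v, e, rfl, rfl, h⟩⟩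
  · exact ⟨v, rfl, h⟩
  · exact ⟨v, h, rfl⟩

omit [Fintype V] [Fintype E] in
lemma incidence_adj {v : V} {e : E} (h : v ∈ G.ends e) :
    G.incidence.Adj (Sum.inl v) (Sum.inr e) := by
  rw [incidence, SimpleGraph.fromRel_adj]
  exact ⟨by simp, Or.inl ⟨v, e, rfl, rfl, h⟩⟩

-- Adjacent nodes of the incidence graph share a vertex, so connectedness of `H`, `J_i` or `S` turns
-- into reachability in a spanning subgraph. Only the propagators in the component of `a` have to
-- belong to `F`.
omit [Fintype V] [Fintype E] in
lemma reachable_of_incidence_reachable {P : Set (V ⊕ E)} {F : Finset E} {a b : P}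
    (hF : ∀ e, ∀ h : Sum.inr e ∈ P, (G.incidence.induce P).Reachable a ⟨_, h⟩ → e ∈ F)
    (h : (G.incidence.induce P).Reachable a b) {v w : V}
    (hv : G.Touches a v) (hw : G.Touches b w) : (G.spanning F).Reachable v w := by
  have key : ∀ c : P, (G.incidence.induce P).Reachable a c → ∀ v w,
      G.Touches c v → G.Touches c w → (G.spanning F).Reachable v w := by
    rintro ⟨v | e, hc⟩ hac x y hx hy
    · simp only [Touches, Sum.elim_inl] at hx hy
      rw [hx, hy]
    · exact reachable_of_mem_ends (hF e hc hac) hx hy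
  have h' := h
  rw [SimpleGraph.reachable_iff_reflTransGen] at h'
  induction h' generalizing w with
  | refl => exact key a (SimpleGraph.Reachable.refl _) v w hv hw
  | @tail c d hac hcd ih =>
    have hr : (G.incidence.induce P).Reachable a c :=
      (SimpleGraph.reachable_iff_reflTransGen _ _).2 hac
    obtain ⟨x, hx, hx'⟩ := exists_touches_of_incidence_adj (SimpleGraph.induce_adj.1 hcd)
    exact (ih hr hx).trans (key d h x w hx' hw)

end FeynmanGraph

/-! ### The propagators that depend on a jet, and their number in spanning forests. -/

namespace FeynmanGraph

variable {V E : Type*} [Fintype V] [Fintype E] {K M m : ℕ} {G : FeynmanGraph V E K M}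
  {part : E → Mode K}

/-- The soft component of a soft propagator. -/
def softComponent (G : FeynmanGraph V E K M) {part : E → Mode K} {e : E} (he : part e = .soft) :
    G.SoftComponent part :=
  (G.incidence.induce (G.softPart part)).connectedComponentMk ⟨Sum.inr e, he⟩

/-- The soft component `c` is attached to the `i`-th jet. -/
def SoftComponent.AttachedTo (c : G.SoftComponent part) (i : Fin K) : Prop :=
  ∃ v, c.Meets v ∧ G.IsJetVertex part i v

open Classical in
/-- The propagators whose parameters depend on the virtuality of `p_i`: those of the `i`-th jet,
and those of the soft components that are attached to it. -/
noncomputable def jetEdges (G : FeynmanGraph V E K M) (part : E → Mode K) (i : Fin K) : Finset E :=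
  Finset.univ.filter fun e => part e = .jet i ∨
    ∃ he : part e = .soft, SoftComponent.AttachedTo (G.softComponent he) i

omit [Fintype V] in
lemma mem_jetEdges {e : E} {i : Fin K} : e ∈ G.jetEdges part i ↔ part e = .jet i ∨
    ∃ he : part e = .soft, SoftComponent.AttachedTo (G.softComponent he) i := by
  classical
  simp [jetEdges]

omit [Fintype V] [Fintype E] in
lemma meets_softComponent {e : E} (he : part e = .soft) {v : V} (hv : v ∈ G.ends e) :
    (G.softComponent he).Meets v :=
  ⟨⟨Sum.inr e, he⟩, rfl, e, rfl, hv⟩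

omit [Fintype V] [Fintype E] in
lemma softComponent_eq_mk {e : E} (he : part e = .soft) {v : V} (hv : v ∈ G.ends e)
    (hs : G.IsSoftVertex part v) :
    G.softComponent he =
      (G.incidence.induce (G.softPart part)).connectedComponentMk ⟨Sum.inl v, hs⟩ :=
  SimpleGraph.ConnectedComponent.sound (SimpleGraph.Adj.reachable
    (SimpleGraph.induce_adj.2 (incidence_adj hv).symm))

omit [Fintype V] [Fintype E] in
lemma IsJetVertex.eq {i j : Fin K} {v : V} (hi : G.IsJetVertex part i v)
    (hj : G.IsJetVertex part j v) : i = j := by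
  obtain ⟨⟨e, he, hei⟩, -⟩ := hi
  have := hj.2 e he
  simpa [hei] using this

omit [Fintype V] [Fintype E] in
lemma vertex_trichotomy (G : FeynmanGraph V E K M) (part : E → Mode K) (v : V) :
    G.IsHardVertex part v ∨ (∃ i, G.IsJetVertex part i v) ∨ G.IsSoftVertex part v := by
  unfold IsHardVertex
  by_cases h : G.IsSoftVertex part v
  · exact Or.inr (Or.inr h)
  · by_cases h' : ∃ i, G.IsJetVertex part i v
    · exact Or.inr (Or.inl h')
    · exact Or.inl ⟨h, fun i hi => h' ⟨i, hi⟩⟩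

omit [Fintype V] [Fintype E] in
lemma isHardVertex_of_hard {e : E} (he : part e = .hard) {v : V} (hv : v ∈ G.ends e) :
    G.IsHardVertex part v :=
  ⟨fun h => by simpa [he] using h.2 e hv, fun i h => by simpa [he] using h.2 e hv⟩

omit [Fintype V] [Fintype E] in
lemma hard_or_jet_of_jet {e : E} {i : Fin K} (he : part e = .jet i) {v : V} (hv : v ∈ G.ends e) :
    G.IsHardVertex part v ∨ G.IsJetVertex part i v := by
  rcases vertex_trichotomy G part v with h | ⟨j, hj⟩ | h
  · exact Or.inl h
  · have := hj.2 e hv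
    simp only [he, Mode.jet.injEq, reduceCtorEq, or_false] at this
    exact Or.inr (this ▸ hj)
  · simpa [he] using h.2 e hv

omit [Fintype V] in
/-- The scaling of a propagator is shared equally between the jets on which it depends. -/
lemma scaling_eq_neg_card [DecidableEq E] (hsoft : G.IsJetPairingSoft part) (e : E) :
    (part e).scaling = -∑ i : Fin K, if e ∈ G.jetEdges part i then (1 : ℝ) else 0 := by
  rw [Finset.sum_boole]
  rcases h : part e with _ | j | _
  · have : (Finset.univ.filter fun i => e ∈ G.jetEdges part i) = ∅ := by
      ext i; simp [mem_jetEdges, h]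
    simp [this, Mode.scaling]
  · have : (Finset.univ.filter fun i => e ∈ G.jetEdges part i) = {j} := by
      ext i; simp [mem_jetEdges, h, eq_comm]
    simp [this, Mode.scaling]
  · have h2 := hsoft (G.softComponent h)
    have : ((Finset.univ.filter fun i => e ∈ G.jetEdges part i : Finset (Fin K)) : Set (Fin K)) =
        {i | ∃ v, (G.softComponent h).Meets v ∧ G.IsJetVertex part i v} := by
      ext i; simp [mem_jetEdges, h, SoftComponent.AttachedTo]
    rw [← this, Set.ncard_coe_finset] at h2
    simp [h2, Mode.scaling]

namespace IsScatteringPicture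

omit [Fintype V] [Fintype E] in
lemma exists_hard (h : G.IsScatteringPicture part) : ∃ v, G.IsHardVertex part v := by
  obtain ⟨⟨v | e, ha⟩⟩ := h.hard_connected.nonempty
  · exact ⟨v, ha⟩
  · obtain ⟨⟨a, b⟩, he⟩ := (G.ends e).exists_rep
    exact ⟨a, isHardVertex_of_hard ha (by rw [← he]; exact Sym2.mem_mk_left a b)⟩

omit [Fintype V] [Fintype E] in
lemma reachable_hard (h : G.IsScatteringPicture part) {F : Finset E}
    (hF : ∀ e, part e = .hard → e ∈ F) {v w : V} (hv : G.IsHardVertex part v)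
    (hw : G.IsHardVertex part w) : (G.spanning F).Reachable v w :=
  reachable_of_incidence_reachable (P := G.hardPart part) (a := ⟨Sum.inl v, hv⟩)
    (b := ⟨Sum.inl w, hw⟩) (fun e he _ => hF e he) (h.hard_connected.preconnected _ _) rfl rfl

omit [Fintype V] [Fintype E] in
lemma exists_reachable_hard_of_jet (h : G.IsScatteringPicture part) {i : Fin K} {F : Finset E}
    (hF : ∀ e, part e = .jet i → e ∈ F) {v : V} (hv : G.IsJetVertex part i v) :
    ∃ w, G.IsHardVertex part w ∧ (G.spanning F).Reachable v w := by
  obtain ⟨e, hve, hei⟩ := hv.1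
  obtain ⟨e', he', w, hwe, hw⟩ := h.jet_attached i ⟨e, hei⟩
  exact ⟨w, hw, reachable_of_incidence_reachable (P := G.jetPart part i) (a := ⟨Sum.inr e, hei⟩)
    (b := ⟨Sum.inr e', he'⟩) (fun e he _ => hF e he) (h.jet_connected i _ _) hve hwe⟩

omit [Fintype V] [Fintype E] in
/-- A soft vertex is connected, within its component, to the rest of the graph. -/
lemma exists_reachable_of_soft (h : G.IsScatteringPicture part) {v : V}
    (hv : G.IsSoftVertex part v) {F : Finset E} (hF : ∀ e, part e = .soft → e ∈ F) :
    ∃ w, ¬ G.IsSoftVertex part w ∧ (G.spanning F).Reachable v w := by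
  obtain ⟨w, ⟨a, hac, e, hae, hwe⟩, hw⟩ := h.soft_attached
    ((G.incidence.induce (G.softPart part)).connectedComponentMk ⟨Sum.inl v, hv⟩)
  refine ⟨w, hw, reachable_of_incidence_reachable (P := G.softPart part) (a := ⟨Sum.inl v, hv⟩)
    (b := a) (fun e he _ => hF e he) (SimpleGraph.ConnectedComponent.exact hac).symm rfl ?_⟩
  rw [hae]
  exact hwe

/-- There is a spanning tree that restricts to spanning trees of the hard subgraph, of the hard
subgraph with the jets, and hence of the complement of `jetEdges`. -/
lemma exists_tree (h : G.IsScatteringPicture part) :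
    ∃ T ∈ G.forests 1, ∀ i : Fin K, ∀ F : Finset E, (∀ e ∈ T, e ∉ G.jetEdges part i → e ∈ F) →
      (∀ e ∉ G.jetEdges part i, ∀ v ∈ G.ends e, ∀ w ∈ G.ends e, (G.spanning F).Reachable v w) ∧
      (∀ v w, (G.IsHardVertex part v ∨ ∃ j, j ≠ i ∧ G.IsJetVertex part j v) →
        (G.IsHardVertex part w ∨ ∃ j, j ≠ i ∧ G.IsJetVertex part j w) →
        (G.spanning F).Reachable v w) := by
  classical
  -- Nested maximal forests, as in a greedy algorithm: in the hard propagators, in the non-soft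
  -- ones, in all of them. No choice depends on `i`.
  obtain ⟨F₁, -, hF₁, hc₁, hr₁⟩ := exists_forest_extension (G := G) (F := ∅)
    (X := Finset.univ.filter fun e => part e = .hard) (by simp) (by simp [comps_empty])
  obtain ⟨F₂, hF₁₂, hF₂, hc₂, hr₂⟩ := exists_forest_extension (G := G) (F := F₁)
    (X := Finset.univ.filter fun e => part e ≠ .soft)
    (hF₁.trans fun e => by simp +contextual) hc₁
  obtain ⟨T, hF₂₃, -, hc₃, hr₃⟩ := exists_forest_extension (G := G) (F := F₂)
    (X := Finset.univ) (by simp) hc₂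
  have hcon : ∀ v w, (G.spanning T).Reachable v w := fun v w => hr₃ v w (by
    have := G.connected.preconnected v w
    simpa [spanning] using this)
  have hcomps : G.comps T = 1 := by
    have : Nonempty V := G.connected.nonempty
    rw [comps, Nat.card_eq_one_iff_unique]
    exact ⟨⟨fun a b => a.ind₂ (fun v w => SimpleGraph.ConnectedComponent.sound (hcon v w)) b⟩,
      ⟨(G.spanning T).connectedComponentMk (Classical.arbitrary V)⟩⟩
  refine ⟨T, by
    simp only [forests, Finset.mem_filter, Finset.mem_univ, true_and]
    exact ⟨hcomps, by omega⟩, fun i F hF => ?_⟩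
  obtain ⟨h₀, hh₀⟩ := h.exists_hard
  have hard : ∀ v, G.IsHardVertex part v → (G.spanning F).Reachable v h₀ := fun v hv => by
    refine (hr₁ v h₀ (h.reachable_hard (by simp) hv hh₀)).mono (spanning_mono fun e he => ?_)
    have := hF₁ he
    simp only [Finset.mem_filter, Finset.mem_univ, true_and] at this
    exact hF e (hF₂₃ (hF₁₂ he)) (by simp [mem_jetEdges, this])
  have jet : ∀ j, j ≠ i → ∀ v, G.IsJetVertex part j v → (G.spanning F).Reachable v h₀ := by
    intro j hji v hv
    obtain ⟨w, hw, hvw⟩ := h.exists_reachable_hard_of_jet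
      (F := Finset.univ.filter fun e => part e ≠ .soft) (by simp +contextual) hv
    -- A path in `F₂` to a hard vertex leaves the jet `j` through propagators of this jet only,
    -- which are not in `jetEdges part i`, and the first vertex outside is hard.
    obtain ⟨x, hx, ⟨e, he, hxe⟩, hr⟩ := exists_exit (P := G.IsJetVertex part j)
      (Q := Finset.univ.filter fun e => part e = .jet j) (fun e he v hv hvj => by
        have h1 := hF₂ he
        have h2 := hvj.2 e hv
        simp only [Finset.mem_filter, Finset.mem_univ, true_and] at h1 ⊢
        exact h2.resolve_right h1) hv (hw.2 j) (hr₂ v w hvw)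
    simp only [Finset.mem_filter, Finset.mem_univ, true_and] at he hr
    refine (hr F fun e he hej => hF e (hF₂₃ he) ?_).trans
      (hard x ((hard_or_jet_of_jet he hxe).resolve_right hx))
    simp [mem_jetEdges, hej, hji]
  have soft : ∀ v, ∀ hs : G.IsSoftVertex part v, ∀ e, v ∈ G.ends e → e ∉ G.jetEdges part i →
      (G.spanning F).Reachable v h₀ := by
    intro v hv e hve hei
    have hes := hv.2 e hve
    obtain ⟨w, hw, -⟩ := h.exists_reachable_of_soft hv (F := Finset.univ) (by simp)
    -- A path in `T` leaves the soft component through its own propagators. The component is not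
    -- attached to the jet `i`, so these are outside `jetEdges part i`, and the exit vertex is hard
    -- or in another jet.
    obtain ⟨x, hx, ⟨e', he', hxe⟩, hr⟩ := exists_exit (F := T) (w := w)
      (P := fun x => G.IsSoftVertex part x ∧
        ∃ e', ∃ he' : part e' = .soft, x ∈ G.ends e' ∧ G.softComponent he' = G.softComponent hes)
      (Q := Finset.univ.filter fun e' => ∃ he' : part e' = .soft,
        G.softComponent he' = G.softComponent hes)
      (fun e' _ x hx ⟨hxs, e'', he'', hx'', hc⟩ => by
        simp only [Finset.mem_filter, Finset.mem_univ, true_and]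
        exact ⟨hxs.2 e' hx, by
          rw [← hc, softComponent_eq_mk _ hx hxs, softComponent_eq_mk _ hx'' hxs]⟩)
      ⟨hv, e, hes, hve, rfl⟩ (fun hw' => hw hw'.1) (hcon v w)
    simp only [Finset.mem_filter, Finset.mem_univ, true_and] at he' hr
    obtain ⟨he's, hc⟩ := he'
    have hni : ¬ SoftComponent.AttachedTo (G.softComponent hes) i := fun hi =>
      hei (mem_jetEdges.2 (Or.inr ⟨hes, hi⟩))
    refine (hr F fun e₁ he₁ ⟨he₁s, hc₁⟩ => hF e₁ he₁ fun hmem => ?_).trans ?_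
    · rcases mem_jetEdges.1 hmem with h1 | ⟨_, h1⟩
      · simp [he₁s] at h1
      · exact hni (hc₁ ▸ h1)
    · rcases vertex_trichotomy G part x with h1 | ⟨j, h1⟩ | h1
      · exact hard x h1
      · refine jet j (fun hji => hni ?_) x h1
        exact hc ▸ ⟨x, meets_softComponent he's hxe, hji ▸ h1⟩
      · exact absurd ⟨h1, e', he's, hxe, hc⟩ hx
  have all : ∀ e ∉ G.jetEdges part i, ∀ v ∈ G.ends e, (G.spanning F).Reachable v h₀ := by
    intro e he v hv
    rcases vertex_trichotomy G part v with h1 | ⟨j, h1⟩ | h1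
    · exact hard v h1
    · refine jet j (fun hji => he ?_) v h1
      subst hji
      rcases h1.2 e hv with h2 | h2
      · exact mem_jetEdges.2 (Or.inl h2)
      · exact mem_jetEdges.2 (Or.inr ⟨h2, v, meets_softComponent h2 hv, h1⟩)
    · exact soft v h1 e hv he
  have big : ∀ v, (G.IsHardVertex part v ∨ ∃ j, j ≠ i ∧ G.IsJetVertex part j v) →
      (G.spanning F).Reachable v h₀ := by
    rintro v (hv | ⟨j, hj, hv⟩)
    · exact hard v hv
    · exact jet j hj v hv
  exact ⟨fun e he v hv w hw => (all e he v hv).trans (all e he w hw).symm,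
    fun v w hv hw => (big v hv).trans (big w hw).symm⟩

end IsScatteringPicture

lemma mem_forests {k : ℕ} {F : Finset E} :
    F ∈ G.forests k ↔ G.comps F = k ∧ F.card + k = Fintype.card V := by
  classical
  simp [forests, IsSpanningForest, comps]

/-- The minimal number of propagators of `jetEdges` in a spanning tree. -/
noncomputable def jetRank (G : FeynmanGraph V E K M) (part : E → Mode K) (i : Fin K) : ℕ := by
  classical exact G.comps (Finset.univ \ G.jetEdges part i) - 1

omit [Fintype E] in
lemma comps_pos (F : Finset E) : 0 < G.comps F := by
  have : Nonempty V := G.connected.nonempty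
  have : Nonempty (G.spanning F).ConnectedComponent :=
    ⟨(G.spanning F).connectedComponentMk (Classical.arbitrary V)⟩
  exact Nat.card_pos

lemma jetRank_add_one_le [DecidableEq E] {F : Finset E} {k : ℕ} (hF : F ∈ G.forests k)
    (i : Fin K) : G.jetRank part i + 1 ≤ (F ∩ G.jetEdges part i).card + k := by
  rw [mem_forests] at hF
  have h1 := comps_le_comps_union (G := G) (F \ G.jetEdges part i) (F ∩ G.jetEdges part i)
  rw [Finset.sdiff_union_inter, hF.1] at h1
  have h2 : G.comps (Finset.univ \ G.jetEdges part i) ≤ G.comps (F \ G.jetEdges part i) :=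
    comps_anti (Finset.sdiff_subset_sdiff (Finset.subset_univ _) le_rfl)
  have h3 := comps_pos (G := G) (Finset.univ \ G.jetEdges part i)
  have : G.jetRank part i = G.comps (Finset.univ \ G.jetEdges part i) - 1 := by
    unfold jetRank; congr!
  omega

/-- Outside `jetEdges`, the tree of `exists_tree` joins all that the whole complement joins, so it
has as many propagators there as possible and as few as possible inside. That one `T` serves every
`i` makes the sum of the jet weights the minimal weight of the region. -/
lemma IsScatteringPicture.exists_tree_card_eq [DecidableEq E] (h : G.IsScatteringPicture part) :
    ∃ T ∈ G.forests 1, ∀ i, (T ∩ G.jetEdges part i).card = G.jetRank part i := by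
  obtain ⟨T, hT, hr⟩ := h.exists_tree
  refine ⟨T, hT, fun i => le_antisymm ?_ (by simpa using jetRank_add_one_le (part := part) hT i)⟩
  have h1 := (hr i (T \ G.jetEdges part i) (by simp +contextual)).1
  have h2 : G.comps (T \ G.jetEdges part i) ≤ G.comps (Finset.univ \ G.jetEdges part i) := by
    refine Nat.card_le_card_of_injective
      (SimpleGraph.ConnectedComponent.map (SimpleGraph.Hom.ofLE (spanning_mono
        (Finset.sdiff_subset_sdiff (Finset.subset_univ _) le_rfl)))) fun c d hcd => ?_
    induction c using SimpleGraph.ConnectedComponent.ind with | _ v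
    induction d using SimpleGraph.ConnectedComponent.ind with | _ w
    simp only [SimpleGraph.ConnectedComponent.map_mk, SimpleGraph.ConnectedComponent.eq] at hcd ⊢
    exact reachable_of_forall_mem (fun e he => h1 e (by simpa using he)) hcd
  have h3 := card_le_comps_add (G := G) (T \ G.jetEdges part i)
  have h4 := Finset.card_sdiff_add_card_inter T (G.jetEdges part i)
  rw [mem_forests] at hT
  have : G.jetRank part i = G.comps (Finset.univ \ G.jetEdges part i) - 1 := by
    unfold jetRank; congr!
  omega

/-- A spanning 2-tree with fewer propagators of `jetEdges` than any spanning tree separates at most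
the leg `p_i` from all the others. -/
lemma IsScatteringPicture.channel_of_card_lt [DecidableEq E] (h : G.IsScatteringPicture part)
    {F : Finset E} (hF : F ∈ G.forests 2) {i : Fin K}
    (hlt : (F ∩ G.jetEdges part i).card < G.jetRank part i) :
    G.channel F = ∅ ∨ (G.channel F)ᶜ = ∅ ∨ G.channel F = {Sum.inl i} ∨
      (G.channel F)ᶜ = {Sum.inl i} := by
  classical
  have hjr : G.jetRank part i = G.comps (Finset.univ \ G.jetEdges part i) - 1 := by
    unfold jetRank; congr!
  obtain ⟨T, hT, hr⟩ := h.exists_tree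
  have hbig := (hr i (Finset.univ \ G.jetEdges part i) (by simp)).2
  rw [mem_forests] at hF
  have h1 := comps_le_comps_union (G := G) (F \ G.jetEdges part i) (F ∩ G.jetEdges part i)
  rw [Finset.sdiff_union_inter, hF.1] at h1
  have hcon : ∀ l l', l ≠ Sum.inl i → l' ≠ Sum.inl i →
      (G.spanning F).Reachable (G.leg l) (G.leg l') := by
    have key : ∀ l, l ≠ Sum.inl i → G.IsHardVertex part (G.leg l) ∨
        ∃ j, j ≠ i ∧ G.IsJetVertex part j (G.leg l) := by
      rintro (j | j) hl
      · rcases h.onShell_jet j with hj | hj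
        · exact Or.inr ⟨j, fun e => hl (e ▸ rfl), hj⟩
        · exact Or.inl hj.1
      · exact Or.inl (h.offShell_hard j)
    intro l l' hl hl'
    -- Outside `jetEdges part i`, the 2-tree has at most `2 + (F ∩ jetEdges).card ≤ jetRank + 1`
    -- components, no more than the full complement. So it joins whatever the complement joins, in
    -- particular the hard vertices and all jets other than `i`.
    refine (SimpleGraph.Reachable.of_card_le (spanning_mono (Finset.sdiff_subset_sdiff
      (Finset.subset_univ F) le_rfl)) ?_ (hbig _ _ (key l hl) (key l' hl'))).mono
      (spanning_mono Finset.sdiff_subset)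
    change G.comps (F \ G.jetEdges part i) ≤ G.comps (Finset.univ \ G.jetEdges part i)
    omega
  have hmem : ∀ l, l ∈ G.channel F ↔ (G.spanning F).Reachable G.root (G.leg l) := by
    simp [channel]
  have hsame : ∀ l l', l ≠ Sum.inl i → l' ≠ Sum.inl i → l ∈ G.channel F → l' ∈ G.channel F :=
    fun l l' hl hl' hm => (hmem l').2 (((hmem l).1 hm).trans (hcon l l' hl hl'))
  by_cases hex : ∃ l, l ≠ Sum.inl i ∧ l ∈ G.channel F
  · obtain ⟨l, hl, hlm⟩ := hex
    have : (G.channel F)ᶜ ⊆ {Sum.inl i} := fun l' hl' => by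
      by_contra hn
      exact (Finset.mem_compl.1 hl') (hsame l l' hl (by simpa using hn) hlm)
    rcases Finset.subset_singleton_iff.1 this with h' | h' <;> simp [h']
  · have : G.channel F ⊆ {Sum.inl i} := fun l hl => by
      by_contra hn
      exact hex ⟨l, by simpa using hn, hl⟩
    rcases Finset.subset_singleton_iff.1 this with h' | h' <;> simp [h']

lemma IsScatteringPicture.jetRank_le_of_isHardChannel [DecidableEq E]
    (h : G.IsScatteringPicture part) {F : Finset E} (hF : F ∈ G.forests 2)
    (hc : IsHardChannel (G.channel F)) (i : Fin K) :
    G.jetRank part i ≤ (F ∩ G.jetEdges part i).card := by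
  by_contra hn
  rcases h.channel_of_card_lt hF (not_le.1 hn) with h' | h' | h' | h'
  · exact hc.1 h'
  · exact hc.2.1 h'
  · exact hc.2.2 ⟨i, Or.inl h'⟩
  · exact hc.2.2 ⟨i, Or.inr h'⟩

omit [Fintype V] [Fintype E] in
/-- Two different virtualities do not coincide identically. -/
lemma _root_.Kinematics.compl_inl_ne (kin : Kinematics K M m) {i j : Fin K} (hij : i ≠ j) :
    ({Sum.inl i}ᶜ : Finset (Fin K ⊕ Fin M)) ≠ {Sum.inl j} := by
  intro h
  have h1 := kin.inv_compl {Sum.inl i}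
  rw [h] at h1
  have h2 := kin.inv_onShell j (Pi.single i 1) 0
  rw [h1, kin.inv_onShell] at h2
  simp [hij.symm] at h2

omit [Fintype V] [Fintype E] in
lemma _root_.Kinematics.eq_of_channel (kin : Kinematics K M m) {A : Finset (Fin K ⊕ Fin M)}
    {i j : Fin K} (hi : A = {Sum.inl i} ∨ Aᶜ = {Sum.inl i})
    (hj : A = {Sum.inl j} ∨ Aᶜ = {Sum.inl j}) : i = j := by
  by_contra hij
  rcases hi with rfl | hi
  · rcases hj with hj | hj
    · exact hij (by simpa using hj)
    · exact kin.compl_inl_ne hij hj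
  · rcases hj with rfl | hj
    · exact kin.compl_inl_ne (Ne.symm hij) hi
    · rw [hi] at hj
      exact hij (by simpa using hj)

lemma IsScatteringPicture.jetRank_le_of_isOnShellChannel [DecidableEq E]
    (h : G.IsScatteringPicture part) (kin : Kinematics K M m) {F : Finset E}
    (hF : F ∈ G.forests 2) {j : Fin K}
    (hc : G.channel F = {Sum.inl j} ∨ (G.channel F)ᶜ = {Sum.inl j}) (i : Fin K) :
    G.jetRank part i ≤ (F ∩ G.jetEdges part i).card + if j = i then 1 else 0 := by
  split_ifs with hij
  · have := jetRank_add_one_le (part := part) hF i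
    omega
  by_contra hn
  -- This settles the trivial channels: there `p_j` would be the only leg, hence `i = j`.
  have huniv : ∀ k l : Fin K, (Finset.univ : Finset (Fin K ⊕ Fin M)) = {Sum.inl k} → l = k :=
    fun k l hk => by
      have : (Sum.inl l : Fin K ⊕ Fin M) ∈ (Finset.univ : Finset (Fin K ⊕ Fin M)) :=
        Finset.mem_univ _
      rw [hk] at this
      simpa using this
  rcases h.channel_of_card_lt hF (not_le.1 hn) with h' | h' | h'
  · rw [h'] at hc
    rcases hc with hc | hc
    · exact absurd hc.symm (Finset.singleton_ne_empty _)
    · exact hij (huniv j i (by simpa using hc)).symm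
  · rw [h'] at hc
    rcases hc with hc | hc
    · rw [← compl_inj_iff, h'] at hc
      have h2 : (Finset.univ : Finset (Fin K ⊕ Fin M)) = {Sum.inl j} := by
        rw [← compl_inj_iff, ← hc]; simp
      exact hij (huniv j i h2).symm
    · exact absurd hc.symm (Finset.singleton_ne_empty _)
  · exact hij (kin.eq_of_channel hc h')

end FeynmanGraph

/-! ### Taylor coefficients of complex powers. -/

section Taylor

open Asymptotics

/-- If the order of vanishing were some `k < N`, the cofactor of `x ^ k` would be of order `‖x‖ ^ (N
- k)` and vanish at `0`. -/
lemma iteratedDeriv_eq_zero_of_isBigO {h : ℝ → ℂ} (hh : AnalyticAt ℝ h 0) {N : ℕ}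
    (hO : h =O[𝓝 0] fun x => ‖x‖ ^ N) {i : ℕ} (hi : i < N) : iteratedDeriv i h 0 = 0 := by
  refine (natCast_le_analyticOrderAt_iff_iteratedDeriv_eq_zero hh).1 ?_ i hi
  by_contra hlt
  rw [not_le] at hlt
  obtain ⟨k, hk⟩ := ENat.ne_top_iff_exists.1 (hlt.trans_le le_top).ne
  rw [← hk, Nat.cast_lt] at hlt
  obtain ⟨g, hg, hg0, hfg⟩ := hh.analyticOrderAt_eq_natCast.1 hk.symm
  refine hg0 ?_
  have hgO : g =O[𝓝[≠] 0] fun x : ℝ => ‖x‖ ^ (N - k) := by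
    obtain ⟨C, hC⟩ := hO.bound
    refine IsBigO.of_bound C ?_
    filter_upwards [nhdsWithin_le_nhds hC, nhdsWithin_le_nhds hfg, self_mem_nhdsWithin] with x h1 h2 h3
    have hx : 0 < ‖x‖ ^ k := by
      have : x ≠ 0 := h3
      positivity
    rw [h2, sub_zero, norm_smul, norm_pow] at h1
    refine le_of_mul_le_mul_left (h1.trans (le_of_eq ?_)) hx
    simp only [norm_pow, norm_norm]
    rw [show N = k + (N - k) by omega, pow_add]
    simp only [Nat.add_sub_cancel_left]
    ring
  have ht : Tendsto (fun x : ℝ => ‖x‖ ^ (N - k)) (𝓝[≠] 0) (𝓝 0) := by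
    have : Tendsto (fun x : ℝ => ‖x‖ ^ (N - k)) (𝓝 0) (𝓝 (‖(0 : ℝ)‖ ^ (N - k))) :=
      (continuous_norm.pow _).tendsto 0
    rw [norm_zero, zero_pow (by omega)] at this
    exact this.mono_left nhdsWithin_le_nhds
  exact tendsto_nhds_unique (hg.continuousAt.tendsto.mono_left nhdsWithin_le_nhds)
    (hgO.trans_tendsto ht)

/-- Near `z = 0` the sum of the two arguments stays strictly between `-π` and `π`, as `L` is off the
branch cut, so the principal logarithms add. -/
lemma Complex.cpow_mul_one_add_eventuallyEq {L : ℂ} (hL : L ∈ Complex.slitPlane) (s : ℂ) :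
    ∀ᶠ z in 𝓝 (0 : ℂ), (L * (1 + z)) ^ s = L ^ s * (1 + z) ^ s := by
  have h1 : ContinuousAt (fun z : ℂ => Complex.arg L + Complex.arg (1 + z)) 0 :=
    continuousAt_const.add (ContinuousAt.comp (g := Complex.arg)
      (Complex.continuousAt_arg (by simp)) (by fun_prop))
  have h2 : Complex.arg L + Complex.arg (1 + 0) ∈ Ioo (-Real.pi) Real.pi := by
    have := Complex.mem_slitPlane_iff_arg.1 hL
    have h3 := Complex.neg_pi_lt_arg L
    have h4 := Complex.arg_le_pi L
    simp only [add_zero, Complex.arg_one]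
    exact ⟨h3, lt_of_le_of_ne h4 this.1⟩
  have h3 : ∀ᶠ z : ℂ in 𝓝 0, 1 + z ≠ 0 :=
    ContinuousAt.eventually_ne (g := fun z : ℂ => 1 + z) (by fun_prop) (by simp)
  filter_upwards [h1.eventually (Ioo_mem_nhds h2.1 h2.2), h3] with z hz hz0
  have hL0 := Complex.slitPlane_ne_zero hL
  rw [Complex.cpow_def_of_ne_zero (mul_ne_zero hL0 hz0), Complex.cpow_def_of_ne_zero hL0,
    Complex.cpow_def_of_ne_zero hz0, (Complex.log_mul_eq_add_log_iff hL0 hz0).2 ⟨hz.1, hz.2.le⟩,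
    add_mul, Complex.exp_add]

variable {β : Type*} [Fintype β]

/-- The expansion of a power of `L + ∑ b, m b * lam ^ δ b` around `lam = 0`. -/
lemma iteratedDeriv_cpow_add_sum {L : ℂ} (hL : L ∈ Complex.slitPlane) (m : β → ℂ) {δ : β → ℕ}
    (hδ : ∀ b, 1 ≤ δ b) (s : ℂ) (n : ℕ) :
    AnalyticAt ℝ (fun lam : ℝ => (L + ∑ b, m b * (lam : ℂ) ^ δ b) ^ s) 0 ∧
    iteratedDeriv n (fun lam : ℝ => (L + ∑ b, m b * (lam : ℂ) ^ δ b) ^ s) 0 =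
      n.factorial * ∑ j ∈ Finset.range (n + 1), Ring.choose s j * L ^ (s - j) *
        ∑ f ∈ Finset.univ.filter (fun f : Fin j → β => ∑ l, δ (f l) = n), ∏ l, m (f l) := by
  have hL0 := Complex.slitPlane_ne_zero hL
  set R : ℝ → ℂ := fun lam => ∑ b, m b * (lam : ℂ) ^ δ b with hR
  have hR0 : R 0 = 0 := by
    simp only [hR]
    refine Finset.sum_eq_zero fun b _ => ?_
    have := hδ b
    simp [show δ b ≠ 0 by omega]
  have hofReal : ∀ x, AnalyticAt ℝ (fun x : ℝ => (x : ℂ)) x := fun x =>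
    Complex.ofRealCLM.analyticAt x
  have hRan : AnalyticAt ℝ R 0 :=
    Finset.analyticAt_fun_sum _ fun b _ => analyticAt_const.mul ((hofReal 0).pow _)
  have hfan : AnalyticAt ℝ (fun lam : ℝ => (L + R lam) ^ s) 0 := by
    have h1 : AnalyticAt ℂ (fun w : ℂ => w ^ s) (L + R 0) :=
      analyticAt_id.cpow analyticAt_const (by simpa [hR0] using hL)
    exact AnalyticAt.comp (g := fun w : ℂ => w ^ s) (f := fun lam : ℝ => L + R lam)
      h1.restrictScalars (analyticAt_const.add hRan)
  refine ⟨hfan, ?_⟩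
  -- The binomial series truncated after `j = n`: since each `δ b ≥ 1`, `R lam` is of order `lam`,
  -- and the remainder does not affect the derivative of order `n`.
  set p : ℝ → ℂ := fun lam => ∑ j ∈ Finset.range (n + 1),
    Ring.choose s j * L ^ (s - j) * (R lam) ^ j with hp
  have hpan : AnalyticAt ℝ p 0 :=
    Finset.analyticAt_fun_sum _ fun b _ => analyticAt_const.mul (hRan.pow _)
  have hRO : R =O[𝓝 0] fun x : ℝ => ‖x‖ := by
    have := hRan.differentiableAt.isBigO_sub
    simpa [hR0] using this.norm_right
  have hdiff : (fun lam => (L + R lam) ^ s - p lam) =O[𝓝 0] fun x : ℝ => ‖x‖ ^ (n + 1) := by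
    have h1 := (Complex.one_add_cpow_hasFPowerSeriesAt_zero (a := s)).isBigO_sub_partialSum_pow
      (n + 1)
    have ht : Tendsto (fun lam => R lam / L) (𝓝 0) (𝓝 0) := by
      have := (hRan.continuousAt.div_const L).tendsto
      simpa [hR0] using this
    have h2 := (h1.comp_tendsto ht).const_mul_left (L ^ s)
    have h3 : (fun lam => (L + R lam) ^ s - p lam) =ᶠ[𝓝 0] fun lam => L ^ s *
        ((fun y => (fun x => (1 + x) ^ s) (0 + y) -
          (binomialSeries ℂ s).partialSum (n + 1) y) ∘ fun lam => R lam / L) lam := by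
      filter_upwards [ht.eventually (Complex.cpow_mul_one_add_eventuallyEq hL s)] with lam hlam
      have e1 : L + R lam = L * (1 + R lam / L) := by field_simp
      rw [e1, hlam]
      simp only [Function.comp_apply, zero_add, mul_sub, hp, sub_right_inj]
      rw [FormalMultilinearSeries.partialSum, Finset.mul_sum]
      refine Finset.sum_congr rfl fun j _ => ?_
      simp only [binomialSeries, FormalMultilinearSeries.ofScalars_apply_eq, smul_eq_mul, div_pow]
      rw [Complex.cpow_sub _ _ hL0, Complex.cpow_natCast]
      field_simp
    refine (h2.congr' h3.symm EventuallyEq.rfl).trans ?_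
    have h4 : (fun lam => R lam / L) =O[𝓝 0] fun x : ℝ => ‖x‖ := by
      simpa [div_eq_inv_mul] using hRO.const_mul_left L⁻¹
    exact (h4.norm_left.pow (n + 1))
  have h0 := iteratedDeriv_eq_zero_of_isBigO (hfan.sub hpan) hdiff (Nat.lt_succ_self n)
  rw [iteratedDeriv_sub hfan.contDiffAt hpan.contDiffAt, sub_eq_zero] at h0
  have hterm : ∀ j ∈ Finset.range (n + 1), ContDiffAt ℝ n
      (fun lam => Ring.choose s j * L ^ (s - j) * R lam ^ j) 0 := fun j _ =>
    (analyticAt_const.mul (hRan.pow j)).contDiffAt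
  rw [h0, hp, iteratedDeriv_fun_sum hterm, Finset.mul_sum]
  refine Finset.sum_congr rfl fun j _ => ?_
  rw [iteratedDeriv_const_mul_field, mul_left_comm]
  congr 1
  have hpow : (fun lam => R lam ^ j) = fun lam : ℝ => ∑ f : Fin j → β,
      (∏ l, m (f l)) * (lam : ℂ) ^ (∑ l, δ (f l)) := by
    ext lam
    simp only [hR]
    rw [Fintype.sum_pow]
    refine Finset.sum_congr rfl fun f _ => ?_
    rw [Finset.prod_mul_distrib, Finset.prod_pow_eq_pow_sum]
  have hmon : ∀ k : ℕ, iteratedDeriv n (fun lam : ℝ => (lam : ℂ) ^ k) 0 =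
      if k = n then (n.factorial : ℂ) else 0 := by
    intro k
    have e : (fun lam : ℝ => (lam : ℂ) ^ k) = fun lam : ℝ => (lam ^ k) • (1 : ℂ) := by
      ext lam; simp
    rw [e, iteratedDeriv_smul_const, iteratedDeriv_fun_pow_zero]
    · by_cases h : k = n
      · subst h; simp
      · rw [if_neg h, if_neg (Ne.symm h)]; simp
    · fun_prop
  change iteratedDeriv n (fun lam => R lam ^ j) 0 = _
  have hterm' : ∀ f ∈ (Finset.univ : Finset (Fin j → β)), ContDiffAt ℝ n
      (fun lam : ℝ => (∏ l, m (f l)) * (lam : ℂ) ^ (∑ l, δ (f l))) 0 := fun f _ =>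
    (analyticAt_const.mul ((hofReal 0).pow _)).contDiffAt
  rw [hpow, iteratedDeriv_fun_sum hterm', Finset.sum_filter, Finset.mul_sum]
  refine Finset.sum_congr rfl fun f _ => ?_
  rw [iteratedDeriv_const_mul_field, hmon]
  split_ifs <;> ring

end Taylor

/-! ### Families of monomials -/

/-- A finite family of monomials `coef * ∏ t_i ^ tdeg_i * ∏ x_e`, the last product over `edges`,
each of which has an excess `shift` over the leading monomials of the family. -/
structure MonomialFamily (ι κ E : Type*) where
  coef : ι → ℂ
  tdeg : ι → κ → ℕ
  edges : ι → Finset E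
  shift : ι → κ → ℕ

namespace MonomialFamily

variable {ι κ E : Type*} [Fintype ι] [Fintype κ] [Fintype E] (P : MonomialFamily ι κ E)

/-- The coefficient of the product of the `x_e` in a monomial. -/
noncomputable def coefAt (α : ι) (t : κ → ℂ) : ℂ := P.coef α * ∏ i, t i ^ P.tdeg α i

noncomputable def term (α : ι) (t : κ → ℂ) (x : E → ℝ) : ℂ :=
  P.coefAt α t * ∏ e ∈ P.edges α, (x e : ℂ)

/-- The indices of the leading monomials. -/
abbrev Lead : Type _ := {α : ι // P.shift α = 0}

/-- The indices of the other monomials. -/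
abbrev Rest : Type _ := {α : ι // P.shift α ≠ 0}

open Classical in
/-- The sum of the leading monomials. -/
noncomputable def lead (t : κ → ℂ) (x : E → ℝ) : ℂ := ∑ α : P.Lead, P.term α t x

open Classical in
/-- The sum of the leading monomials with unit coefficients. -/
noncomputable def leadAbs (x : E → ℝ) : ℝ := ∑ α : P.Lead, ∏ e ∈ P.edges α, x e

open Classical in
/-- The part of multidegree `k` in the excess of the `s`-th power of the family. -/
noncomputable def powerPart (k : κ → ℕ) (s : ℂ) (t : κ → ℂ) (x : E → ℝ) : ℂ :=
  ∑ j ∈ Finset.range (∑ i, k i + 1), Ring.choose s j * P.lead t x ^ (s - j) *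
    ∑ f ∈ Finset.univ.filter (fun f : Fin j → P.Rest => ∀ i, ∑ l, P.shift (f l) i = k i),
      ∏ l, P.term (f l) t x

-- The part of order `n` under the common scaling splits into its multidegrees: the tuples of
-- non-leading monomials are sorted by the total excess for each `i`.
omit [Fintype E] in
open Classical in
lemma sum_powerPart [DecidableEq κ] (n : ℕ) (s : ℂ) (t : κ → ℂ) (x : E → ℝ) :
    ∑ k ∈ Finset.piAntidiag Finset.univ n, P.powerPart k s t x =
      ∑ j ∈ Finset.range (n + 1), Ring.choose s j * P.lead t x ^ (s - j) *
        ∑ f ∈ Finset.univ.filter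
          (fun f : Fin j → P.Rest => ∑ l, ∑ i, P.shift (f l) i = n), ∏ l, P.term (f l) t x := by
  have h1 : ∀ k ∈ Finset.piAntidiag (Finset.univ : Finset κ) n, P.powerPart k s t x =
      ∑ j ∈ Finset.range (n + 1), Ring.choose s j * P.lead t x ^ (s - j) *
        ∑ f ∈ Finset.univ.filter (fun f : Fin j → P.Rest => ∀ i, ∑ l, P.shift (f l) i = k i),
          ∏ l, P.term (f l) t x := fun k hk => by
    rw [powerPart, (Finset.mem_piAntidiag.1 hk).1]
  rw [Finset.sum_congr rfl h1, Finset.sum_comm]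
  refine Finset.sum_congr rfl fun j _ => ?_
  rw [← Finset.mul_sum]
  congr 1
  rw [← Finset.sum_fiberwise_of_maps_to (t := Finset.piAntidiag (Finset.univ : Finset κ) n)
    (g := fun f : Fin j → P.Rest => fun i => ∑ l, P.shift (f l) i)]
  · refine Finset.sum_congr rfl fun k hk => ?_
    congr 1
    ext f
    simp only [Finset.mem_filter, Finset.mem_univ, true_and]
    constructor
    · intro h
      refine ⟨?_, funext h⟩
      rw [Finset.sum_comm, Finset.sum_congr rfl fun i _ => h i]
      exact (Finset.mem_piAntidiag.1 hk).1
    · rintro ⟨-, rfl⟩ i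
      rfl
  · intro f hf
    simp only [Finset.mem_filter, Finset.mem_univ, true_and] at hf
    rw [Finset.mem_piAntidiag]
    refine ⟨?_, fun _ _ => Finset.mem_univ _⟩
    rw [← hf, Finset.sum_comm]

/-! ### Bounds -/

/-- The indicator function of a set of propagators: the exponent of the corresponding monomial. -/
noncomputable def indicatorVec (S : Finset E) : E → ℝ :=
  fun e => open Classical in if e ∈ S then 1 else 0

/-- A point in the interior of the Newton polytope of the leading monomials, at distance at least
`r` from its boundary. -/
def IsInnerPoint (y₀ : E → ℝ) (r : ℝ) : Prop :=
  0 < r ∧ ∀ y : E → ℝ, (∀ e, |y e - y₀ e| ≤ r) →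
    y ∈ convexHull ℝ {y | ∃ α, P.shift α = 0 ∧ y = indicatorVec (P.edges α)}

/-- The distance of `x` from the point `1`, in a multiplicative sense. -/
noncomputable def spread (x : E → ℝ) : ℝ := ∏ e, max (x e) (x e)⁻¹

variable {P}

lemma one_le_max_inv {a : ℝ} (ha : 0 < a) : 1 ≤ max a a⁻¹ := by
  rcases le_total 1 a with h | h
  · exact le_max_of_le_left h
  · exact le_max_of_le_right ((one_le_inv₀ ha).2 h)

lemma rpow_le_max_inv {a b : ℝ} (ha : 0 < a) (hb : |b| ≤ 1) : a ^ b ≤ max a a⁻¹ := by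
  rcases le_total 1 a with h | h
  · calc a ^ b ≤ a ^ (1 : ℝ) := Real.rpow_le_rpow_of_exponent_le h (abs_le.1 hb).2
      _ = a := Real.rpow_one a
      _ ≤ _ := le_max_left _ _
  · calc a ^ b ≤ a ^ (-1 : ℝ) := Real.rpow_le_rpow_of_exponent_ge ha h (abs_le.1 hb).1
      _ = a⁻¹ := Real.rpow_neg_one a
      _ ≤ _ := le_max_right _ _

lemma one_le_spread {x : E → ℝ} (hx : ∀ e, 0 < x e) : 1 ≤ spread x := by
  simpa [spread] using Finset.prod_le_prod (s := Finset.univ) (f := fun _ : E => (1 : ℝ))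
    (g := fun e => max (x e) (x e)⁻¹) (fun _ _ => zero_le_one) fun e _ => one_le_max_inv (hx e)

lemma prod_rpow_le_spread {x : E → ℝ} (hx : ∀ e, 0 < x e) {b : E → ℝ} (hb : ∀ e, |b e| ≤ 1) :
    ∏ e, x e ^ b e ≤ spread x :=
  Finset.prod_le_prod (fun e _ => (Real.rpow_pos_of_pos (hx e) _).le)
    fun e _ => rpow_le_max_inv (hx e) (hb e)

lemma prod_edges_eq (x : E → ℝ) (S : Finset E) :
    ∏ e ∈ S, x e = ∏ e, x e ^ indicatorVec S e := by
  classical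
  rw [← Finset.prod_subset (Finset.subset_univ S)]
  · exact Finset.prod_congr rfl fun e he => by simp [indicatorVec, he]
  · intro e _ he
    simp [indicatorVec, he]

lemma prod_edges_le_spread {x : E → ℝ} (hx : ∀ e, 0 < x e) (S : Finset E) :
    ∏ e ∈ S, x e ≤ spread x := by
  rw [prod_edges_eq]
  refine prod_rpow_le_spread hx fun e => ?_
  unfold indicatorVec
  split_ifs <;> simp

/-- A monomial with exponent in the Newton polytope is bounded by the sum of the leading ones. -/
lemma prod_rpow_le_leadAbs {x : E → ℝ} (hx : ∀ e, 0 < x e) {y : E → ℝ}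
    (hy : y ∈ convexHull ℝ {y | ∃ α, P.shift α = 0 ∧ y = indicatorVec (P.edges α)}) :
    ∏ e, x e ^ y e ≤ P.leadAbs x := by
  classical
  have hexp : ∀ y : E → ℝ, ∏ e, x e ^ y e = Real.exp (∑ e, Real.log (x e) * y e) := fun y => by
    rw [Real.exp_sum]
    exact Finset.prod_congr rfl fun e _ => Real.rpow_def_of_pos (hx e) _
  let ℓ : (E → ℝ) →ₗ[ℝ] ℝ := ∑ e, Real.log (x e) • LinearMap.proj e
  have hℓ : ∀ y, ℓ y = ∑ e, Real.log (x e) * y e := fun y => by simp [ℓ]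
  -- The monomial is the exponential of a linear form in its exponent vector, hence convex in it. It
  -- suffices to bound it at the exponents of the leading monomials, where it is one of the
  -- summands.
  have hconv : ConvexOn ℝ univ fun y : E → ℝ => ∏ e, x e ^ y e := by
    have := convexOn_exp.comp_linearMap ℓ
    simp only [preimage_univ] at this
    refine this.congr fun y _ => ?_
    simp only [Function.comp_apply, hexp, hℓ]
  have hsub := convexHull_min (s := {y | ∃ α, P.shift α = 0 ∧ y = indicatorVec (P.edges α)})
    (t := {y ∈ univ | ∏ e, x e ^ y e ≤ P.leadAbs x}) ?_ (hconv.convex_le _)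
  · exact (hsub hy).2
  · rintro _ ⟨α, hα, rfl⟩
    refine ⟨mem_univ _, ?_⟩
    rw [← prod_edges_eq, leadAbs]
    exact Finset.single_le_sum (f := fun α : P.Lead => ∏ e ∈ P.edges α, x e)
      (fun α _ => (Finset.prod_pos fun e _ => hx e).le) (Finset.mem_univ (⟨α, hα⟩ : P.Lead))

omit [Fintype ι] [Fintype κ] [Fintype E] in
lemma IsInnerPoint.abs_le_one {y₀ : E → ℝ} {r : ℝ} (h : P.IsInnerPoint y₀ r) (e : E) :
    |y₀ e| ≤ 1 := by
  have h1 := h.2 y₀ (by simp [h.1.le])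
  have h2 : convexHull ℝ {y | ∃ α, P.shift α = 0 ∧ y = indicatorVec (P.edges α)} ⊆
      Icc (0 : E → ℝ) 1 := by
    refine convexHull_min ?_ (convex_Icc _ _)
    rintro _ ⟨α, -, rfl⟩
    constructor <;> intro e <;> simp only [indicatorVec, Pi.zero_apply, Pi.one_apply] <;>
      split_ifs <;> norm_num
  have h3 := h2 h1
  exact abs_le.2 ⟨by have := h3.1 e; simp at this; linarith, h3.2 e⟩

/-- Moving each coordinate of `y₀` by `r`, upwards where `x e ≥ 1` and downwards elsewhere, stays in
the polytope and gains the factor `spread x ^ r`. This is the gain that makes the integrals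
converge. -/
lemma IsInnerPoint.mul_spread_rpow_le {y₀ : E → ℝ} {r : ℝ} (h : P.IsInnerPoint y₀ r) {x : E → ℝ}
    (hx : ∀ e, 0 < x e) : (∏ e, x e ^ y₀ e) * spread x ^ r ≤ P.leadAbs x := by
  have key := prod_rpow_le_leadAbs (P := P) hx
    (h.2 (fun e => y₀ e + if 1 ≤ x e then r else -r) fun e => by
      rw [add_sub_cancel_left]
      split_ifs <;> simp [abs_of_pos h.1])
  refine le_trans (le_of_eq ?_) key
  rw [spread, ← Real.finsetProd_rpow _ _ fun e _ => (zero_le_one.trans (one_le_max_inv (hx e))),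
    ← Finset.prod_mul_distrib]
  refine Finset.prod_congr rfl fun e _ => ?_
  rw [Real.rpow_add (hx e)]
  congr 1
  split_ifs with h1
  · rw [max_eq_left ((inv_le_one_of_one_le₀ h1).trans h1)]
  · rw [not_le] at h1
    rw [max_eq_right (h1.le.trans ((one_le_inv₀ (hx e)).2 h1.le)), Real.inv_rpow (hx e).le,
      Real.rpow_neg (hx e).le]

/-- All leading coefficients at `t` are in a common sector that is bounded away from the negative
real axis, and all coefficients are bounded. -/
structure InSector (P : MonomialFamily ι κ E) (ω : ℂ) (c C : ℝ) (t : κ → ℂ) : Prop where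
  lead_le : ∀ α : P.Lead, c ≤ (ω * P.coefAt α t).re
  bound : ∀ α, ‖P.coefAt α t‖ ≤ C

lemma leadAbs_pos {y₀ : E → ℝ} {r : ℝ} (h : P.IsInnerPoint y₀ r) {x : E → ℝ}
    (hx : ∀ e, 0 < x e) : 0 < P.leadAbs x :=
  lt_of_lt_of_le (mul_pos (Finset.prod_pos fun e _ => Real.rpow_pos_of_pos (hx e) _)
    (Real.rpow_pos_of_pos (zero_lt_one.trans_le (one_le_spread hx)) _)) (h.mul_spread_rpow_le hx)

omit [Fintype E] in
lemma InSector.le_re {ω : ℂ} {c C : ℝ} {t : κ → ℂ} (hs : P.InSector ω c C t)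
    {x : E → ℝ} (hx : ∀ e, 0 < x e) : c * P.leadAbs x ≤ (ω * P.lead t x).re := by
  classical
  rw [lead, leadAbs, Finset.mul_sum, Finset.mul_sum, Complex.re_sum]
  refine Finset.sum_le_sum fun α _ => ?_
  rw [term, ← Complex.ofReal_prod, ← mul_assoc, Complex.re_mul_ofReal]
  exact mul_le_mul_of_nonneg_right (hs.lead_le α) (Finset.prod_pos fun e _ => hx e).le

/-- The open half-plane `0 < (ω * z).re` with `0 < ω.re` contains no real `z ≤ 0`. -/
lemma InSector.mem_slitPlane {ω : ℂ} {c C : ℝ} {t : κ → ℂ} (hs : P.InSector ω c C t)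
    (hω : 0 < ω.re) (hc : 0 < c) {y₀ : E → ℝ} {r : ℝ} (h : P.IsInnerPoint y₀ r) {x : E → ℝ}
    (hx : ∀ e, 0 < x e) : P.lead t x ∈ Complex.slitPlane := by
  have h1 := (mul_pos hc (leadAbs_pos h hx)).trans_le (hs.le_re hx)
  by_contra hn
  rw [Complex.mem_slitPlane_iff, not_or, not_lt, not_not] at hn
  rw [Complex.mul_re, hn.2, mul_zero, sub_zero] at h1
  nlinarith [hn.1]

omit [Fintype E] in
lemma InSector.le_norm {ω : ℂ} {c C : ℝ} {t : κ → ℂ} (hs : P.InSector ω c C t)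
    (hω : 0 < ω.re) {x : E → ℝ} (hx : ∀ e, 0 < x e) :
    c / ‖ω‖ * P.leadAbs x ≤ ‖P.lead t x‖ := by
  have hω0 : 0 < ‖ω‖ := norm_pos_iff.2 fun h => by simp [h] at hω
  have h1 := (hs.le_re hx).trans (Complex.re_le_norm _)
  rw [norm_mul] at h1
  rw [div_mul_eq_mul_div, div_le_iff₀ hω0]
  linarith

/-- The exponents `ν` and the dimension `D` for which the parts of order at most `n` are absolutely
integrable, by power counting. -/
def convergenceDomain (y₀ : E → ℝ) (r : ℝ) (n : ℕ) : Set ((E → ℂ) × ℂ) :=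
  {z | 2 * n + 2 < r * (z.2.re / 2) ∧ ∀ e, |(z.1 e).re - z.2.re / 2 * y₀ e| < 1}

lemma isOpen_convergenceDomain (y₀ : E → ℝ) (r : ℝ) (n : ℕ) :
    IsOpen (convergenceDomain y₀ r n) := by
  simp only [convergenceDomain, ofPred_and, ofPred_forall]
  refine IsOpen.inter (isOpen_lt (by fun_prop) (by fun_prop)) (isOpen_iInter_of_finite fun e =>
    isOpen_lt (by fun_prop) (by fun_prop))

-- Take `D / 2 = (2 * n + 3) / r` and `ν` equal to this multiple of `y₀`.
omit [Fintype E] in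
lemma convergenceDomain_nonempty (y₀ : E → ℝ) {r : ℝ} (hr : 0 < r) (n : ℕ) :
    (convergenceDomain y₀ r n).Nonempty := by
  refine ⟨(fun e => (((2 * n + 3) / r * y₀ e : ℝ) : ℂ), ((2 * ((2 * n + 3) / r) : ℝ) : ℂ)), ?_, ?_⟩
  · simp only [Complex.ofReal_re]
    field_simp
    linarith
  · intro e
    simp only [Complex.ofReal_re]
    have : (2 * n + 3) / r * y₀ e - 2 * ((2 * n + 3) / r) / 2 * y₀ e = 0 := by ring
    rw [this]
    simp

/-- The integrand of multidegree `k`, with the measure `∏ dx_e / x_e`. -/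
noncomputable def integrandPart (P : MonomialFamily ι κ E) (k : κ → ℕ) (z : (E → ℂ) × ℂ)
    (t : κ → ℂ) (x : E → ℝ) : ℂ :=
  (∏ e, (x e : ℂ) ^ z.1 e) * P.powerPart k (-z.2 / 2) t x * ∏ e, ((x e)⁻¹ : ℂ)

/-- One inverse power of `spread` suffices for integrability against `∏ dx_e / x_e`, since `max x
x⁻¹ * x = max (x ^ 2) 1 ≥ (1 + x ^ 2) / 2`. -/
lemma inv_spread_mul_le {x : E → ℝ} (hx : ∀ e, 0 < x e) :
    (spread x)⁻¹ * ∏ e, (x e)⁻¹ ≤ ∏ e, 2 * (1 + x e ^ 2)⁻¹ := by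
  rw [spread, ← Finset.prod_inv_distrib, ← Finset.prod_mul_distrib]
  refine Finset.prod_le_prod (fun e _ => ?_) fun e _ => ?_
  · have := hx e
    have := one_le_max_inv (hx e)
    positivity
  · have h0 := hx e
    have h1 := one_le_max_inv h0
    rw [← mul_inv, ← div_eq_mul_inv, inv_le_comm₀ (by positivity) (by positivity), inv_div,
      max_mul_of_nonneg _ _ h0.le, inv_mul_cancel₀ h0.ne']
    rcases le_total 1 (x e * x e) with h | h
    · exact le_max_of_le_left (by nlinarith)
    · exact le_max_of_le_right (by nlinarith)

/-- Power counting for one term of the expansion. -/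
lemma norm_power_mul_le {y₀ : E → ℝ} {r : ℝ} (h : P.IsInnerPoint y₀ r) {n : ℕ}
    {z : (E → ℂ) × ℂ} (hz : z ∈ convergenceDomain y₀ r n) {ω : ℂ} (hω : 0 < ω.re) {c C : ℝ}
    (hc : 0 < c) {t : κ → ℂ} (hs : P.InSector ω c C t) {x : E → ℝ} (hx : ∀ e, 0 < x e)
    {j : ℕ} (hj : j ≤ n) (f : Fin j → P.Rest) :
    ‖∏ e, (x e : ℂ) ^ z.1 e‖ * (‖P.lead t x ^ (-z.2 / 2 - j)‖ * ‖∏ l, P.term (f l) t x‖) ≤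
      Real.exp (Real.pi * |(-z.2 / 2 - j).im|) * (c / ‖ω‖) ^ (-(z.2.re / 2 + j)) * C ^ j *
        (spread x)⁻¹ := by
  set a := z.2.re / 2 with ha
  set S := spread x with hS
  have hS1 : 1 ≤ S := one_le_spread hx
  have hS0 : 0 < S := zero_lt_one.trans_le hS1
  set A := ∏ e, x e ^ y₀ e with hA
  have hA0 : 0 < A := Finset.prod_pos fun e _ => Real.rpow_pos_of_pos (hx e) _
  have hr := h.1
  have hz1 : 2 * n + 2 < r * a := hz.1
  have ha0 : 0 < a := by
    by_contra hn
    have : r * a ≤ 0 := mul_nonpos_of_nonneg_of_nonpos hr.le (not_lt.1 hn)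
    have : (0 : ℝ) ≤ n := n.cast_nonneg
    linarith
  have hω0 : 0 < ‖ω‖ := norm_pos_iff.2 fun h => by simp [h] at hω
  have hc1 : 0 < c / ‖ω‖ := div_pos hc hω0
  -- The single power of `S` pays for the distance, less than `1` in each coordinate, of `ν` from
  -- `(D / 2) * y₀`.
  have b1 : ‖∏ e, (x e : ℂ) ^ z.1 e‖ ≤ A ^ a * S := by
    rw [norm_prod, hA, ← Real.finsetProd_rpow _ _ fun e _ => (Real.rpow_pos_of_pos (hx e) _).le]
    calc ∏ e, ‖(x e : ℂ) ^ z.1 e‖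
        = (∏ e, (x e ^ y₀ e) ^ a) * ∏ e, x e ^ ((z.1 e).re - a * y₀ e) := by
          rw [← Finset.prod_mul_distrib]
          refine Finset.prod_congr rfl fun e _ => ?_
          rw [Complex.norm_cpow_eq_rpow_re_of_pos (hx e), ← Real.rpow_mul (hx e).le,
            ← Real.rpow_add (hx e)]
          congr 1
          ring
      _ ≤ _ := mul_le_mul_of_nonneg_left
          (prod_rpow_le_spread hx fun e => (hz.2 e).le)
          (Finset.prod_nonneg fun e _ => (Real.rpow_pos_of_pos (Real.rpow_pos_of_pos (hx e) _) _).le)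
  have b2 : ‖P.lead t x ^ (-z.2 / 2 - j)‖ ≤ (c / ‖ω‖ * (A * S ^ r)) ^ (-(a + j)) *
      Real.exp (Real.pi * |(-z.2 / 2 - j).im|) := by
    have hL := hs.mem_slitPlane hω hc h hx
    have e1 : (-z.2 / 2 - (j : ℂ)).re = -(a + j) := by
      simp [ha]; ring
    refine (Complex.norm_cpow_le _ _).trans ?_
    rw [e1, div_eq_mul_inv, ← Real.exp_neg]
    refine mul_le_mul ?_ ?_ (Real.exp_pos _).le (by positivity)
    · refine Real.rpow_le_rpow_of_nonpos (by positivity) ?_ (by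
        have : (0 : ℝ) ≤ j := j.cast_nonneg
        linarith)
      exact (mul_le_mul_of_nonneg_left (h.mul_spread_rpow_le hx) hc1.le).trans (hs.le_norm hω hx)
    · rw [Real.exp_le_exp]
      refine (neg_le_abs _).trans ?_
      rw [abs_mul]
      exact mul_le_mul_of_nonneg_right (Complex.abs_arg_le_pi _) (abs_nonneg _)
  have hC0 : ∀ l : Fin j, 0 ≤ C := fun l => (norm_nonneg _).trans (hs.bound (f l))
  have b3 : ‖∏ l, P.term (f l) t x‖ ≤ C ^ j * S ^ j := by
    rw [norm_prod, ← mul_pow]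
    calc ∏ l, ‖P.term (f l) t x‖ ≤ ∏ _l : Fin j, C * S := by
          refine Finset.prod_le_prod (fun l _ => norm_nonneg _) fun l _ => ?_
          rw [term, norm_mul, ← Complex.ofReal_prod, Complex.norm_real, Real.norm_eq_abs,
            abs_of_pos (Finset.prod_pos fun e _ => hx e)]
          exact mul_le_mul (hs.bound _) (prod_edges_le_spread hx _)
            (Finset.prod_pos fun e _ => hx e).le (hC0 l)
      _ = (C * S) ^ j := by simp
  have hCj : 0 ≤ C ^ j := by
    rcases Nat.eq_zero_or_pos j with rfl | hj0
    · simp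
    · exact pow_nonneg (hC0 ⟨0, hj0⟩) _
  -- The exponent `-(a + j)` of the leading polynomial leaves `A⁻¹ ^ j` uncancelled, which costs `j`
  -- more powers of `S`.
  have b4 : A⁻¹ ≤ S := by
    rw [hA, ← Finset.prod_inv_distrib]
    have := prod_rpow_le_spread hx (b := fun e => -y₀ e) fun e => by
      rw [abs_neg]; exact h.abs_le_one e
    refine le_trans (le_of_eq (Finset.prod_congr rfl fun e _ => ?_)) this
    rw [Real.rpow_neg (hx e).le]
  calc _ ≤ (A ^ a * S) * (((c / ‖ω‖ * (A * S ^ r)) ^ (-(a + j)) *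
      Real.exp (Real.pi * |(-z.2 / 2 - j).im|)) * (C ^ j * S ^ j)) := by gcongr
    _ = Real.exp (Real.pi * |(-z.2 / 2 - j).im|) * (c / ‖ω‖) ^ (-(a + j)) * C ^ j *
        ((A⁻¹) ^ j * (S * S ^ j * S ^ (-(r * (a + j))))) := by
      rw [Real.mul_rpow hc1.le (by positivity), Real.mul_rpow hA0.le (by positivity),
        ← Real.rpow_mul hS0.le, neg_add, Real.rpow_add hA0, Real.rpow_neg hA0.le a,
        Real.rpow_neg hA0.le, Real.rpow_natCast, inv_pow, mul_add, ← mul_neg, neg_add]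
      have : A ^ a ≠ 0 := (Real.rpow_pos_of_pos hA0 _).ne'
      field_simp
    _ ≤ Real.exp (Real.pi * |(-z.2 / 2 - j).im|) * (c / ‖ω‖) ^ (-(a + j)) * C ^ j *
        (S ^ j * (S * S ^ j * S ^ (-(r * (a + j))))) := by gcongr
    _ ≤ _ := by
      refine mul_le_mul_of_nonneg_left ?_ (by positivity)
      have e2 : S ^ j * (S * S ^ j * S ^ (-(r * (a + j)))) =
          S ^ ((j : ℝ) + (1 + j + -(r * (a + j)))) := by
        rw [Real.rpow_add hS0, Real.rpow_add hS0, Real.rpow_add hS0, Real.rpow_natCast,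
          Real.rpow_one]
      rw [e2, ← Real.rpow_neg_one]
      -- The exponent `1 + 2 * j - r * (a + j)` is at most `-1`, since `j ≤ n` and `r * a > 2 * n +
      -- 2`. This explains the constant in `convergenceDomain`.
      refine Real.rpow_le_rpow_of_exponent_le hS1 ?_
      have : (j : ℝ) ≤ n := by exact_mod_cast hj
      have : 0 ≤ r * j := by positivity
      nlinarith

/-- Power counting: a bound that is uniform in a sector. -/
lemma exists_norm_integrandPart_le {y₀ : E → ℝ} {r : ℝ} (h : P.IsInnerPoint y₀ r) {k : κ → ℕ}
    {z : (E → ℂ) × ℂ} (hz : z ∈ convergenceDomain y₀ r (∑ i, k i)) {ω : ℂ} (hω : 0 < ω.re)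
    {c C : ℝ} (hc : 0 < c) : ∃ B : ℝ, ∀ t, P.InSector ω c C t → ∀ x : E → ℝ, (∀ e, 0 < x e) →
      ‖P.integrandPart k z t x‖ ≤ B * ∏ e, 2 * (1 + x e ^ 2)⁻¹ := by
  classical
  set b : ℕ → ℝ := fun j => ‖Ring.choose (-z.2 / 2) j‖ *
    ∑ _f ∈ Finset.univ.filter (fun f : Fin j → P.Rest => ∀ i, ∑ l, P.shift (f l) i = k i),
      Real.exp (Real.pi * |(-z.2 / 2 - j).im|) * (c / ‖ω‖) ^ (-(z.2.re / 2 + j)) * |C| ^ j with hb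
  have hω0 : 0 < ‖ω‖ := norm_pos_iff.2 fun h => by simp [h] at hω
  refine ⟨∑ j ∈ Finset.range (∑ i, k i + 1), b j, fun t hs x hx => ?_⟩
  have hs' : P.InSector ω c |C| t := ⟨hs.lead_le, fun α => (hs.bound α).trans (le_abs_self C)⟩
  have hS0 : 0 < spread x := zero_lt_one.trans_le (one_le_spread hx)
  have hB0 : 0 ≤ ∑ j ∈ Finset.range (∑ i, k i + 1), b j := by
    refine Finset.sum_nonneg fun j _ => mul_nonneg (norm_nonneg _) (Finset.sum_nonneg fun f _ => ?_)
    have : 0 ≤ c / ‖ω‖ := (div_pos hc hω0).le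
    positivity
  have hxi : ‖∏ e, ((x e)⁻¹ : ℂ)‖ = ∏ e, (x e)⁻¹ := by
    rw [norm_prod]
    exact Finset.prod_congr rfl fun e _ => by
      rw [norm_inv, Complex.norm_real, Real.norm_of_nonneg (hx e).le]
  have key : ‖∏ e, (x e : ℂ) ^ z.1 e‖ * ‖P.powerPart k (-z.2 / 2) t x‖ ≤
      (∑ j ∈ Finset.range (∑ i, k i + 1), b j) * (spread x)⁻¹ := by
    rw [powerPart, Finset.sum_mul]
    refine (mul_le_mul_of_nonneg_left (norm_sum_le _ _) (norm_nonneg _)).trans ?_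
    rw [Finset.mul_sum]
    refine Finset.sum_le_sum fun j hj => ?_
    rw [norm_mul, norm_mul, hb, mul_assoc ‖Ring.choose _ _‖, mul_left_comm, mul_assoc]
    refine mul_le_mul_of_nonneg_left ?_ (norm_nonneg _)
    rw [Finset.sum_mul, ← mul_assoc]
    refine (mul_le_mul_of_nonneg_left (norm_sum_le _ _) (by positivity)).trans ?_
    rw [Finset.mul_sum]
    refine Finset.sum_le_sum fun f _ => ?_
    rw [mul_assoc]
    exact norm_power_mul_le h hz hω hc hs' hx (Nat.lt_succ_iff.1 (Finset.mem_range.1 hj)) f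
  rw [integrandPart, norm_mul, norm_mul, hxi]
  calc _ ≤ (∑ j ∈ Finset.range (∑ i, k i + 1), b j) * (spread x)⁻¹ * ∏ e, (x e)⁻¹ :=
        mul_le_mul_of_nonneg_right key (Finset.prod_nonneg fun e _ => (inv_pos.2 (hx e)).le)
    _ ≤ _ := by
        rw [mul_assoc]
        exact mul_le_mul_of_nonneg_left (inv_spread_mul_le hx) hB0

end MonomialFamily

/-! ### Rescaling and differentiation of integrals over positive parameters. -/

/-- Multiplication by a positive number commutes with complex powers. -/
lemma Complex.exp_mul_cpow (a : ℝ) (z s : ℂ) :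
    (Complex.exp a * z) ^ s = Complex.exp (a * s) * z ^ s := by
  rcases eq_or_ne z 0 with rfl | hz
  · rcases eq_or_ne s 0 with rfl | hs
    · simp
    · simp [hs]
  · rw [Complex.cpow_def_of_ne_zero (mul_ne_zero (Complex.exp_ne_zero _) hz),
      Complex.cpow_def_of_ne_zero hz, ← Complex.ofReal_exp,
      Complex.log_ofReal_mul (Real.exp_pos a) hz, Real.log_exp, add_mul, Complex.exp_add]

/-- The derivative of an integral of holomorphic functions with a common bound. -/
lemma differentiableAt_integral_of_norm_le {X : Type*} [MeasurableSpace X] {μ : Measure X}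
    {F : ℂ → X → ℂ} {z₀ : ℂ} {R : ℝ} (hR : 0 < R) {bound : X → ℝ} (hb : Integrable bound μ)
    (hmeas : ∀ z, AEStronglyMeasurable (F z) μ)
    (hF : ∀ᵐ x ∂μ, ∀ z ∈ Metric.ball z₀ R, ‖F z x‖ ≤ bound x)
    (hd : ∀ᵐ x ∂μ, DifferentiableOn ℂ (fun z => F z x) (Metric.ball z₀ R)) :
    DifferentiableAt ℂ (fun z => ∫ x, F z x ∂μ) z₀ := by
  have hmem : z₀ ∈ Metric.ball z₀ R := Metric.mem_ball_self hR
  have hderiv : ∀ᵐ x ∂μ, ∀ z ∈ Metric.ball z₀ (R / 2),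
      HasDerivAt (fun z => F z x) (deriv (fun z => F z x) z) z := by
    filter_upwards [hd] with x hx z hz
    exact (hx.differentiableAt (Metric.isOpen_ball.mem_nhds
      (Metric.ball_subset_ball (by linarith) hz))).hasDerivAt
  -- The derivative is a limit of a sequence of measurable difference quotients.
  have hmeas' : AEStronglyMeasurable (fun x => deriv (fun z => F z x) z₀) μ := by
    have hlim : Tendsto (fun n : ℕ => (R / 2 / (n + 1) : ℝ)) atTop (𝓝 0) :=
      tendsto_const_div_atTop_nhds_zero_nat (R / 2) |>.comp (tendsto_add_atTop_nat 1) |>.congr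
        fun n => by simp
    refine aestronglyMeasurable_of_tendsto_ae atTop
      (f := fun (n : ℕ) x => ((R / 2 / (n + 1) : ℝ) : ℂ)⁻¹ •
        (F (z₀ + (R / 2 / (n + 1) : ℝ)) x - F z₀ x))
      (fun n => by
        exact ((hmeas (z₀ + (R / 2 / (n + 1) : ℝ))).sub (hmeas z₀)).const_smul
          ((R / 2 / (n + 1) : ℝ) : ℂ)⁻¹) ?_
    filter_upwards [hderiv] with x hx
    have h1 := (hx z₀ (Metric.mem_ball_self (half_pos hR))).tendsto_slope_zero
    refine h1.comp (tendsto_nhdsWithin_iff.2 ⟨?_, Eventually.of_forall fun n => ?_⟩)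
    · have := (Complex.continuous_ofReal.tendsto 0).comp hlim
      exact this
    · have : (0 : ℝ) < R / 2 / (n + 1) := by positivity
      exact Complex.ofReal_ne_zero.2 this.ne'
  refine (hasDerivAt_integral_of_dominated_loc_of_deriv_le
    (F' := fun z x => deriv (fun z => F z x) z) (bound := fun x => bound x / (R / 4))
    (Metric.ball_mem_nhds z₀ (half_pos hR)) (Eventually.of_forall hmeas) ?_ hmeas' ?_
    (hb.div_const _) hderiv).2.differentiableAt
  · exact hb.mono' (hmeas _) (hF.mono fun x hx => hx z₀ hmem)
  · filter_upwards [hd, hF] with x hdx hFx z hz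
    -- Cauchy's estimate on circles of radius `R / 4` bounds the derivative by a multiple of
    -- `bound`.
    have hsub : Metric.closedBall z (R / 4) ⊆ Metric.ball z₀ R := by
      intro w hw
      rw [Metric.mem_ball] at hz ⊢
      rw [Metric.mem_closedBall] at hw
      linarith [dist_triangle w z z₀]
    refine Complex.norm_deriv_le_of_forall_mem_sphere_norm_le (by positivity) ?_ fun w hw =>
      hFx w (hsub (Metric.sphere_subset_closedBall hw))
    exact (hdx.mono hsub).diffContOnCl_ball le_rfl

/-- The measure `∏ dx_e / x_e` is invariant under rescaling. -/
lemma setIntegral_pos_comp_mul {E : Type*} [Fintype E] (F : (E → ℝ) → ℂ) {c : E → ℝ}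
    (hc : ∀ e, 0 < c e) :
    ∫ x in {x : E → ℝ | ∀ e, 0 < x e}, F (fun e => c e * x e) * ∏ e, ((x e)⁻¹ : ℂ) =
      ∫ x in {x : E → ℝ | ∀ e, 0 < x e}, F x * ∏ e, ((x e)⁻¹ : ℂ) := by
  classical
  have hms : MeasurableSet {x : E → ℝ | ∀ e, 0 < x e} := by
    simp only [ofPred_forall]
    exact MeasurableSet.iInter fun e => measurableSet_lt measurable_const (measurable_pi_apply e)
  have hdet : (Matrix.diagonal c).det ≠ 0 := by
    rw [Matrix.det_diagonal]
    exact (Finset.prod_pos fun e _ => hc e).ne'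
  have hvol := Real.smul_map_diagonal_volume_pi hdet
  have happ : ∀ x, Matrix.toLin' (Matrix.diagonal c) x = fun e => c e * x e := fun x => by
    ext e; simp [Matrix.mulVec_diagonal]
  have hemb : MeasurableEmbedding (Matrix.toLin' (Matrix.diagonal c) : (E → ℝ) → E → ℝ) := by
    have : (Matrix.toLin' (Matrix.diagonal c) : (E → ℝ) → E → ℝ) =
        (Homeomorph.piCongrRight fun e => Homeomorph.mulLeft₀ (c e) (hc e).ne') := by
      ext x e; simp [Matrix.mulVec_diagonal]
    rw [this]
    exact Homeomorph.measurableEmbedding _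
  rw [← integral_indicator hms, ← integral_indicator hms]
  conv_rhs => rw [← hvol]
  rw [integral_smul_measure, hemb.integral_map, ENNReal.toReal_ofReal (abs_nonneg _),
    ← integral_smul]
  congr 1
  ext x
  rw [happ]
  have hpos : (fun e => c e * x e) ∈ {x : E → ℝ | ∀ e, 0 < x e} ↔ x ∈ {x : E → ℝ | ∀ e, 0 < x e} :=
    forall_congr' fun e => by simp [hc e]
  by_cases hx : x ∈ {x : E → ℝ | ∀ e, 0 < x e}
  · rw [indicator_of_mem hx, indicator_of_mem (hpos.2 hx), Matrix.det_diagonal,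
      abs_of_pos (Finset.prod_pos fun e _ => hc e), Complex.real_smul, mul_left_comm]
    congr 1
    rw [Complex.ofReal_prod, ← Finset.prod_mul_distrib]
    refine Finset.prod_congr rfl fun e _ => ?_
    have : (c e : ℂ) ≠ 0 := by exact_mod_cast (hc e).ne'
    rw [Complex.ofReal_mul, mul_inv, mul_inv_cancel_left₀ this]
  · rw [indicator_of_notMem hx, indicator_of_notMem (fun h => hx (hpos.1 h)), smul_zero]

namespace MonomialFamily

variable {ι κ E : Type*} [Fintype ι] [Fintype κ] [Fintype E] {P : MonomialFamily ι κ E}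

lemma measurableSet_pos : MeasurableSet {x : E → ℝ | ∀ e, 0 < x e} := by
  simp only [ofPred_forall]
  exact MeasurableSet.iInter fun e => measurableSet_lt measurable_const (measurable_pi_apply e)

lemma measurable_integrandPart (k : κ → ℕ) (z : (E → ℂ) × ℂ) (t : κ → ℂ) :
    Measurable (P.integrandPart k z t) := by
  classical
  have hterm : ∀ α, Measurable (P.term α t) := fun α => by
    unfold term
    refine measurable_const.mul (Finset.measurable_fun_prod _ fun e _ => by fun_prop)
  have hlead : Measurable (P.lead t) := by
    unfold lead
    exact Finset.measurable_fun_sum _ fun α _ => hterm α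
  unfold integrandPart powerPart
  refine ((Finset.measurable_fun_prod _ fun e _ => ?_).mul
    (Finset.measurable_fun_sum _ fun j _ => ?_)).mul (Finset.measurable_fun_prod _ fun e _ => by fun_prop)
  · exact Measurable.pow_const (by fun_prop) _
  · exact (measurable_const.mul (hlead.pow_const _)).mul
      (Finset.measurable_fun_sum _ fun f _ => Finset.measurable_fun_prod _ fun l _ => hterm _)

lemma integrable_bound : Integrable fun x : E → ℝ => ∏ e, 2 * (1 + x e ^ 2)⁻¹ :=
  Integrable.fintype_prod (f := fun _ : E => fun y : ℝ => 2 * (1 + y ^ 2)⁻¹)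
    fun _ => integrable_inv_one_add_sq.const_mul 2

lemma integrableOn_integrandPart {y₀ : E → ℝ} {r : ℝ} (h : P.IsInnerPoint y₀ r) {k : κ → ℕ}
    {z : (E → ℂ) × ℂ} (hz : z ∈ convergenceDomain y₀ r (∑ i, k i)) {ω : ℂ} (hω : 0 < ω.re)
    {c C : ℝ} (hc : 0 < c) {t : κ → ℂ} (hs : P.InSector ω c C t) :
    IntegrableOn (P.integrandPart k z t) {x | ∀ e, 0 < x e} := by
  obtain ⟨B, hB⟩ := exists_norm_integrandPart_le (C := C) h hz hω hc
  exact ((integrable_bound.const_mul B).integrableOn).mono'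
    (measurable_integrandPart k z t).aestronglyMeasurable
    ((ae_restrict_iff' measurableSet_pos).2 (Eventually.of_forall fun x hx => hB t hs x hx))

/-! ### Homogeneity -/

variable (P) in
/-- The monomials are homogeneous with respect to the rescaling of `t i` by a factor `c` and of
`x e` by `c ^ u i e`, up to the excess. -/
def IsHomogeneous (u : κ → E → ℝ) (w : κ → ℝ) : Prop :=
  ∀ α i, ∑ e ∈ P.edges α, u i e + P.tdeg α i = w i + P.shift α i

/-- The exponents of the integrals of the parts of the family. -/
noncomputable def scalingExponent (u : κ → E → ℝ) (w : κ → ℝ) (z : (E → ℂ) × ℂ) (i : κ) : ℂ :=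
  ∑ e, (u i e : ℂ) * z.1 e - w i * z.2 / 2

/-- The integral of the part of multidegree `k`. -/
noncomputable def partIntegral (P : MonomialFamily ι κ E) (k : κ → ℕ) (z : (E → ℂ) × ℂ)
    (t : κ → ℂ) : ℂ :=
  ∫ x in {x : E → ℝ | ∀ e, 0 < x e}, P.integrandPart k z t x

omit [Fintype ι] [Fintype E] in
lemma IsHomogeneous.term_rescale {u : κ → E → ℝ} {w : κ → ℝ} (hP : P.IsHomogeneous u w)
    (v : κ → ℝ) (α : ι) (t : κ → ℂ) (x : E → ℝ) :
    P.term α (fun i => Complex.exp (v i) * t i)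
      (fun e => Real.exp (∑ i, v i * u i e) * x e) =
      Complex.exp (∑ i, v i * w i : ℝ) * Complex.exp (∑ i, v i * P.shift α i : ℝ) *
        P.term α t x := by
  unfold term coefAt
  simp only [mul_pow, Complex.ofReal_mul, Finset.prod_mul_distrib]
  have e1 : ∏ i, Complex.exp (v i) ^ P.tdeg α i * (1 : ℂ) =
      Complex.exp (∑ i, v i * P.tdeg α i : ℝ) := by
    rw [Complex.ofReal_sum, Complex.exp_sum]
    refine Finset.prod_congr rfl fun i _ => ?_
    rw [← Complex.exp_nat_mul, mul_one]
    push_cast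
    rw [mul_comm]
  have e2 : ∏ e ∈ P.edges α, ((Real.exp (∑ i, v i * u i e) : ℝ) : ℂ) =
      Complex.exp (∑ i, v i * ∑ e ∈ P.edges α, u i e : ℝ) := by
    rw [← Complex.ofReal_prod, ← Real.exp_sum, ← Complex.ofReal_exp, Finset.sum_comm]
    simp only [Finset.mul_sum]
  simp only [mul_one] at e1
  rw [e1, e2, ← Complex.exp_add]
  have e3 : (∑ i, v i * w i + ∑ i, v i * P.shift α i : ℝ) =
      ∑ i, v i * P.tdeg α i + ∑ i, v i * ∑ e ∈ P.edges α, u i e := by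
    rw [← Finset.sum_add_distrib, ← Finset.sum_add_distrib]
    refine Finset.sum_congr rfl fun i _ => ?_
    rw [← mul_add, ← mul_add, ← hP α i, add_comm]
  rw [← Complex.ofReal_add, e3, Complex.ofReal_add, Complex.exp_add]
  ring

-- The power `s - j` of the leading sum and the `j` other monomials together contribute the weight
-- `w` exactly `s` times, whatever `j` is. The excesses of the `j` monomials add up to `k`.
omit [Fintype E] in
lemma IsHomogeneous.powerPart_rescale {u : κ → E → ℝ} {w : κ → ℝ} (hP : P.IsHomogeneous u w)
    (v : κ → ℝ) (k : κ → ℕ) (s : ℂ) (t : κ → ℂ) (x : E → ℝ) :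
    P.powerPart k s (fun i => Complex.exp (v i) * t i)
      (fun e => Real.exp (∑ i, v i * u i e) * x e) =
      Complex.exp ((∑ i, v i * w i : ℝ) * s) * Complex.exp (∑ i, v i * k i : ℝ) *
        P.powerPart k s t x := by
  classical
  have hlead : P.lead (fun i => Complex.exp (v i) * t i)
      (fun e => Real.exp (∑ i, v i * u i e) * x e) =
      Complex.exp (∑ i, v i * w i : ℝ) * P.lead t x := by
    unfold lead
    rw [Finset.mul_sum]
    refine Finset.sum_congr rfl fun α _ => ?_
    rw [hP.term_rescale, α.2]
    simp
  unfold powerPart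
  rw [Finset.mul_sum]
  refine Finset.sum_congr rfl fun j _ => ?_
  rw [hlead, Complex.exp_mul_cpow, Finset.mul_sum, Finset.mul_sum, Finset.mul_sum]
  refine Finset.sum_congr rfl fun f hf => ?_
  have hk : ∏ l, Complex.exp (∑ i, v i * P.shift (f l) i : ℝ) =
      Complex.exp (∑ i, v i * k i : ℝ) := by
    rw [← Complex.exp_sum, ← Complex.ofReal_sum, Finset.sum_comm]
    congr 2
    refine Finset.sum_congr rfl fun i _ => ?_
    rw [← Finset.mul_sum, ← (Finset.mem_filter.1 hf).2 i]
    push_cast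
    rfl
  simp only [hP.term_rescale, Finset.prod_mul_distrib, hk, Finset.prod_const, Finset.card_univ,
    Fintype.card_fin]
  rw [mul_sub, Complex.exp_sub, ← Complex.exp_nat_mul, mul_comm (j : ℂ)]
  have := Complex.exp_ne_zero ((∑ i, v i * w i : ℝ) * (j : ℂ))
  field_simp

/-- Substitute `x e ↦ exp (∑ i, v i * u i e) * x e`, which preserves the measure. This needs no
convergence, because the change of variables also holds for the default value of the integral. -/
lemma IsHomogeneous.partIntegral_rescale {u : κ → E → ℝ} {w : κ → ℝ} (hP : P.IsHomogeneous u w)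
    (v : κ → ℝ) (k : κ → ℕ) (z : (E → ℂ) × ℂ) (t : κ → ℂ) :
    P.partIntegral k z (fun i => Complex.exp (v i) * t i) =
      Complex.exp (∑ i, v i * (scalingExponent u w z i + k i)) * P.partIntegral k z t := by
  unfold partIntegral integrandPart
  rw [← setIntegral_pos_comp_mul (fun x => (∏ e, (x e : ℂ) ^ z.1 e) *
    P.powerPart k (-z.2 / 2) (fun i => Complex.exp (v i) * t i) x)
    (c := fun e => Real.exp (∑ i, v i * u i e)) fun e => Real.exp_pos _, ← integral_const_mul]
  refine setIntegral_congr_fun measurableSet_pos fun x hx => ?_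
  simp only
  rw [hP.powerPart_rescale, ← mul_assoc (Complex.exp _)]
  congr 1
  have e1 : ∏ e, ((Real.exp (∑ i, v i * u i e) * x e : ℝ) : ℂ) ^ z.1 e =
      Complex.exp (∑ i, v i * ∑ e, (u i e : ℂ) * z.1 e) * ∏ e, (x e : ℂ) ^ z.1 e := by
    simp only [Complex.ofReal_mul, Complex.ofReal_exp, Complex.exp_mul_cpow,
      Finset.prod_mul_distrib]
    rw [← Complex.exp_sum]
    congr 2
    simp only [Complex.ofReal_sum, Complex.ofReal_mul, Finset.sum_mul, Finset.mul_sum]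
    rw [Finset.sum_comm]
    simp only [mul_assoc]
  rw [e1]
  have e2 : Complex.exp (∑ i, v i * (scalingExponent u w z i + k i)) =
      Complex.exp (∑ i, v i * ∑ e, (u i e : ℂ) * z.1 e) *
        (Complex.exp ((∑ i, v i * w i : ℝ) * (-z.2 / 2)) * Complex.exp (∑ i, v i * k i : ℝ)) := by
    rw [← Complex.exp_add, ← Complex.exp_add]
    congr 1
    push_cast
    rw [Finset.sum_mul, ← Finset.sum_add_distrib, ← Finset.sum_add_distrib]
    refine Finset.sum_congr rfl fun i _ => ?_
    rw [scalingExponent]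
    ring
  rw [e2]
  ring

end MonomialFamily

/-! ### From positive rescalings to all virtualities allowed by Feynman's prescription. -/

lemma neg_exp_mem_feynmanDomain {w : ℂ} (h₁ : -Real.pi < w.im) (h₂ : w.im ≤ 0) :
    -Complex.exp w ∈ feynmanDomain := by
  simp only [feynmanDomain, mem_ofPred_eq, Complex.neg_im, Complex.neg_re, Complex.exp_im,
    Complex.exp_re]
  rcases h₂.lt_or_eq with h | h
  · left
    have := Real.sin_neg_of_neg_of_neg_pi_lt h h₁
    have := Real.exp_pos w.re
    nlinarith
  · right
    simp [h, Real.exp_pos]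

lemma neg_ne_zero_of_mem_feynmanDomain {t : ℂ} (ht : t ∈ feynmanDomain) : -t ≠ 0 := by
  intro h
  rw [neg_eq_zero] at h
  subst h
  simp [feynmanDomain] at ht

lemma log_neg_of_mem_feynmanDomain {t : ℂ} (ht : t ∈ feynmanDomain) :
    Complex.log (-t) = Complex.log t - Real.pi * Complex.I := by
  have harg : Complex.arg (-t) = Complex.arg t - Real.pi := by
    rcases ht with h | ⟨h1, h2⟩
    · exact Complex.arg_neg_eq_arg_sub_pi_of_im_pos h
    · rw [Complex.arg_neg_eq_arg_sub_pi_iff]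
      exact Or.inr ⟨h1, h2⟩
  simp only [Complex.log, norm_neg, harg]
  push_cast
  ring

lemma arg_neg_of_mem_feynmanDomain {t : ℂ} (ht : t ∈ feynmanDomain) :
    -Real.pi < (Complex.log (-t)).im ∧ (Complex.log (-t)).im ≤ 0 := by
  refine ⟨Complex.neg_pi_lt_log_im _, ?_⟩
  rw [Complex.log_im]
  rcases ht with h | ⟨h1, h2⟩
  · exact (Complex.arg_neg_iff.2 (by simpa using h)).le
  · have : Complex.arg (-t) = 0 := Complex.arg_eq_zero_iff.2 (by simp [h1, h2.le])
    exact this.le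

namespace MonomialFamily

variable {ι κ E : Type*} [Fintype ι] [Fintype κ] [Fintype E] {P : MonomialFamily ι κ E}

variable (P) in
/-- The leading coefficients obey Feynman's prescription. -/
def IsPhysical : Prop :=
  ∀ α : P.Lead, ∀ t : κ → ℂ, (∀ i, t i ∈ feynmanDomain) → -P.coefAt α t ∈ feynmanDomain

-- The leading coefficients are positive or in the open lower half-plane. Multiplication by `η + I`
-- with a small `η > 0` moves these finitely many numbers into the open right half-plane, and
-- continuity keeps them there near `t`.
omit [Fintype E] in
lemma IsPhysical.exists_inSector (hP : P.IsPhysical) {t : κ → ℂ} (ht : ∀ i, t i ∈ feynmanDomain) :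
    ∃ ω : ℂ, 0 < ω.re ∧ ∃ c > 0, ∃ C, ∀ᶠ t' in 𝓝 t, P.InSector ω c C t' := by
  classical
  have h1 : ∀ α : P.Lead, ∀ᶠ η : ℝ in 𝓝[>] 0, 0 < (((η : ℂ) + Complex.I) * P.coefAt α t).re := by
    intro α
    have hα := hP α t ht
    simp only [feynmanDomain, mem_ofPred_eq, Complex.neg_im, Complex.neg_re] at hα
    have e : ∀ η : ℝ, (((η : ℂ) + Complex.I) * P.coefAt α t).re =
        η * (P.coefAt α t).re - (P.coefAt α t).im := fun η => by simp
    simp only [e]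
    rcases hα with h | ⟨h, h'⟩
    · have : ContinuousAt (fun η : ℝ => η * (P.coefAt α t).re - (P.coefAt α t).im) 0 := by
        fun_prop
      exact nhdsWithin_le_nhds (this.eventually (lt_mem_nhds (by simpa using h)))
    · filter_upwards [self_mem_nhdsWithin] with η hη
      have : 0 < η := hη
      nlinarith
  obtain ⟨η, hη, hη0⟩ := ((eventually_all.2 h1).and self_mem_nhdsWithin).exists
  have hη0 : 0 < η := hη0
  set ω : ℂ := (η : ℂ) + Complex.I with hω
  have h2 : ∀ α : P.Lead, ∀ᶠ c : ℝ in 𝓝[>] 0, c < (ω * P.coefAt α t).re := fun α =>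
    nhdsWithin_le_nhds (gt_mem_nhds (hη α))
  obtain ⟨c, hc, hc0⟩ := ((eventually_all.2 h2).and self_mem_nhdsWithin).exists
  have hcont : ∀ α, Continuous (P.coefAt α) := fun α => by
    unfold coefAt
    exact continuous_const.mul (continuous_finsetProd _ fun i _ => (continuous_apply i).pow _)
  refine ⟨ω, by simpa [hω] using hη0, c, hc0, ∑ α, ‖P.coefAt α t‖ + 1, ?_⟩
  have h3 : ∀ α : P.Lead, ∀ᶠ t' in 𝓝 t, c < (ω * P.coefAt α t').re := fun α =>
    (Complex.continuous_re.comp (continuous_const.mul (hcont α))).continuousAt.eventually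
      (lt_mem_nhds (hc α))
  have h4 : ∀ α, ∀ᶠ t' in 𝓝 t, ‖P.coefAt α t'‖ < ∑ α, ‖P.coefAt α t‖ + 1 := fun α =>
    (hcont α).norm.continuousAt.eventually (gt_mem_nhds
      ((Finset.single_le_sum (f := fun α => ‖P.coefAt α t‖) (fun _ _ => norm_nonneg _)
        (Finset.mem_univ α)).trans_lt (lt_add_one _)))
  filter_upwards [eventually_all.2 h3, eventually_all.2 h4] with t' ht3 ht4
  exact ⟨fun α => (ht3 α).le, fun α => (ht4 α).le⟩

lemma IsPhysical.integrableOn (hP : P.IsPhysical) {y₀ : E → ℝ} {r : ℝ} (h : P.IsInnerPoint y₀ r)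
    {k : κ → ℕ} {z : (E → ℂ) × ℂ} (hz : z ∈ convergenceDomain y₀ r (∑ i, k i)) {t : κ → ℂ}
    (ht : ∀ i, t i ∈ feynmanDomain) :
    IntegrableOn (P.integrandPart k z t) {x | ∀ e, 0 < x e} := by
  obtain ⟨ω, hω, c, hc, C, hs⟩ := hP.exists_inSector ht
  exact integrableOn_integrandPart h hz hω hc hs.self_of_nhds

lemma IsPhysical.lead_mem_slitPlane (hP : P.IsPhysical) {y₀ : E → ℝ} {r : ℝ}
    (h : P.IsInnerPoint y₀ r) {t : κ → ℂ} (ht : ∀ i, t i ∈ feynmanDomain) {x : E → ℝ}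
    (hx : ∀ e, 0 < x e) : P.lead t x ∈ Complex.slitPlane := by
  obtain ⟨ω, hω, c, hc, C, hs⟩ := hP.exists_inSector ht
  exact hs.self_of_nhds.mem_slitPlane hω hc h hx

/-- The integral depends holomorphically on the `t i`. -/
lemma IsPhysical.differentiableAt_partIntegral (hP : P.IsPhysical) {y₀ : E → ℝ} {r : ℝ}
    (h : P.IsInnerPoint y₀ r) {k : κ → ℕ} {z : (E → ℂ) × ℂ}
    (hz : z ∈ convergenceDomain y₀ r (∑ i, k i)) {τ : ℂ → κ → ℂ} (hτ : Differentiable ℂ τ) {ζ : ℂ}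
    (ht : ∀ i, τ ζ i ∈ feynmanDomain) :
    DifferentiableAt ℂ (fun ζ => P.partIntegral k z (τ ζ)) ζ := by
  classical
  obtain ⟨ω, hω, c, hc, C, hs⟩ := hP.exists_inSector ht
  obtain ⟨R, hR, hball⟩ := Metric.mem_nhds_iff.1 (hτ.continuous.continuousAt.eventually hs)
  obtain ⟨B, hB⟩ := exists_norm_integrandPart_le (C := C) h hz hω hc
  refine differentiableAt_integral_of_norm_le hR ((integrable_bound.const_mul B).integrableOn)
    (fun ζ => (measurable_integrandPart k z (τ ζ)).aestronglyMeasurable)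
    ((ae_restrict_iff' measurableSet_pos).2 (Eventually.of_forall fun x hx ζ' hζ' =>
      hB _ (hball hζ') x hx))
    ((ae_restrict_iff' measurableSet_pos).2 (Eventually.of_forall fun x hx ζ' hζ' => ?_))
  refine DifferentiableAt.differentiableWithinAt ?_
  have hcoord : ∀ i, DifferentiableAt ℂ (fun ζ => τ ζ i) ζ' := fun i =>
    differentiableAt_pi.1 (hτ ζ') i
  have hterm : ∀ α, DifferentiableAt ℂ (fun ζ => P.term α (τ ζ) x) ζ' := fun α => by
    unfold term coefAt
    refine DifferentiableAt.mul_const (DifferentiableAt.const_mul ?_ _) _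
    exact DifferentiableAt.fun_finsetProd fun i _ => (hcoord i).pow _
  have hlead : DifferentiableAt ℂ (fun ζ => P.lead (τ ζ) x) ζ' := by
    unfold lead
    exact DifferentiableAt.fun_sum fun α _ => hterm α
  have hslit : P.lead (τ ζ') x ∈ Complex.slitPlane :=
    InSector.mem_slitPlane (hball hζ') hω hc h hx
  unfold integrandPart powerPart
  refine DifferentiableAt.mul_const (DifferentiableAt.const_mul
    (DifferentiableAt.fun_sum fun j _ => ?_) _) _
  exact ((hlead.cpow_const hslit).const_mul _).mul
    (DifferentiableAt.fun_sum fun f _ => DifferentiableAt.fun_finsetProd fun l _ => hterm _)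

/-- The dependence of the integral on the `t i`, by rotation of the contour of integration. -/
lemma IsPhysical.partIntegral_eq_exp (hP : P.IsPhysical) {u : κ → E → ℝ} {w : κ → ℝ}
    (hu : P.IsHomogeneous u w) {y₀ : E → ℝ} {r : ℝ} (h : P.IsInnerPoint y₀ r) {k : κ → ℕ}
    {z : (E → ℂ) × ℂ} (hz : z ∈ convergenceDomain y₀ r (∑ i, k i)) {t : κ → ℂ}
    (ht : ∀ i, t i ∈ feynmanDomain) :
    P.partIntegral k z t =
      Complex.exp (∑ i, Complex.log (-t i) * (scalingExponent u w z i + k i)) *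
        P.partIntegral k z fun _ => -1 := by
  set p : κ → ℂ := fun i => scalingExponent u w z i + k i with hp
  set a : κ → ℝ := fun i => (Complex.log (-t i)).re with ha
  set b : κ → ℝ := fun i => (Complex.log (-t i)).im with hb
  -- For real `ζ` from `0` to `1`, `τ ζ` keeps the absolute values and turns the phases from `-|t
  -- i|` to `t i` inside the Feynman domain. Shifting `ζ` in the imaginary direction only rescales
  -- the `t i` by positive factors.
  set W : ℂ → κ → ℂ := fun ζ i => a i + ζ * (b i * Complex.I) with hW
  set τ : ℂ → κ → ℂ := fun ζ i => -Complex.exp (W ζ i) with hτ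
  set g : ℂ → ℂ := fun ζ => Complex.exp (-∑ i, W ζ i * p i) * P.partIntegral k z (τ ζ) with hg
  have hτd : Differentiable ℂ τ := by
    refine differentiable_pi.2 fun i => ?_
    simp only [hτ, hW]
    fun_prop
  have hdom : ∀ s : ℝ, s ∈ Icc (0 : ℝ) 1 → ∀ i, τ s i ∈ feynmanDomain := by
    intro s hs i
    obtain ⟨h1, h2⟩ := arg_neg_of_mem_feynmanDomain (ht i)
    have e : (W s i).im = s * b i := by simp [hW]
    refine neg_exp_mem_feynmanDomain ?_ ?_
    · rw [e]
      have h3 : -Real.pi < b i := h1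
      have h4 : b i ≤ 0 := h2
      nlinarith [hs.1, hs.2]
    · rw [e]
      exact mul_nonpos_of_nonneg_of_nonpos hs.1 h2
  -- Homogeneity makes `g` constant in the imaginary direction. Where `g` is holomorphic its complex
  -- derivative then vanishes, so `g` is constant along the real segment too.
  have hinv : ∀ (ζ : ℂ) (η : ℝ), g (ζ + η * Complex.I) = g ζ := by
    intro ζ η
    have e1 : ∀ i, W (ζ + η * Complex.I) i = ((-(η * b i) : ℝ) : ℂ) + W ζ i := fun i => by
      simp only [hW]
      push_cast
      linear_combination (η : ℂ) * b i * Complex.I_sq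
    have e2 : τ (ζ + η * Complex.I) =
        fun i => Complex.exp ((-(η * b i) : ℝ) : ℂ) * τ ζ i := by
      ext i
      simp only [hτ, e1, Complex.exp_add, mul_neg]
    simp only [hg]
    rw [e2, hu.partIntegral_rescale, ← mul_assoc, ← Complex.exp_add]
    congr 2
    simp only [e1]
    rw [neg_add_eq_sub, ← Finset.sum_sub_distrib, ← Finset.sum_neg_distrib]
    refine Finset.sum_congr rfl fun i _ => ?_
    simp only [hp]
    ring
  have hgd : ∀ s : ℝ, s ∈ Icc (0 : ℝ) 1 → HasDerivAt (fun s : ℝ => g s) 0 s := by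
    intro s hs
    have hd : DifferentiableAt ℂ g s := by
      refine DifferentiableAt.mul ?_
        (hP.differentiableAt_partIntegral h hz hτd (hdom s hs))
      simp only [hW]
      fun_prop
    have h1 : HasDerivAt (fun η : ℝ => g (s + η * Complex.I)) (deriv g s * Complex.I) 0 := by
      have h2 : HasDerivAt (fun η : ℝ => (s : ℂ) + η * Complex.I) Complex.I 0 := by
        have := ((Complex.ofRealCLM.hasDerivAt (x := 0)).mul_const Complex.I).const_add (s : ℂ)
        simpa using this
      have h3 : HasDerivAt g (deriv g s) ((s : ℂ) + ((0 : ℝ) : ℂ) * Complex.I) := by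
        simpa using hd.hasDerivAt
      exact HasDerivAt.comp (h₂ := g) 0 h3 h2
    have h4 : HasDerivAt (fun η : ℝ => g (s + η * Complex.I)) 0 0 := by
      simp only [hinv]
      exact hasDerivAt_const _ _
    have h5 : deriv g s = 0 := by
      have := h1.unique h4
      simpa using this
    have := hd.hasDerivAt.comp_ofReal
    rwa [h5] at this
  have hconst : g (1 : ℝ) = g (0 : ℝ) :=
    constant_of_has_deriv_right_zero (f := fun s : ℝ => g s)
      (fun s hs => (hgd s hs).continuousAt.continuousWithinAt)
      (fun s hs => (hgd s ⟨hs.1, hs.2.le⟩).hasDerivWithinAt) 1 ⟨zero_le_one, le_rfl⟩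
  have hW1 : ∀ i, W (1 : ℝ) i = Complex.log (-t i) := fun i => by
    simp only [hW, ha, hb, Complex.ofReal_one, one_mul]
    exact Complex.re_add_im _
  have hτ1 : τ (1 : ℝ) = t := by
    ext i
    simp only [hτ]
    rw [hW1, Complex.exp_log (neg_ne_zero_of_mem_feynmanDomain (ht i)), neg_neg]
  have hg0 : g (0 : ℝ) = P.partIntegral k z fun _ => -1 := by
    have e1 : τ (0 : ℝ) = fun i => Complex.exp (a i) * -1 := by
      ext i
      simp [hτ, hW]
    have e2 : ∀ i, W (0 : ℝ) i = a i := fun i => by simp [hW]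
    simp only [hg]
    rw [e1, hu.partIntegral_rescale, ← mul_assoc, ← Complex.exp_add]
    simp only [e2, hp]
    rw [neg_add_cancel, Complex.exp_zero, one_mul]
  rw [← hg0, ← hconst]
  simp only [hg]
  rw [← mul_assoc, ← Complex.exp_add, hτ1]
  simp only [hW1, hp]
  rw [add_neg_cancel, Complex.exp_zero, one_mul]

/-- The integral is, up to powers of the `t i`, a homogeneous polynomial in them. -/
lemma IsPhysical.exists_coefficients [DecidableEq κ] (hP : P.IsPhysical) {u : κ → E → ℝ}
    {w : κ → ℝ} (hu : P.IsHomogeneous u w) {y₀ : E → ℝ} {r : ℝ} (h : P.IsInnerPoint y₀ r) {n : ℕ}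
    {z : (E → ℂ) × ℂ} (hz : z ∈ convergenceDomain y₀ r n) :
    ∃ c : (κ → ℕ) → ℂ, ∀ t : κ → ℂ, (∀ i, t i ∈ feynmanDomain) →
      IntegrableOn (fun x => ∑ k ∈ Finset.piAntidiag Finset.univ n, P.integrandPart k z t x)
        {x | ∀ e, 0 < x e} ∧
      ∫ x in {x : E → ℝ | ∀ e, 0 < x e},
        ∑ k ∈ Finset.piAntidiag Finset.univ n, P.integrandPart k z t x =
          (∏ i, t i ^ scalingExponent u w z i) *
            ∑ k ∈ Finset.piAntidiag Finset.univ n, (∏ i, (-t i) ^ k i) * c k := by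
  -- The phases convert the powers of `-t i`, in which the formula arises, into principal powers of
  -- `t i`, by `log (-t) = log t - π * I` on the Feynman domain.
  refine ⟨fun k => (∏ i, Complex.exp (-(Real.pi * Complex.I * scalingExponent u w z i))) *
    P.partIntegral k z fun _ => -1, fun t ht => ?_⟩
  have hz' : ∀ k ∈ Finset.piAntidiag (Finset.univ : Finset κ) n,
      z ∈ convergenceDomain y₀ r (∑ i, k i) := fun k hk => by
    rwa [(Finset.mem_piAntidiag.1 hk).1]
  have hint := fun k hk => hP.integrableOn h (hz' k hk) ht
  refine ⟨integrable_finsetSum _ hint, ?_⟩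
  rw [integral_finsetSum _ hint, Finset.mul_sum]
  refine Finset.sum_congr rfl fun k hk => ?_
  have := hP.partIntegral_eq_exp hu h (hz' k hk) ht
  unfold partIntegral at this ⊢
  rw [this, ← mul_assoc, ← mul_assoc, Complex.exp_sum, ← Finset.prod_mul_distrib,
    ← Finset.prod_mul_distrib]
  congr 1
  refine Finset.prod_congr rfl fun i _ => ?_
  have ht0 : t i ≠ 0 := neg_ne_zero.1 (neg_ne_zero_of_mem_feynmanDomain (ht i))
  rw [mul_add, Complex.exp_add, mul_comm _ (k i : ℂ), Complex.exp_nat_mul,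
    Complex.exp_log (neg_ne_zero_of_mem_feynmanDomain (ht i)), log_neg_of_mem_feynmanDomain (ht i),
    Complex.cpow_def_of_ne_zero ht0, sub_mul, sub_eq_add_neg, Complex.exp_add]
  ring

end MonomialFamily

/-! ### Continuation in the propagator exponents and the dimension. -/

/-- Values of meromorphic continuations that are, on an open set, the values of a linear form at
given vectors, are so everywhere. -/
lemma exists_coefficients_of_continuation {S X Y : Type*} [Fintype X] [NormedAddCommGroup Y]
    [NormedSpace ℂ Y] (φ : S → X → ℂ) (v : S → ℂ) (pref I : S → Y → ℂ) (z : Y) {W : Set Y}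
    (hW : IsOpen W) (hne : W.Nonempty) (hpref : ∀ a, AnalyticOnNhd ℂ (pref a) univ)
    (hpref0 : ∀ a y, pref a y ≠ 0)
    (hcont : ∀ a, ∃ A B : Y → ℂ, AnalyticOnNhd ℂ A univ ∧ AnalyticOnNhd ℂ B univ ∧
      (∀ y ∈ W, A y = B y * I a y) ∧ B z ≠ 0 ∧ v a = A z / B z)
    (hlin : ∀ y ∈ W, ∃ c : X → ℂ, ∀ a, I a y = pref a y * ∑ k, φ a k * c k) :
    ∃ c : X → ℂ, ∀ a, v a = pref a z * ∑ k, φ a k * c k := by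
  classical
  choose A B hA hB hAB hBz hv using hcont
  let Φ : (S →₀ ℂ) →ₗ[ℂ] (X → ℂ) := Finsupp.linearCombination ℂ φ
  let Ψ : (S →₀ ℂ) →ₗ[ℂ] ℂ := Finsupp.linearCombination ℂ fun a => v a / pref a z
  -- Coefficients `c` exist at `z` as soon as every finite linear relation among the vectors `φ a`
  -- also holds among the numbers `v a / pref a z`. This formulation needs no regularity of `c` in
  -- `y`.
  have hker : Ψ ∈ (LinearMap.ker Φ).dualAnnihilator := by
    rw [Submodule.mem_dualAnnihilator]
    intro l hl
    rw [LinearMap.mem_ker] at hl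
    have hl' : ∀ k, ∑ a ∈ l.support, l a * φ a k = 0 := fun k => by
      have := congrFun hl k
      simpa [Φ, Finsupp.linearCombination_apply, Finsupp.sum, Finset.sum_apply] using this
    -- The relation with all denominators `B b` cleared: an entire function that vanishes on `W`,
    -- hence everywhere. At `z` the denominators are non-zero and can be cancelled.
    set g : Y → ℂ := fun y => ∑ a ∈ l.support,
      l a * (A a y * (pref a y)⁻¹ * ∏ b ∈ l.support.erase a, B b y) with hg
    have hgan : AnalyticOnNhd ℂ g univ := fun y _ =>
      Finset.analyticAt_fun_sum _ fun a _ => analyticAt_const.mul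
        (((hA a y trivial).mul ((hpref a y trivial).inv (hpref0 a y))).mul
          (Finset.analyticAt_fun_prod _ fun b _ => hB b y trivial))
    have hgW : ∀ y ∈ W, g y = 0 := by
      intro y hy
      obtain ⟨c, hc⟩ := hlin y hy
      have h1 : ∀ a ∈ l.support, l a * (A a y * (pref a y)⁻¹ * ∏ b ∈ l.support.erase a, B b y) =
          (∏ b ∈ l.support, B b y) * ∑ k, (l a * φ a k) * c k := by
        intro a ha
        rw [hAB a y hy, hc a, ← Finset.mul_prod_erase _ _ ha]
        simp only [mul_assoc (l a), ← Finset.mul_sum]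
        field_simp [hpref0 a y]
      rw [hg]
      simp only
      rw [Finset.sum_congr rfl h1, ← Finset.mul_sum, Finset.sum_comm]
      simp only [← Finset.sum_mul, hl', zero_mul, Finset.sum_const_zero, mul_zero]
    obtain ⟨y₀, hy₀⟩ := hne
    have hg0 : g = 0 := hgan.eq_of_eventuallyEq (fun _ _ => analyticAt_const)
      (eventually_of_mem (hW.mem_nhds hy₀) hgW)
    have hz := congrFun hg0 z
    have h2 : g z = (∏ b ∈ l.support, B b z) * Ψ l := by
      simp only [hg, Ψ, Finsupp.linearCombination_apply, Finsupp.sum, smul_eq_mul, Finset.mul_sum]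
      refine Finset.sum_congr rfl fun a ha => ?_
      rw [hv a, ← Finset.mul_prod_erase _ _ ha]
      field_simp [hBz a, hpref0 a z]
    rw [h2] at hz
    exact (mul_eq_zero.1 hz).resolve_left (Finset.prod_ne_zero_iff.2 fun b _ => hBz b)
  rw [← LinearMap.range_dualMap_eq_dualAnnihilator_ker] at hker
  obtain ⟨ℓ, hℓ⟩ := hker
  refine ⟨fun k => ℓ (Pi.single k 1), fun a => ?_⟩
  have h1 := LinearMap.congr_fun hℓ (Finsupp.single a 1)
  simp only [LinearMap.dualMap_apply, Φ, Ψ, Finsupp.linearCombination_single, one_smul] at h1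
  rw [LinearMap.pi_apply_eq_sum_univ] at h1
  have h2 : ∑ k, φ a k * ℓ (Pi.single k 1) = v a / pref a z := by
    rw [← h1]
    refine Finset.sum_congr rfl fun k _ => ?_
    rw [smul_eq_mul]
    congr 2
    ext j
    simp [Pi.single_apply, eq_comm]
  rw [h2, mul_div_cancel₀ _ (hpref0 a z)]

/-! ### Taylor coefficients of a rescaled family of monomials. -/

namespace MonomialFamily

variable {ι κ E : Type*} [Fintype ι] [Fintype κ] [Fintype E] {P : MonomialFamily ι κ E}

omit [Fintype E] in
open Classical in
lemma IsHomogeneous.sum_term_rescale {u : κ → E → ℝ} {w : κ → ℝ} (hP : P.IsHomogeneous u w)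
    {lam : ℝ} (hlam : 0 < lam) (t : κ → ℂ) (x : E → ℝ) :
    ∑ α, P.term α (fun i => lam * t i) (fun e => lam ^ (∑ i, u i e) * x e) =
      Complex.exp ((Real.log lam * ∑ i, w i : ℝ)) *
        (P.lead t x + ∑ b : P.Rest, P.term b t x * (lam : ℂ) ^ (∑ i, P.shift b i)) := by
  have h1 : ∀ α, P.term α (fun i => lam * t i) (fun e => lam ^ (∑ i, u i e) * x e) =
      Complex.exp ((Real.log lam * ∑ i, w i : ℝ)) *
        (P.term α t x * (lam : ℂ) ^ (∑ i, P.shift α i)) := by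
    intro α
    have h2 := hP.term_rescale (fun _ => Real.log lam) α t x
    rw [← Complex.ofReal_exp, Real.exp_log hlam] at h2
    have h3 : ∀ e, Real.exp (∑ i, Real.log lam * u i e) = lam ^ (∑ i, u i e) := fun e => by
      rw [← Finset.mul_sum, Real.rpow_def_of_pos hlam]
    simp only [h3] at h2
    rw [h2, ← Finset.mul_sum, ← Finset.mul_sum]
    have h4 : Complex.exp ((Real.log lam * ∑ i, (P.shift α i : ℝ) : ℝ)) =
        (lam : ℂ) ^ (∑ i, P.shift α i) := by
      rw [← Complex.ofReal_exp, ← Nat.cast_sum, ← Real.rpow_def_of_pos hlam, Real.rpow_natCast,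
        Complex.ofReal_pow]
    rw [h4]
    ring
  rw [Finset.sum_congr rfl fun α _ => h1 α, ← Finset.mul_sum]
  congr 1
  rw [← Fintype.sum_subtype_add_sum_subtype (fun α => P.shift α = 0)]
  congr 1
  unfold lead
  exact Finset.sum_congr rfl fun α _ => by simp [α.2]

omit [Fintype E] in
/-- The Taylor coefficients of the rescaled integrand. -/
lemma limUnder_iteratedDeriv_eq [DecidableEq κ] {t : κ → ℂ} {x : E → ℝ}
    (hL : P.lead t x ∈ Complex.slitPlane) (c s : ℂ) (n : ℕ) {f : ℝ → ℂ}
    (hf : ∀ lam : ℝ, 0 < lam → f lam = c *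
      (P.lead t x + ∑ b : P.Rest, P.term b t x * (lam : ℂ) ^ (∑ i, P.shift b i)) ^ s) :
    limUnder (𝓝[>] (0 : ℝ)) (iteratedDeriv n f) / n.factorial =
      c * ∑ k ∈ Finset.piAntidiag Finset.univ n, P.powerPart k s t x := by
  classical
  have hδ : ∀ b : P.Rest, 1 ≤ ∑ i, P.shift b i := fun b => by
    by_contra hn
    rw [not_le, Nat.lt_one_iff, Finset.sum_eq_zero_iff] at hn
    exact b.2 (funext fun i => hn i (Finset.mem_univ i))
  obtain ⟨han, hd⟩ := iteratedDeriv_cpow_add_sum hL (fun b : P.Rest => P.term b t x) hδ s n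
  set g : ℝ → ℂ := fun lam =>
    (P.lead t x + ∑ b : P.Rest, P.term b t x * (lam : ℂ) ^ (∑ i, P.shift b i)) ^ s with hg
  -- The function `f` is known for positive `lam` only. Its derivatives there agree with those of a
  -- function that is analytic at `0`, so the one-sided limit is the derivative of the latter at
  -- `0`.
  have h1 : ∀ᶠ lam in 𝓝[>] (0 : ℝ), iteratedDeriv n (fun lam => c * g lam) lam =
      iteratedDeriv n f lam := by
    filter_upwards [self_mem_nhdsWithin] with lam hlam
    refine Filter.EventuallyEq.iteratedDeriv_eq n ?_
    filter_upwards [lt_mem_nhds (show (0 : ℝ) < lam from hlam)] with l hl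
    exact (hf l hl).symm
  have h2 : Tendsto (iteratedDeriv n (fun lam => c * g lam)) (𝓝[>] 0)
      (𝓝 (c * iteratedDeriv n g 0)) := by
    have h3 : AnalyticAt ℝ (iteratedDeriv n (fun lam => c * g lam)) 0 := by
      rw [iteratedDeriv_eq_iterate]
      exact (analyticAt_const.mul han).iterated_deriv n
    have := h3.continuousAt.tendsto
    rw [iteratedDeriv_const_mul_field] at this
    exact this.mono_left nhdsWithin_le_nhds
  rw [(h2.congr' h1).limUnder_eq, hd, sum_powerPart]
  have : (n.factorial : ℂ) ≠ 0 := by exact_mod_cast n.factorial_ne_zero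
  field_simp

end MonomialFamily

/-! ### Lower facets, and the Lee-Pomeransky polynomial as a family of monomials. -/

namespace FeynmanGraph

variable {V E : Type*} [Fintype V] [Fintype E] {K M m : ℕ}

/-- The weight as a linear form. -/
noncomputable def weightForm (u : E → ℝ) : ((E → ℝ) × ℝ) →ₗ[ℝ] ℝ :=
  (∑ e, u e • LinearMap.proj e) ∘ₗ LinearMap.fst ℝ (E → ℝ) ℝ + LinearMap.snd ℝ (E → ℝ) ℝ

lemma weightForm_apply (u : E → ℝ) (r : (E → ℝ) × ℝ) : weightForm u r = weight u r := by
  simp [weightForm, weight]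

/-- The points of minimal weight of a convex hull are in the convex hull of the points of minimal
weight. -/
lemma mem_convexHull_of_weight_le {u : E → ℝ} {N : Set ((E → ℝ) × ℝ)} {μ : ℝ}
    (hμ : ∀ r ∈ N, μ ≤ weight u r) {r : (E → ℝ) × ℝ} (hr : r ∈ convexHull ℝ N)
    (hle : weight u r ≤ μ) : r ∈ convexHull ℝ {r ∈ N | weight u r = μ} := by
  set N₀ := {r ∈ N | weight u r = μ}
  have hN₀ : ∀ r ∈ convexHull ℝ N₀, weight u r = μ := fun r hr => by
    have h1 : Convex ℝ {r | weightForm u r = μ} := convex_hyperplane (weightForm u).isLinear μ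
    have h2 := convexHull_min (s := N₀) (fun r hr => by
      simp only [mem_ofPred_eq, weightForm_apply]; exact hr.2) h1 hr
    simpa [weightForm_apply] using h2
  -- This convex set contains `N`, hence its convex hull, and its points of weight at most `μ` are
  -- in the hull of `N₀`.
  have hC : Convex ℝ ({r | μ < weightForm u r} ∪ convexHull ℝ N₀) := by
    have hge : ∀ r ∈ {r | μ < weightForm u r} ∪ convexHull ℝ N₀, μ ≤ weightForm u r := by
      rintro r (hr | hr)
      · exact le_of_lt hr
      · rw [weightForm_apply, hN₀ r hr]
    intro x hx y hy a b ha hb hab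
    rcases hx with hx' | hx'
    · rcases ha.eq_or_lt with rfl | ha
      · rw [zero_add] at hab
        subst hab
        simpa using hy
      · left
        have h1 := hge y hy
        have h2 : μ < weightForm u x := hx'
        have h3 := mul_lt_mul_of_pos_left h2 ha
        have h4 := mul_le_mul_of_nonneg_left h1 hb
        have h5 : a * μ + b * μ = μ := by rw [← add_mul, hab, one_mul]
        simp only [mem_ofPred_eq, map_add, map_smul, smul_eq_mul]
        linarith
    · rcases hy with hy' | hy'
      · rcases hb.eq_or_lt with rfl | hb
        · rw [add_zero] at hab
          subst hab
          simpa using Or.inr hx'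
        · left
          have h1 := hge x (Or.inr hx')
          have h2 : μ < weightForm u y := hy'
          have h3 := mul_lt_mul_of_pos_left h2 hb
          have h4 := mul_le_mul_of_nonneg_left h1 ha
          have h5 : a * μ + b * μ = μ := by rw [← add_mul, hab, one_mul]
          simp only [mem_ofPred_eq, map_add, map_smul, smul_eq_mul]
          linarith
      · exact Or.inr (convex_convexHull ℝ N₀ hx' hy' ha hb hab)
  have hsub : N ⊆ {r | μ < weightForm u r} ∪ convexHull ℝ N₀ := fun r hr => by
    rcases (hμ r hr).lt_or_eq with h | h
    · exact Or.inl (by simpa [weightForm_apply] using h)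
    · exact Or.inr (subset_convexHull ℝ N₀ ⟨hr, h.symm⟩)
  rcases convexHull_min hsub hC hr with h | h
  · have : μ < weight u r := by simpa [weightForm_apply] using h
    exact absurd hle (not_le.2 this)
  · exact h

/-- The projection of a lower facet has interior points. -/
lemma IsLowerFacetNormal.interior_nonempty {G : FeynmanGraph V E K M} {u : E → ℝ}
    (hu : G.IsLowerFacetNormal u) {μ : ℝ} (hμ : ∀ r ∈ G.newtonPoints, μ ≤ weight u r)
    (hμ' : ∃ r ∈ G.newtonPoints, weight u r = μ) :
    (interior (convexHull ℝ (Prod.fst '' {r ∈ G.newtonPoints | weight u r = μ}))).Nonempty := by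
  unfold IsLowerFacetNormal at hu
  set Φ := {r ∈ G.newtonPolytope | ∀ r' ∈ G.newtonPolytope, weight u r ≤ weight u r'} with hΦ
  set N₀ := {r ∈ G.newtonPoints | weight u r = μ} with hN₀
  obtain ⟨r₀, hr₀, hr₀μ⟩ := hμ'
  have hsub : Φ ⊆ convexHull ℝ N₀ := fun r hr =>
    mem_convexHull_of_weight_le hμ hr.1 (hr₀μ ▸ hr.2 r₀ (subset_convexHull ℝ _ hr₀))
  have hker : vectorSpan ℝ Φ ≤ LinearMap.ker (weightForm u) := by
    rw [vectorSpan_def, Submodule.span_le]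
    rintro _ ⟨r, hr, r', hr', rfl⟩
    simp only [SetLike.mem_coe, LinearMap.mem_ker, vsub_eq_sub, map_sub, weightForm_apply]
    exact sub_eq_zero.2 (le_antisymm (hr.2 r' hr'.1) (hr'.2 r hr.1))
  -- The last entry of `(u; 1)` is non-zero, so the facet is not vertical: forgetting the power of
  -- `lam` loses no dimension, and the projection spans the whole space.
  have hinj : Function.Injective ((LinearMap.fst ℝ (E → ℝ) ℝ).domRestrict (vectorSpan ℝ Φ)) := by
    rw [← LinearMap.ker_eq_bot, LinearMap.ker_eq_bot']
    rintro ⟨⟨a, b⟩, hab⟩ h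
    have h1 : a = 0 := h
    have h2 := hker hab
    rw [LinearMap.mem_ker, weightForm_apply, weight, h1] at h2
    simp only [Pi.zero_apply, mul_zero, Finset.sum_const_zero, zero_add] at h2
    exact Subtype.ext (Prod.ext h1 h2)
  have hfin := LinearMap.finrank_range_of_inj hinj
  rw [LinearMap.range_domRestrict, hu] at hfin
  have htop : (vectorSpan ℝ Φ).map (LinearMap.fst ℝ (E → ℝ) ℝ) = ⊤ :=
    Submodule.eq_top_of_finrank_eq (by rw [hfin, Module.finrank_fintype_fun_eq_card])
  have himg : vectorSpan ℝ (Prod.fst '' Φ) = ⊤ := by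
    rw [← htop]
    exact (AffineMap.map_vectorSpan (LinearMap.fst ℝ (E → ℝ) ℝ).toAffineMap).symm
  have hsub' : Prod.fst '' Φ ⊆ convexHull ℝ (Prod.fst '' N₀) := by
    have := (LinearMap.fst ℝ (E → ℝ) ℝ).image_convexHull N₀
    rw [LinearMap.coe_fst] at this
    rw [← this]
    exact image_mono hsub
  rw [(convex_convexHull ℝ _).interior_nonempty_iff_affineSpan_eq_top,
    AffineSubspace.affineSpan_eq_top_iff_vectorSpan_eq_top_of_nonempty]
  · exact top_le_iff.1 (himg ▸ vectorSpan_mono ℝ hsub')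
  · exact ⟨r₀.1, subset_convexHull ℝ _ ⟨r₀, ⟨hr₀, hr₀μ⟩, rfl⟩⟩

/-! ### The monomials of the Lee-Pomeransky polynomial -/

section Family

variable (G : FeynmanGraph V E K M) (kin : Kinematics K M m) (part : E → Mode K)

/-- The momentum through the channel `A` is `± p_i`. -/
def OnShellIn (A : Finset (Fin K ⊕ Fin M)) (i : Fin K) : Prop :=
  A = {Sum.inl i} ∨ Aᶜ = {Sum.inl i}

/-- The spanning trees, the spanning 2-trees with a hard channel, and the pairs of a virtuality and
a spanning 2-tree whose monomial can depend on it. -/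
abbrev MonomialIndex : Type _ :=
  {T // T ∈ G.forests 1} ⊕ {F // F ∈ G.forests 2 ∧ IsHardChannel (G.channel F)} ⊕
    {q : Fin K × Finset E // q.2 ∈ G.forests 2 ∧
      (IsHardChannel (G.channel q.2) ∨ OnShellIn (G.channel q.2) q.1)}

noncomputable instance : Fintype G.MonomialIndex := by
  classical exact inferInstance

open Classical in
/-- The set of propagators of the forest of a monomial. -/
def forestOf : G.MonomialIndex → Finset E
  | .inl T => T.1
  | .inr (.inl F) => F.1
  | .inr (.inr q) => q.1.2

/-- The exponents of the virtualities in a monomial. -/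
def virtualityDegree : G.MonomialIndex → Fin K → ℕ
  | .inl _ => 0
  | .inr (.inl _) => 0
  | .inr (.inr q) => Pi.single q.1.1 1

open Classical in
/-- The monomials of the Lee-Pomeransky polynomial, with their excess in a region. -/
noncomputable def monomials (σ : Fin m → ℂ) : MonomialFamily G.MonomialIndex (Fin K) E where
  coef
    | .inl _ => 1
    | .inr (.inl F) => -kin.inv (G.channel F.1) (0, σ)
    | .inr (.inr q) => -kin.inv (G.channel q.1.2) (Pi.single q.1.1 1, 0)
  tdeg := G.virtualityDegree
  edges α := Finset.univ.filter (· ∉ G.forestOf α)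
  -- In a scattering picture this natural subtraction is not truncated, by `jetRank_le`.
  shift α i := (G.forestOf α ∩ G.jetEdges part i).card + G.virtualityDegree α i - G.jetRank part i

open Classical in
/-- The power of the scale of the `i`-th jet with which a propagator scales. -/
noncomputable def jetScaling (i : Fin K) (e : E) : ℝ := if e ∈ G.jetEdges part i then -1 else 0

/-- The leading power of the scale of the `i`-th jet. -/
noncomputable def jetWeight (i : Fin K) : ℝ := G.jetRank part i - (G.jetEdges part i).card

variable {G kin part}

lemma jetRank_le (h : G.IsScatteringPicture part) (kin : Kinematics K M m) [DecidableEq E]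
    (α : G.MonomialIndex) (i : Fin K) :
    G.jetRank part i ≤ (G.forestOf α ∩ G.jetEdges part i).card + G.virtualityDegree α i := by
  rcases α with ⟨T, hT⟩ | ⟨F, hF, hc⟩ | ⟨⟨j, F⟩, hF, hc | hc⟩
  · have := jetRank_add_one_le (part := part) hT i
    simp only [forestOf, virtualityDegree, Pi.zero_apply]
    omega
  · exact (h.jetRank_le_of_isHardChannel hF hc i).trans (Nat.le_add_right _ _)
  · exact (h.jetRank_le_of_isHardChannel hF hc i).trans (Nat.le_add_right _ _)
  · have := h.jetRank_le_of_isOnShellChannel kin hF hc i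
    simpa [forestOf, virtualityDegree, Pi.single_apply, eq_comm] using this

omit [Fintype V] in
lemma sum_jetScaling [DecidableEq E] (F : Finset E) (i : Fin K) :
    ∑ e ∈ Finset.univ.filter (· ∉ F), G.jetScaling part i e =
      (F ∩ G.jetEdges part i).card - (G.jetEdges part i).card := by
  classical
  have h0 : ∀ e, G.jetScaling part i e = -if e ∈ G.jetEdges part i then (1 : ℝ) else 0 :=
    fun e => by unfold jetScaling; split_ifs <;> simp
  simp only [h0]
  rw [Finset.sum_neg_distrib, Finset.sum_boole, Finset.filter_filter]
  have h1 : (Finset.univ.filter fun e => e ∉ F ∧ e ∈ G.jetEdges part i) = G.jetEdges part i \ F := by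
    ext e; simp [and_comm]
  have h2 := Finset.card_sdiff_add_card_inter (G.jetEdges part i) F
  have h3 : ((G.jetEdges part i \ F).card : ℝ) + (G.jetEdges part i ∩ F).card =
      (G.jetEdges part i).card := by exact_mod_cast h2
  rw [h1, Finset.inter_comm F]
  linarith

lemma isHomogeneous_monomials (h : G.IsScatteringPicture part) (σ : Fin m → ℂ) :
    (G.monomials kin part σ).IsHomogeneous (G.jetScaling part) (G.jetWeight part) := by
  classical
  intro α i
  have h1 := jetRank_le (G := G) h kin α i
  have h2 := sum_jetScaling (G := G) (part := part) (G.forestOf α) i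
  simp only [monomials, jetWeight]
  rw [Nat.cast_sub (by convert h1), ← add_sub_assoc]
  push_cast
  have h3 : ∑ e ∈ Finset.univ.filter (· ∉ G.forestOf α), G.jetScaling part i e =
      (G.forestOf α ∩ G.jetEdges part i).card - (G.jetEdges part i).card := by
    convert h2
  rw [h3]
  ring

omit [Fintype V] [Fintype E] in
lemma _root_.Kinematics.inv_of_onShellIn {A : Finset (Fin K ⊕ Fin M)} {i : Fin K}
    (h : OnShellIn A i) (t : Fin K → ℂ) (σ : Fin m → ℂ) : kin.inv A (t, σ) = t i := by
  rcases h with rfl | h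
  · exact kin.inv_onShell i t σ
  · rw [← kin.inv_compl, h, kin.inv_onShell]

/-- The terms linear in a virtuality that come from a hard channel have coefficients of unknown
sign, but they are never leading: the 2-tree alone already has weight `jetRank`, and the factor `t
j` adds one. Only trees, hard invariants at `t = 0` and the `t j` themselves remain. -/
lemma isPhysical_monomials {σ : Fin m → ℂ}
    (hσ : ∀ F ∈ G.forests 2, IsHardChannel (G.channel F) →
      kin.inv (G.channel F) (0, σ) ∈ feynmanDomain)
    (h : G.IsScatteringPicture part) : (G.monomials kin part σ).IsPhysical := by
  classical
  rintro ⟨⟨T, hT⟩ | ⟨F, hF, hc⟩ | ⟨⟨j, F⟩, hF, hc⟩, hα⟩ t ht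
  · simp [MonomialFamily.coefAt, monomials, virtualityDegree, feynmanDomain]
  · simpa [MonomialFamily.coefAt, monomials, virtualityDegree] using hσ F hF hc
  · have hon : OnShellIn (G.channel F) j := by
      refine hc.resolve_left fun hhard => ?_
      have h1 := h.jetRank_le_of_isHardChannel hF hhard j
      have h2 := congrFun hα j
      simp only [monomials, forestOf, virtualityDegree, Pi.single_eq_same, Pi.zero_apply] at h2
      have h3 : G.jetRank part j ≤ (F ∩ G.jetEdges part j).card := by convert h1
      omega
    have h4 : ∏ i, t i ^ (Pi.single j 1 : Fin K → ℕ) i = t j := by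
      rw [Finset.prod_eq_single j (fun i _ hij => by simp [hij]) (by simp)]
      simp
    simpa [MonomialFamily.coefAt, monomials, virtualityDegree, h4, Kinematics.inv_of_onShellIn hon]
      using ht j

/-- The Lee-Pomeransky polynomial is the sum of its monomials. -/
lemma lpPoly_eq_sum_term (x : E → ℝ) (t : Fin K → ℂ) (σ : Fin m → ℂ) :
    G.lpPoly kin x t σ = ∑ α, (G.monomials kin part σ).term α t x := by
  classical
  rw [Fintype.sum_sum_type, Fintype.sum_sum_type, lpPoly]
  congr 1
  · rw [← Finset.sum_coe_sort]
    refine Finset.sum_congr rfl fun T _ => ?_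
    simp [MonomialFamily.term, MonomialFamily.coefAt, monomials, virtualityDegree, forestOf]
    congr!
  -- Each invariant is expanded by linearity into its value at `t = 0` and its terms in the `t i`.
  -- Trivial channels contribute nothing, and an on-shell channel contributes only its own
  -- virtuality.
  have h1 : ∀ F ∈ G.forests 2, -kin.inv (G.channel F) (t, σ) =
      (if IsHardChannel (G.channel F) then -kin.inv (G.channel F) (0, σ) else 0) +
        ∑ i, if IsHardChannel (G.channel F) ∨ OnShellIn (G.channel F) i then
          -kin.inv (G.channel F) (Pi.single i 1, 0) * t i else 0 := by
    intro F _
    set A := G.channel F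
    have hdec : kin.inv A (t, σ) = kin.inv A (0, σ) + ∑ i, kin.inv A (Pi.single i 1, 0) * t i := by
      have e : (t, σ) = (0, σ) + ∑ i, t i • ((Pi.single i 1 : Fin K → ℂ), (0 : Fin m → ℂ)) := by
        refine Prod.ext ?_ ?_
        · ext j
          simp [Prod.fst_sum, Finset.sum_apply, Pi.single_apply]
        · simp [Prod.snd_sum]
      rw [e, map_add, map_sum]
      congr 1
      refine Finset.sum_congr rfl fun i _ => ?_
      rw [map_smul, smul_eq_mul, mul_comm]
    have hcases : ¬ IsHardChannel A → kin.inv A = 0 ∨ ∃ j, OnShellIn A j := by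
      intro hn
      by_contra hcon
      rw [not_or] at hcon
      refine hn ⟨fun h => hcon.1 ?_, fun h => hcon.1 ?_, fun ⟨j, hj⟩ => hcon.2 ⟨j, hj⟩⟩
      · rw [h, kin.inv_empty]
      · rw [← kin.inv_compl, h, kin.inv_empty]
    rw [hdec, neg_add, ← Finset.sum_neg_distrib]
    congr 1
    · split_ifs with hh
      · rfl
      · rcases hcases hh with h0 | ⟨j, hj⟩
        · simp [h0]
        · simp [Kinematics.inv_of_onShellIn hj]
    · refine Finset.sum_congr rfl fun i _ => ?_
      split_ifs with hh
      · ring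
      · rw [not_or] at hh
        rcases hcases hh.1 with h0 | ⟨j, hj⟩
        · simp [h0]
        · have hij : i ≠ j := fun hij => hh.2 (hij ▸ hj)
          simp [Kinematics.inv_of_onShellIn hj, hij.symm]
  have h2 : ∀ F ∈ G.forests 2, -(kin.inv (G.channel F) (t, σ) *
      ∏ e ∈ Finset.univ.filter (· ∉ F), (x e : ℂ)) =
      (if IsHardChannel (G.channel F) then -kin.inv (G.channel F) (0, σ) *
        ∏ e ∈ Finset.univ.filter (· ∉ F), (x e : ℂ) else 0) +
      ∑ i, if IsHardChannel (G.channel F) ∨ OnShellIn (G.channel F) i then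
          -kin.inv (G.channel F) (Pi.single i 1, 0) * t i *
            ∏ e ∈ Finset.univ.filter (· ∉ F), (x e : ℂ) else 0 := by
    intro F hF
    rw [← neg_mul, h1 F hF, add_mul, Finset.sum_mul]
    simp only [ite_mul, zero_mul]
  rw [← Finset.sum_neg_distrib, Finset.sum_congr rfl h2, Finset.sum_add_distrib]
  congr 1
  · rw [← Finset.sum_filter, Finset.sum_subtype (p := fun F => F ∈ G.forests 2 ∧
      IsHardChannel (G.channel F)) _ (by simp)]
    refine Finset.sum_congr rfl fun F _ => ?_
    simp [MonomialFamily.term, MonomialFamily.coefAt, monomials, virtualityDegree, forestOf]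
    left
    congr!
  · rw [Finset.sum_comm, ← Finset.sum_product', ← Finset.sum_filter, Finset.sum_subtype
      (p := fun q : Fin K × Finset E => q.2 ∈ G.forests 2 ∧
        (IsHardChannel (G.channel q.2) ∨ OnShellIn (G.channel q.2) q.1)) _ (by simp)]
    refine Finset.sum_congr rfl fun q _ => ?_
    have h4 : ∏ i, t i ^ (Pi.single q.1.1 1 : Fin K → ℕ) i = t q.1.1 := by
      rw [Finset.prod_eq_single q.1.1 (fun i _ hij => by simp [hij]) (by simp)]
      simp
    simp [MonomialFamily.term, MonomialFamily.coefAt, monomials, virtualityDegree, forestOf, h4]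
    left
    congr!

omit [Fintype V] in
lemma sum_jetScaling_eq (hsoft : G.IsJetPairingSoft part) (e : E) :
    ∑ i, G.jetScaling part i e = regionVector part e := by
  classical
  rw [regionVector, scaling_eq_neg_card hsoft, ← Finset.sum_neg_distrib]
  refine Finset.sum_congr rfl fun i _ => ?_
  unfold jetScaling
  split_ifs <;> simp

/-- The point of the Newton polytope of a monomial. -/
noncomputable def pointOf (G : FeynmanGraph V E K M) (α : G.MonomialIndex) : (E → ℝ) × ℝ :=
  (G.exponent (G.forestOf α), ∑ i, G.virtualityDegree α i)

/-- The weight of the region is the sum of the weights of the jets. As excesses are non-negative,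
minimal weight means that each of them vanishes, which ties the facet to the leading monomials. -/
lemma weight_pointOf (hsoft : G.IsJetPairingSoft part) (h : G.IsScatteringPicture part)
    (σ : Fin m → ℂ) (α : G.MonomialIndex) :
    weight (regionVector part) (G.pointOf α) =
      ∑ i, G.jetWeight part i + ∑ i, ((G.monomials kin part σ).shift α i : ℝ) := by
  classical
  rw [← Finset.sum_add_distrib, Finset.sum_congr rfl fun i _ =>
    (isHomogeneous_monomials (kin := kin) h σ α i).symm, Finset.sum_add_distrib, Finset.sum_comm]
  simp only [sum_jetScaling_eq hsoft, weight, pointOf, exponent, monomials]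
  congr 1
  rw [Finset.sum_filter]
  refine Finset.sum_congr rfl fun e _ => ?_
  split_ifs <;> simp

lemma exists_pointOf_eq {G : FeynmanGraph V E K M} {r : (E → ℝ) × ℝ} (hr : r ∈ G.newtonPoints) : ∃ α, r = G.pointOf α := by
  rcases hr with (⟨T, hT, rfl⟩ | ⟨F, hF, hc, rfl⟩) | ⟨F, hF, ⟨i, hi⟩, rfl⟩
  · exact ⟨.inl ⟨T, hT⟩, by simp [pointOf, forestOf, virtualityDegree]⟩
  · exact ⟨.inr (.inl ⟨F, hF, hc⟩), by simp [pointOf, forestOf, virtualityDegree]⟩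
  · exact ⟨.inr (.inr ⟨(i, F), hF, Or.inr hi⟩), by
      simp only [pointOf, forestOf, virtualityDegree]
      have h1 : ∑ j, (Pi.single i 1 : Fin K → ℕ) j = 1 := by simp
      rw [← Nat.cast_sum, h1, Nat.cast_one]⟩

lemma exists_lead (h : G.IsScatteringPicture part) (σ : Fin m → ℂ) :
    ∃ α, G.pointOf α ∈ G.newtonPoints ∧ (G.monomials kin part σ).shift α = 0 := by
  classical
  obtain ⟨T, hT, hc⟩ := h.exists_tree_card_eq
  refine ⟨.inl ⟨T, hT⟩, Or.inl (Or.inl ⟨T, hT, by simp [pointOf, forestOf, virtualityDegree]⟩), ?_⟩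
  ext i
  simp only [monomials, forestOf, virtualityDegree, Pi.zero_apply, add_zero]
  have : (T ∩ G.jetEdges part i).card = G.jetRank part i := by convert hc i
  omega

lemma le_weight (hsoft : G.IsJetPairingSoft part) (h : G.IsScatteringPicture part)
    (kin : Kinematics K M m) {r : (E → ℝ) × ℝ} (hr : r ∈ G.newtonPoints) :
    ∑ i, G.jetWeight part i ≤ weight (regionVector part) r := by
  obtain ⟨α, rfl⟩ := exists_pointOf_eq hr
  rw [weight_pointOf (kin := kin) hsoft h 0]
  exact le_add_of_nonneg_right (Finset.sum_nonneg fun i _ => Nat.cast_nonneg _)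

lemma minWeight_eq (hsoft : G.IsJetPairingSoft part) (h : G.IsScatteringPicture part)
    (kin : Kinematics K M m) :
    G.minWeight (regionVector part) = ∑ i, G.jetWeight part i := by
  obtain ⟨α, hα, h0⟩ := exists_lead (kin := kin) h 0
  refine IsLeast.csInf_eq ⟨⟨_, hα, ?_⟩, ?_⟩
  · rw [weight_pointOf (kin := kin) hsoft h 0, h0]
    simp
  · rintro _ ⟨r, hr, rfl⟩
    exact le_weight hsoft h kin hr

/-- The Newton polytope of the leading monomials of a region has an interior point. -/
lemma IsRegion.exists_isInnerPoint (hR : G.IsRegion part) (hsoft : G.IsJetPairingSoft part)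
    (kin : Kinematics K M m) :
    ∃ y₀ r, ∀ σ, (G.monomials kin part σ).IsInnerPoint y₀ r := by
  classical
  obtain ⟨h, hfacet⟩ := hR
  obtain ⟨α, hα, h0⟩ := exists_lead (kin := kin) h 0
  obtain ⟨y₀, hy₀⟩ := hfacet.interior_nonempty (fun r hr => le_weight hsoft h kin hr)
    ⟨_, hα, by rw [weight_pointOf (kin := kin) hsoft h 0, h0]; simp⟩
  rw [mem_interior_iff_mem_nhds, Metric.nhds_basis_closedBall.mem_iff] at hy₀
  obtain ⟨r, hr, hball⟩ := hy₀
  refine ⟨y₀, r, fun σ => ⟨hr, fun y hy => ?_⟩⟩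
  have hmem : y ∈ Metric.closedBall y₀ r := by
    rw [Metric.mem_closedBall, dist_pi_le_iff hr.le]
    exact fun e => by rw [Real.dist_eq]; exact hy e
  refine convexHull_mono ?_ (hball hmem)
  rintro _ ⟨r', ⟨hr', hw⟩, rfl⟩
  obtain ⟨β, rfl⟩ := exists_pointOf_eq hr'
  rw [weight_pointOf (kin := kin) hsoft h σ, add_eq_left,
    Finset.sum_eq_zero_iff_of_nonneg fun i _ => Nat.cast_nonneg _] at hw
  refine ⟨β, funext fun i => by exact_mod_cast hw i (Finset.mem_univ i), ?_⟩
  ext e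
  simp only [pointOf, exponent, MonomialFamily.indicatorVec, monomials, Finset.mem_filter,
    Finset.mem_univ, true_and]
  split_ifs <;> simp_all

end Family

end FeynmanGraph

/-! ### The terms of the expansion in a region. -/

namespace FeynmanGraph

variable {V E : Type*} [Fintype V] [Fintype E] {K M m : ℕ} {G : FeynmanGraph V E K M}
  {kin : Kinematics K M m} {part : E → Mode K}

/-- The rescaled integrand in terms of the monomials of the Lee-Pomeransky polynomial. -/
lemma rescaledIntegrand_eq (h : G.IsScatteringPicture part) (hsoft : G.IsJetPairingSoft part)
    (ν : E → ℂ) (D : ℂ) (x : E → ℝ) (t : Fin K → ℂ) (σ : Fin m → ℂ) {lam : ℝ} (hlam : 0 < lam) :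
    G.rescaledIntegrand kin (regionVector part) ν D x t σ lam = (∏ e, (x e : ℂ) ^ ν e) *
      ((G.monomials kin part σ).lead t x + ∑ b : (G.monomials kin part σ).Rest,
        (G.monomials kin part σ).term b t x *
          (lam : ℂ) ^ (∑ i, (G.monomials kin part σ).shift b i)) ^ (-D / 2) := by
  classical
  have hu : ∀ e, regionVector part e = ∑ i, G.jetScaling part i e := fun e =>
    (sum_jetScaling_eq hsoft e).symm
  have hlam0 : (lam : ℂ) ≠ 0 := by exact_mod_cast hlam.ne'
  have h1 : ∏ e, (((lam ^ regionVector part e * x e : ℝ) : ℂ)) ^ ν e =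
      Complex.exp (Real.log lam * ∑ e, (regionVector part e : ℂ) * ν e) *
        ∏ e, (x e : ℂ) ^ ν e := by
    rw [Finset.mul_sum, Complex.exp_sum, ← Finset.prod_mul_distrib]
    refine Finset.prod_congr rfl fun e _ => ?_
    rw [Real.rpow_def_of_pos hlam, Complex.ofReal_mul, Complex.ofReal_exp, Complex.exp_mul_cpow]
    push_cast
    ring_nf
  have h2 := (isHomogeneous_monomials (kin := kin) h σ).sum_term_rescale hlam t x
  rw [rescaledIntegrand, lpIntegrand, lpPoly_eq_sum_term, leadingPower, minWeight_eq hsoft h kin,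
    h1]
  simp only [hu] at h2 ⊢
  rw [h2, Complex.exp_mul_cpow, Complex.cpow_def_of_ne_zero hlam0, ← Complex.ofReal_log hlam.le]
  set Q := (G.monomials kin part σ).lead t x + ∑ b : (G.monomials kin part σ).Rest,
        (G.monomials kin part σ).term b t x *
          (lam : ℂ) ^ (∑ i, (G.monomials kin part σ).shift b i) with hQ
  calc _ = Complex.exp ((Real.log lam : ℂ) *
          -(∑ e, ((∑ i, G.jetScaling part i e : ℝ) : ℂ) * ν e -
            ((∑ i, G.jetWeight part i : ℝ) : ℂ) * D / 2) +
        ((Real.log lam : ℂ) * ∑ e, ((∑ i, G.jetScaling part i e : ℝ) : ℂ) * ν e +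
          ((Real.log lam * ∑ i, G.jetWeight part i : ℝ) : ℂ) * (-D / 2))) *
        ((∏ e, (x e : ℂ) ^ ν e) * Q ^ (-D / 2)) := by
        rw [Complex.exp_add, Complex.exp_add]
        ring
    _ = _ := by
        have : (Real.log lam : ℂ) * -(∑ e, ((∑ i, G.jetScaling part i e : ℝ) : ℂ) * ν e -
            ((∑ i, G.jetWeight part i : ℝ) : ℂ) * D / 2) +
          ((Real.log lam : ℂ) * ∑ e, ((∑ i, G.jetScaling part i e : ℝ) : ℂ) * ν e +
          ((Real.log lam * ∑ i, G.jetWeight part i : ℝ) : ℂ) * (-D / 2)) = 0 := by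
          rw [Complex.ofReal_mul]
          ring
        rw [this, Complex.exp_zero, one_mul]

/-- After division by the leading power, the integrand is a power of the leading sum plus positive
integral powers of `lam`. The leading sum is off the branch cut, so the binomial expansion applies.
-/
lemma taylorIntegrand_mul_eq (h : G.IsScatteringPicture part) (hsoft : G.IsJetPairingSoft part)
    {t : Fin K → ℂ} {σ : Fin m → ℂ} (hw : G.WideAngle kin t σ) {y₀ : E → ℝ} {r : ℝ}
    (hy : (G.monomials kin part σ).IsInnerPoint y₀ r) (n : ℕ) (z : (E → ℂ) × ℂ) {x : E → ℝ}
    (hx : ∀ e, 0 < x e) :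
    G.taylorIntegrand kin (regionVector part) n t σ z.1 z.2 x * ∏ e, ((x e)⁻¹ : ℂ) =
      ∑ k ∈ Finset.piAntidiag Finset.univ n,
        (G.monomials kin part σ).integrandPart k z t x := by
  have hP := isPhysical_monomials hw.hard h
  rw [taylorIntegrand, MonomialFamily.limUnder_iteratedDeriv_eq
    (hP.lead_mem_slitPlane hy hw.onShell hx) _ _ n
    fun lam hlam => rescaledIntegrand_eq h hsoft z.1 z.2 x t σ hlam]
  simp only [MonomialFamily.integrandPart, Finset.mul_sum, Finset.sum_mul]

lemma analyticAt_prod_cpow_scalingExponent {t : Fin K → ℂ} (ht : ∀ i, t i ≠ 0)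
    (u : Fin K → E → ℝ) (w : Fin K → ℝ) (z : (E → ℂ) × ℂ) :
    AnalyticAt ℂ (fun z => ∏ i, t i ^ MonomialFamily.scalingExponent u w z i) z := by
  have hs : ∀ i, AnalyticAt ℂ (fun z : (E → ℂ) × ℂ => MonomialFamily.scalingExponent u w z i) z := by
    intro i
    unfold MonomialFamily.scalingExponent
    refine AnalyticAt.sub (Finset.analyticAt_fun_sum _ fun e _ => analyticAt_const.mul ?_) ?_
    · exact ((ContinuousLinearMap.proj (R := ℂ) (φ := fun _ : E => ℂ) e).comp
        (ContinuousLinearMap.fst ℂ (E → ℂ) ℂ)).analyticAt z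
    · simp only [div_eq_mul_inv]
      exact (analyticAt_const.mul analyticAt_snd).mul analyticAt_const
  refine Finset.analyticAt_fun_prod _ fun i _ => ?_
  simp only [Complex.cpow_def_of_ne_zero (ht i)]
  exact (analyticAt_const.mul (hs i)).cexp

/-- A regularised integral is determined by the values of the integral on any open subset of the
domain of convergence. -/
lemma _root_.IsRegularisedIntegral.exists_continuation {c : (E → ℂ) × ℂ → ℂ}
    {f : (E → ℂ) × ℂ → (E → ℝ) → ℂ} {z : (E → ℂ) × ℂ} {v : ℂ}
    (hv : IsRegularisedIntegral c f z v) {W : Set ((E → ℂ) × ℂ)} (hW : IsOpen W)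
    (hint : ∀ y ∈ W, IntegrableOn (fun x => f y x * ∏ e, ((x e)⁻¹ : ℂ)) {x | ∀ e, 0 < x e}) :
    ∃ A B : (E → ℂ) × ℂ → ℂ, AnalyticOnNhd ℂ A univ ∧ AnalyticOnNhd ℂ B univ ∧
      (∀ y ∈ W, A y = B y * (c y * ∫ x in {x : E → ℝ | ∀ e, 0 < x e},
        f y x * ∏ e, ((x e)⁻¹ : ℂ))) ∧ B z ≠ 0 ∧ v = A z / B z := by
  obtain ⟨-, A, B, hA, hB, hAB, hBz, hvz⟩ := hv
  exact ⟨A, B, hA, hB, fun y hy => hAB y (interior_maximal hint hW hy), hBz, hvz⟩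

/-- The dependence of a term of the expansion on the virtualities. -/
lemma IsRegion.exists_term_eq (hR : G.IsRegion part) (hsoft : G.IsJetPairingSoft part)
    (kin : Kinematics K M m) (z : (E → ℂ) × ℂ) (σ : Fin m → ℂ) (n : ℕ) :
    ∃ c : (Fin K → ℕ) → ℂ, ∀ t v, G.WideAngle kin t σ →
      G.IsRegionTerm kin part n t σ z.1 z.2 v →
      v = (∏ i, t i ^ MonomialFamily.scalingExponent (G.jetScaling part) (G.jetWeight part) z i) *
        ∑ k ∈ Finset.piAntidiag Finset.univ n, (∏ i, (-t i) ^ k i) * c k := by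
  classical
  -- The index set consists of all points `t` together with the values of the term there, at fixed
  -- `σ`, so that a single `c` serves every `t`.
  let S := {q : (Fin K → ℂ) × ℂ // G.WideAngle kin q.1 σ ∧
    G.IsRegionTerm kin part n q.1 σ z.1 z.2 q.2}
  rcases isEmpty_or_nonempty S with hS | ⟨⟨q₀, hw₀, -⟩⟩
  · exact ⟨0, fun t v hw hv => (hS.false ⟨(t, v), hw, hv⟩).elim⟩
  obtain ⟨y₀, r, hy⟩ := hR.exists_isInnerPoint hsoft kin
  have hP := isPhysical_monomials hw₀.hard hR.1
  have hu := isHomogeneous_monomials (kin := kin) hR.1 σ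
  set p := MonomialFamily.scalingExponent (G.jetScaling part) (G.jetWeight part) with hp
  have ht0 : ∀ q : S, ∀ i, q.1.1 i ≠ 0 := fun q i =>
    neg_ne_zero.1 (neg_ne_zero_of_mem_feynmanDomain (q.2.1.onShell i))
  have hcongr : ∀ q : S, ∀ y : (E → ℂ) × ℂ, EqOn
      (fun x => ∑ k ∈ Finset.piAntidiag Finset.univ n,
        (G.monomials kin part σ).integrandPart k y q.1.1 x)
      (fun x => G.taylorIntegrand kin (regionVector part) n q.1.1 σ y.1 y.2 x *
        ∏ e, ((x e)⁻¹ : ℂ)) {x | ∀ e, 0 < x e} := fun q y x hx =>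
    (taylorIntegrand_mul_eq hR.1 hsoft q.2.1 (hy σ) n y hx).symm
  obtain ⟨c, hc⟩ := exists_coefficients_of_continuation
    (fun (q : S) (k : ↥(Finset.piAntidiag (Finset.univ : Finset (Fin K)) n)) =>
      ∏ i, (-q.1.1 i) ^ k.1 i)
    (fun q => q.1.2) (fun q y => ∏ i, q.1.1 i ^ p y i)
    (fun q y => G.lpConst y.1 y.2 * ∫ x in {x : E → ℝ | ∀ e, 0 < x e},
      G.taylorIntegrand kin (regionVector part) n q.1.1 σ y.1 y.2 x * ∏ e, ((x e)⁻¹ : ℂ)) z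
    (MonomialFamily.isOpen_convergenceDomain y₀ r n)
    (MonomialFamily.convergenceDomain_nonempty y₀ (hy σ).1 n)
    (fun q y _ => analyticAt_prod_cpow_scalingExponent (ht0 q) _ _ y)
    (fun q y => Finset.prod_ne_zero_iff.2 fun i _ => by
      rw [Complex.cpow_def_of_ne_zero (ht0 q i)]
      exact Complex.exp_ne_zero _)
    (fun q => q.2.2.exists_continuation (MonomialFamily.isOpen_convergenceDomain y₀ r n)
      fun y hyW => by
        obtain ⟨_, hc⟩ := hP.exists_coefficients hu (hy σ) hyW
        exact (hc q.1.1 q.2.1.onShell).1.congr_fun (hcongr q y)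
          MonomialFamily.measurableSet_pos)
    (fun y hyW => by
      obtain ⟨c, hc⟩ := hP.exists_coefficients hu (hy σ) hyW
      refine ⟨fun k => G.lpConst y.1 y.2 * c k, fun q => ?_⟩
      rw [← setIntegral_congr_fun MonomialFamily.measurableSet_pos (hcongr q y),
        (hc q.1.1 q.2.1.onShell).2, mul_left_comm, ← Finset.sum_coe_sort, Finset.mul_sum]
      congr 1
      exact Finset.sum_congr rfl fun k _ => mul_left_comm _ _ _)
  refine ⟨fun k => if hk : k ∈ Finset.piAntidiag Finset.univ n then c ⟨k, hk⟩ else 0,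
    fun t v hw hv => ?_⟩
  refine (hc ⟨(t, v), hw, hv⟩).trans ?_
  rw [← Finset.sum_coe_sort (Finset.piAntidiag _ n)]
  congr 1
  exact Finset.sum_congr rfl fun k _ => by simp only [k.2, dif_pos]

end FeynmanGraph

lemma HasSum.piAntidiag {κ R : Type*} [Fintype κ] [DecidableEq κ] [AddCommGroup R]
    [UniformSpace R] [IsUniformAddGroup R] [T2Space R] [CompleteSpace R]
    {F : (κ → ℕ) → R} {S : R} (hF : HasSum F S) :
    HasSum (fun n => ∑ k ∈ Finset.piAntidiag Finset.univ n, F k) S := by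
  refine (hF.tsum_fiberwise fun k => ∑ i, k i).congr_fun fun n => ?_
  have h : (fun k : κ → ℕ => ∑ i, k i) ⁻¹' {n} =
      ((Finset.piAntidiag Finset.univ n : Finset (κ → ℕ)) : Set (κ → ℕ)) := by
    ext k
    simp [Finset.mem_piAntidiag]
  rw [h]
  exact (Finset.tsum_subtype _ F).symm

theorem theorem4 {V E : Type*} [Fintype V] [Fintype E] {K M m : ℕ}
    (G : FeynmanGraph V E K M) (kin : Kinematics K M m) (part : E → Mode K)
    (hR : G.IsRegion part) (hsoft : G.IsJetPairingSoft part) (ν : E → ℂ) :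
    ∃ a b : Fin K → ℂ, ∀ ε : ℂ, ∃ Ibar : (Fin K → ℕ) → (Fin m → ℂ) → ℂ,
      ∀ (t : Fin K → ℂ) (σ : Fin m → ℂ), G.WideAngle kin t σ →
        (∀ (n : ℕ) (v : ℂ), G.IsRegionTerm kin part n t σ ν (4 - 2 * ε) v →
          v = (∏ i, t i ^ (a i + b i * ε)) *
            ∑ k ∈ Finset.piAntidiag Finset.univ n, (∏ i, (-t i) ^ k i) * Ibar k σ) ∧
        (∀ T : ℕ → ℂ, (∀ n, G.IsRegionTerm kin part n t σ ν (4 - 2 * ε) (T n)) →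
          ∀ S : ℂ, HasSum (fun k : Fin K → ℕ => (∏ i, (-t i) ^ k i) * Ibar k σ) S →
            HasSum T ((∏ i, t i ^ (a i + b i * ε)) * S)) := by
  -- The exponent is `scalingExponent` at `D / 2 = 2 - ε`.
  refine ⟨fun i => ∑ e, (G.jetScaling part i e : ℂ) * ν e - 2 * G.jetWeight part i,
    fun i => G.jetWeight part i, fun ε => ?_⟩
  choose c hc using fun σ n => hR.exists_term_eq hsoft kin (ν, 4 - 2 * ε) σ n
  have hexp : ∀ i, MonomialFamily.scalingExponent (G.jetScaling part) (G.jetWeight part)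
      (ν, 4 - 2 * ε) i = ∑ e, (G.jetScaling part i e : ℂ) * ν e - 2 * G.jetWeight part i +
        G.jetWeight part i * ε := fun i => by
    rw [MonomialFamily.scalingExponent]
    ring
  have key : ∀ (t : Fin K → ℂ) (σ : Fin m → ℂ), G.WideAngle kin t σ → ∀ (n : ℕ) (v : ℂ),
      G.IsRegionTerm kin part n t σ ν (4 - 2 * ε) v →
      v = (∏ i, t i ^ (∑ e, (G.jetScaling part i e : ℂ) * ν e - 2 * G.jetWeight part i +
        G.jetWeight part i * ε)) * ∑ k ∈ Finset.piAntidiag Finset.univ n,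
          (∏ i, (-t i) ^ k i) * c σ (∑ i, k i) k := by
    intro t σ hw n v hv
    rw [hc σ n t v hw hv]
    simp only [hexp]
    congr 1
    refine Finset.sum_congr rfl fun k hk => ?_
    rw [(Finset.mem_piAntidiag.1 hk).1]
  -- The order is determined by the multi-index, so the coefficients found separately at each order
  -- fit together into one family. Part (2) groups the multiple series by total degree.
  refine ⟨fun k σ => c σ (∑ i, k i) k, fun t σ hw => ⟨key t σ hw, fun T hT S hS => ?_⟩⟩
  have := hS.piAntidiag.mul_left (∏ i, t i ^ (∑ e, (G.jetScaling part i e : ℂ) * ν e -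
    2 * G.jetWeight part i + G.jetWeight part i * ε))
  exact this.congr_fun fun n => key t σ hw n (T n) (hT n)
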